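/- Let $d\ge 1$, let $\Omega\subset\mathbb R^d$ be a bounded Lipschitz domain (open, connected, non-empty), let $p\in\mathbb N_0$, and let $\alpha,\beta,\sigma,\tau$ be real numbers. There are constants $C_0,C>0$, depending only on $d,\Omega,p,\alpha,\beta,\sigma,\tau$, such that the following holds. Let $A\in L^\infty(\Omega)$ be a scalar coefficient with $0<\alpha\le A\le\beta$ almost everywhere, and let $\mathcal T_H$ be a conforming decomposition of $\Omega$ into finitely many $d$-rectangles $K=\prod_{i=1}^d[a_i^K,b_i^K]$: they cover $\overline\Omega$, their interiors are disjoint, and any two that meet do so in a common face. Let $\mathcal T_H$ be shape regular and quasi-uniform, that is, $\operatorname{diam}K\le\sigma\,(b_i^K-a_i^K)$ for all $K$ and $i$, and $H:=\max_{K}\operatorname{diam}K\le\tau\operatorname{diam}K$ for all $K$. Let $\Pi_H$ be the $L^2(\Omega)$-orthogonal projection onto the space of functions that are on every $K\in\mathcal T_H$ a polynomial of degree at most $p$ in each variable, and let $W=\{w\in H^1_0(\Omega):\Pi_Hw=0\}$. For $S\subset\overline\Omega$ let $W(S)$ be the set of $w\in W$ that vanish almost everywhere outside $S$, let $\mathtt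 N^1(S)=\mathtt N(S)$ be the union of the elements $K\in\mathcal T_H$ with $K\cap\overline S\ne\emptyset$, and let $\mathtt N^{\ell}(S)=\mathtt N(\mathtt N^{\ell-1}(S))$ for $\ell\ge2$. For $G\in\mathcal T_H$, $v\in L^2(\Omega)$ and an integer $\lambda_G\ge1$, let $\mathcal D_G^{[\lambda_G]}v\in W(\mathtt N^{\lambda_G}(G))$ and $\mathcal D_Gv\in W$ be the unique solutions of $$\int_{\mathtt N^{\lambda_G}(G)}A\,\nabla\mathcal D_G^{[\lambda_G]}v\cdot\nabla w\,dx=-\int_G v\,w\,dx\quad\text{for all }w\in W(\mathtt N^{\lambda_G}(G)),$$ $$\int_{\Omega}A\,\nabla\mathcal D_Gv\cdot\nabla w\,dx=-\int_G v\,w\,dx\quad\text{for all }w\in W.$$ Then $$\|\nabla(\mathcal D_G^{[\lambda_G]}v-\mathcal D_Gv)\|_{L^2(\Omega)}\le C_0\,e^{-C\lambda_G}\,\|\nabla\mathcal D_Gv\|_{L^2(\Omega)}.$$ -/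

import Mathlib

open MeasureTheory Set Filter Topology
open scoped ContDiff Gradient

noncomputable section

namespace LOD

/-! ### Domains and meshes -/

/-- A bounded Lipschitz domain: non-empty, open, connected, bounded, and near every boundary point,
after a rotation that turns the unit vector `e` into the vertical direction, the set is the strict
epigraph of a Lipschitz function of the horizontal component `y - ⟪e, y⟫ e`. -/
structure IsLipschitzDomain {d : ℕ} (Ω : Set (EuclideanSpace ℝ (Fin d))) : Prop where
  isOpen : IsOpen Ω
  isConnected : IsConnected Ω
  isBounded : Bornology.IsBounded Ω
  lipschitz_boundary : ∀ x ∈ frontier Ω, ∃ e : EuclideanSpace ℝ (Fin d), ‖e‖ = 1 ∧ ∃ r > 0,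
    ∃ (L : NNReal) (f : EuclideanSpace ℝ (Fin d) → ℝ), LipschitzWith L f ∧
      ∀ y ∈ Metric.ball x r, y ∈ Ω ↔ f (y - inner ℝ e y • e) < inner ℝ e y

/-- The closed `d`-rectangle `∏ [aᵢ, bᵢ]` as a subset of Euclidean space. -/
def cell {d : ℕ} (K : BoxIntegral.Box (Fin d)) : Set (EuclideanSpace ℝ (Fin d)) :=
  {x | ∀ i, x i ∈ Icc (K.lower i) (K.upper i)}

/-- `F` is a face (of any dimension, `K` itself included) of the closed rectangle `K`. -/
def IsFace {d : ℕ} (F : Set (EuclideanSpace ℝ (Fin d))) (K : BoxIntegral.Box (Fin d)) : Prop :=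
  ∃ s : Fin d → Set ℝ,
    (∀ i, s i = {K.lower i} ∨ s i = {K.upper i} ∨ s i = Icc (K.lower i) (K.upper i)) ∧
    F = {x | ∀ i, x i ∈ s i}

/-- A regular (conforming) decomposition of `Ω` into finitely many `d`-rectangles: the closed
rectangles cover the closure of `Ω`, they have disjoint interiors, and two of them that meet
do so in a common face. -/
structure Mesh {d : ℕ} (Ω : Set (EuclideanSpace ℝ (Fin d))) where
  cells : Finset (BoxIntegral.Box (Fin d))
  iUnion_cell : ⋃ K ∈ cells, cell K = closure Ω
  disjoint_interior : ∀ K ∈ cells, ∀ K' ∈ cells, K ≠ K' →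
    Disjoint (interior (cell K)) (interior (cell K'))
  conforming : ∀ K ∈ cells, ∀ K' ∈ cells, (cell K ∩ cell K').Nonempty →
    IsFace (cell K ∩ cell K') K ∧ IsFace (cell K ∩ cell K') K'

variable {d : ℕ} {Ω : Set (EuclideanSpace ℝ (Fin d))}

/-- Shape regularity with constant `σ`: the diameter of every element is at most `σ` times the
diameter of its largest inscribed ball, that is, at most `σ` times each of its side lengths. -/
def Mesh.IsShapeRegular (T : Mesh Ω) (σ : ℝ) : Prop :=
  ∀ K ∈ T.cells, ∀ i, Metric.diam (cell K) ≤ σ * (K.upper i - K.lower i)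

/-- Quasi-uniformity with constant `τ`: the mesh size `H`, which is the largest diameter of an
element, is at most `τ` times the diameter of every element. -/
def Mesh.IsQuasiUniform (T : Mesh Ω) (τ : ℝ) : Prop :=
  ∀ K ∈ T.cells, ∀ K' ∈ T.cells, Metric.diam (cell K') ≤ τ * Metric.diam (cell K)

/-- The patch `N(S)`: the union of all closed elements that meet the closure of `S`. -/
def Mesh.nbhd (T : Mesh Ω) (S : Set (EuclideanSpace ℝ (Fin d))) :
    Set (EuclideanSpace ℝ (Fin d)) :=
  ⋃ K ∈ {K | K ∈ T.cells ∧ (closure S ∩ cell K).Nonempty}, cell K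

/-- The patch `N^ℓ(S)` of order `ℓ`, with `N^0(S)` the closure of `S`. -/
def Mesh.patch (T : Mesh Ω) (S : Set (EuclideanSpace ℝ (Fin d))) :
    ℕ → Set (EuclideanSpace ℝ (Fin d))
  | 0 => closure S
  | ℓ + 1 => T.nbhd (T.patch S ℓ)

theorem isClosed_cell (K : BoxIntegral.Box (Fin d)) : IsClosed (cell K) := by
  simp only [cell, mem_Icc, ofPred_forall, ofPred_and]
  refine isClosed_iInter fun i => IsClosed.inter ?_ ?_
  · exact isClosed_le continuous_const (by fun_prop)
  · exact isClosed_le (by fun_prop) continuous_const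

theorem Mesh.isClosed_patch (T : Mesh Ω) (S : Set (EuclideanSpace ℝ (Fin d))) (ℓ : ℕ) :
    IsClosed (T.patch S ℓ) := by
  cases ℓ with
  | zero => exact isClosed_closure
  | succ ℓ =>
    refine Set.Finite.isClosed_biUnion ?_ fun K _ => isClosed_cell K
    exact T.cells.finite_toSet.subset fun K hK => hK.1

/-! ### Function spaces -/

/-- `L²(Ω)`. -/
abbrev L2 (Ω : Set (EuclideanSpace ℝ (Fin d))) : Type :=
  Lp ℝ 2 (volume.restrict Ω)

/-- `L²(Ω; ℝᵈ)`. -/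
abbrev L2Vec (Ω : Set (EuclideanSpace ℝ (Fin d))) : Type :=
  Lp (EuclideanSpace ℝ (Fin d)) 2 (volume.restrict Ω)

theorem memLp_gradient {φ : EuclideanSpace ℝ (Fin d) → ℝ} (h : ContDiff ℝ ∞ φ)
    (hc : HasCompactSupport φ) (μ : Measure (EuclideanSpace ℝ (Fin d)))
    [IsFiniteMeasureOnCompacts μ] : MemLp (∇ φ) 2 μ := by
  have h1 : Continuous (∇ φ) := (InnerProductSpace.toDual ℝ _).symm.continuous.comp
    (h.continuous_fderiv (by simp))
  refine h1.memLp_of_hasCompactSupport ?_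
  exact (hc.fderiv ℝ).comp_left (g := (InnerProductSpace.toDual ℝ _).symm) (map_zero _)

/-- The pairs `(φ, ∇φ)` in `L²(Ω) × L²(Ω; ℝᵈ)`, where `φ` is a smooth function with compact support
in `Ω`. The norm of `WithLp 2` is the norm `(‖φ‖² + ‖∇φ‖²)^(1/2)` of `H¹(Ω)`. -/
def testGraph (Ω : Set (EuclideanSpace ℝ (Fin d))) :
    Submodule ℝ (WithLp 2 (L2 Ω × L2Vec Ω)) where
  carrier := {u | ∃ φ : EuclideanSpace ℝ (Fin d) → ℝ, ContDiff ℝ ∞ φ ∧ HasCompactSupport φ ∧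
    tsupport φ ⊆ Ω ∧ u.fst =ᵐ[volume.restrict Ω] φ ∧ u.snd =ᵐ[volume.restrict Ω] ∇ φ}
  zero_mem' := by
    refine ⟨0, contDiff_const, HasCompactSupport.zero, by simp [tsupport], ?_, ?_⟩
    · exact Lp.coeFn_zero ..
    · have : ∇ (0 : EuclideanSpace ℝ (Fin d) → ℝ) = 0 := by
        funext x; simp [gradient]
      rw [this]; exact Lp.coeFn_zero ..
  add_mem' := by
    rintro u v ⟨φ, h1, h2, h3, h4, h5⟩ ⟨ψ, k1, k2, k3, k4, k5⟩
    refine ⟨φ + ψ, h1.add k1, h2.add k2, (tsupport_add φ ψ).trans (union_subset h3 k3), ?_, ?_⟩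
    · exact (Lp.coeFn_add _ _).trans (h4.add k4)
    · have : ∇ (φ + ψ) = ∇ φ + ∇ ψ := by
        funext x
        simp only [gradient, Pi.add_apply]
        rw [fderiv_add (h1.differentiable (by simp) x) (k1.differentiable (by simp) x), map_add]
      rw [this]; exact (Lp.coeFn_add _ _).trans (h5.add k5)
  smul_mem' := by
    rintro c u ⟨φ, h1, h2, h3, h4, h5⟩
    refine ⟨c • φ, contDiff_const.smul h1, h2.smul_left (f := fun _ => c),
      (closure_mono (Function.support_const_smul_subset c φ)).trans h3, ?_, ?_⟩
    · exact (Lp.coeFn_smul _ _).trans (h4.const_smul c)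
    · have : ∇ (c • φ) = c • ∇ φ := by
        funext x
        simp only [gradient, Pi.smul_apply]
        rw [fderiv_const_smul (h1.differentiable (by simp) x)]; simp
      rw [this]; exact (Lp.coeFn_smul _ _).trans (h5.const_smul c)

/-- The Sobolev space `H¹₀(Ω)`, the closure of the smooth functions with compact support in `Ω` with
respect to the norm of `H¹(Ω)`. An element `u` is stored with its weak gradient:
`u.1.fst` is the function and `u.1.snd` is its weak gradient. -/
def H10 (Ω : Set (EuclideanSpace ℝ (Fin d))) : Submodule ℝ (WithLp 2 (L2 Ω × L2Vec Ω)) :=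
  (testGraph Ω).topologicalClosure

/-- The `L²` function underlying an element of `H¹₀(Ω)`. -/
def H10.toL2 : H10 Ω →L[ℝ] L2 Ω :=
  (WithLp.fstL 2 ℝ (L2 Ω) (L2Vec Ω)).comp (H10 Ω).subtypeL

/-- The weak gradient of an element of `H¹₀(Ω)`. -/
def H10.grad : H10 Ω →L[ℝ] L2Vec Ω :=
  (WithLp.sndL 2 ℝ (L2 Ω) (L2Vec Ω)).comp (H10 Ω).subtypeL

/-- The space `V_H` of functions in `L²(Ω)` that are on every element of the mesh
a polynomial of partial degree at most `p`. -/
def Mesh.polySpace (T : Mesh Ω) (p : ℕ) : Submodule ℝ (L2 Ω) where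
  carrier := {v | ∀ K ∈ T.cells, ∃ q ∈ MvPolynomial.restrictDegree (Fin d) ℝ p,
    ∀ᵐ x ∂(volume.restrict Ω), x ∈ cell K → v x = MvPolynomial.eval (fun i => x i) q}
  zero_mem' := fun K _ => ⟨0, Submodule.zero_mem _, by
    filter_upwards [Lp.coeFn_zero ℝ 2 (volume.restrict Ω)] with x hx _
    rw [hx]; simp⟩
  add_mem' := by
    intro u v hu hv K hK
    obtain ⟨q, hq, h⟩ := hu K hK
    obtain ⟨q', hq', h'⟩ := hv K hK
    refine ⟨q + q', Submodule.add_mem _ hq hq', ?_⟩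
    filter_upwards [h, h', Lp.coeFn_add u v] with x h1 h2 h3 hx
    rw [h3, Pi.add_apply, h1 hx, h2 hx, map_add]
  smul_mem' := by
    intro c u hu K hK
    obtain ⟨q, hq, h⟩ := hu K hK
    refine ⟨c • q, Submodule.smul_mem _ c hq, ?_⟩
    filter_upwards [h, Lp.coeFn_smul c u] with x h1 h3 hx
    rw [h3, Pi.smul_apply, h1 hx, MvPolynomial.smul_eval, smul_eq_mul]

instance finiteDimensional_restrictDegree (p : ℕ) :
    FiniteDimensional ℝ (MvPolynomial.restrictDegree (Fin d) ℝ p) := by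
  have : Finite {n : Fin d →₀ ℕ | ∀ i, n i ≤ p} := by
    refine Set.Finite.subset (Set.finite_Iic (Finsupp.equivFunOnFinite.symm fun _ => p)) ?_
    intro n hn i
    simpa using hn i
  exact Module.Finite.of_basis (MvPolynomial.basisRestrictSupport ℝ {n : Fin d →₀ ℕ | ∀ i, n i ≤ p})

instance Mesh.finiteDimensional_polySpace (T : Mesh Ω) (p : ℕ) :
    FiniteDimensional ℝ (T.polySpace p) := by
  let ae' : T.cells → Filter (EuclideanSpace ℝ (Fin d)) := fun K =>
    ae ((volume.restrict Ω).restrict (cell K.1))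
  let P : ∀ K : T.cells, MvPolynomial.restrictDegree (Fin d) ℝ p →ₗ[ℝ] Germ (ae' K) ℝ :=
    fun K =>
    { toFun := fun q => ((fun x => MvPolynomial.eval (fun i => x i) q.1 :
        EuclideanSpace ℝ (Fin d) → ℝ) : Germ (ae' K) ℝ)
      map_add' := by
        intro q q'
        rw [← Germ.coe_add]; congr 1; funext x; simp
      map_smul' := by
        intro c q
        rw [RingHom.id_apply, ← Germ.coe_smul]; congr 1; funext x; simp [MvPolynomial.smul_eval] }
  have hmem : ∀ (v : T.polySpace p) (K : T.cells),
      ((v.1 : EuclideanSpace ℝ (Fin d) → ℝ) : Germ (ae' K) ℝ) ∈ LinearMap.range (P K) := by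
    intro v K
    obtain ⟨q, hq, h⟩ := v.2 K.1 K.2
    refine ⟨⟨q, hq⟩, Germ.coe_eq.2 ?_⟩
    have := (ae_restrict_iff' (μ := volume.restrict Ω) (isClosed_cell K.1).measurableSet).2 h
    filter_upwards [this] with x hx using hx.symm
  let F : T.polySpace p →ₗ[ℝ] ∀ K : T.cells, LinearMap.range (P K) :=
    { toFun := fun v K => ⟨_, hmem v K⟩
      map_add' := by
        intro u v
        funext K
        refine Subtype.ext (Germ.coe_eq.2 ?_)
        exact ae_restrict_of_ae (Lp.coeFn_add u.1 v.1)
      map_smul' := by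
        intro c u
        funext K
        refine Subtype.ext (Germ.coe_eq.2 ?_)
        exact ae_restrict_of_ae (Lp.coeFn_smul c u.1) }
  refine Module.Finite.of_injective F ?_
  rw [← LinearMap.ker_eq_bot, LinearMap.ker_eq_bot']
  intro v hv
  have h0 : ∀ K ∈ T.cells, ∀ᵐ x ∂(volume.restrict Ω), x ∈ cell K → v.1 x = 0 := by
    intro K hK
    have := congrArg Subtype.val (congrFun hv ⟨K, hK⟩)
    exact (ae_restrict_iff' (isClosed_cell K).measurableSet).1 (Germ.coe_eq.1 this)
  have hc : ∀ᵐ x ∂(volume.restrict Ω), x ∈ closure Ω :=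
    ae_mono (Measure.restrict_mono subset_closure le_rfl)
      (ae_restrict_mem isClosed_closure.measurableSet)
  have h1 : ∀ᵐ x ∂(volume.restrict Ω), ∀ K ∈ T.cells, x ∈ cell K → v.1 x = 0 :=
    (Filter.eventually_all_finset T.cells).2 h0
  refine Subtype.ext (Lp.ext ?_)
  filter_upwards [hc, h1, Lp.coeFn_zero ℝ 2 (volume.restrict Ω)] with x hx h2 h3
  rw [← T.iUnion_cell] at hx
  obtain ⟨K, hK, hxK⟩ := mem_iUnion₂.1 hx
  rw [h2 K hK hxK]
  exact h3.symm

/-- The `L²`-orthogonal projection `Π_H` of `L²(Ω)` onto `V_H`. -/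
def Mesh.proj (T : Mesh Ω) (p : ℕ) : L2 Ω →L[ℝ] L2 Ω :=
  (T.polySpace p).starProjection

/-- The space `W`, the kernel of `Π_H` in `H¹₀(Ω)`. -/
def Mesh.kerProj (T : Mesh Ω) (p : ℕ) : Submodule ℝ (H10 Ω) :=
  LinearMap.ker ((T.proj p).comp H10.toL2).toLinearMap

/-- The space `W(S)` of the functions in `W` with support in `S`. -/
def Mesh.kerProjOn (T : Mesh Ω) (p : ℕ) (S : Set (EuclideanSpace ℝ (Fin d))) :
    Submodule ℝ (H10 Ω) where
  carrier := {w | w ∈ T.kerProj p ∧ ∀ᵐ x ∂(volume.restrict Ω), x ∉ S → H10.toL2 w x = 0}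
  zero_mem' := by
    refine ⟨Submodule.zero_mem _, ?_⟩
    rw [map_zero]
    filter_upwards [Lp.coeFn_zero ℝ 2 (volume.restrict Ω)] with x hx _
    rw [hx]; rfl
  add_mem' := by
    rintro u v ⟨hu, hu'⟩ ⟨hv, hv'⟩
    refine ⟨Submodule.add_mem _ hu hv, ?_⟩
    rw [map_add]
    filter_upwards [hu', hv', Lp.coeFn_add (H10.toL2 u) (H10.toL2 v)] with x h1 h2 h3 hx
    rw [h3, Pi.add_apply, h1 hx, h2 hx, add_zero]
  smul_mem' := by
    rintro c u ⟨hu, hu'⟩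
    refine ⟨Submodule.smul_mem _ c hu, ?_⟩
    rw [map_smul]
    filter_upwards [hu', Lp.coeFn_smul c (H10.toL2 u)] with x h1 h3 hx
    rw [h3, Pi.smul_apply, h1 hx, smul_zero]

/-- A scalar coefficient `A ∈ L^∞(Ω)` with `0 < α ≤ A ≤ β < ∞` almost everywhere. -/
structure Coefficient (Ω : Set (EuclideanSpace ℝ (Fin d))) (α β : ℝ) where
  toFun : EuclideanSpace ℝ (Fin d) → ℝ
  aestronglyMeasurable : AEStronglyMeasurable toFun (volume.restrict Ω)
  pos : 0 < α
  bounds : ∀ᵐ x ∂(volume.restrict Ω), α ≤ toFun x ∧ toFun x ≤ β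

/-- The form `a_S(u, w) = (A ∇u, ∇w)` in `L²(S)`. -/
def Coefficient.form {α β : ℝ} (A : Coefficient Ω α β) (S : Set (EuclideanSpace ℝ (Fin d)))
    (u w : H10 Ω) : ℝ :=
  ∫ x in S, A.toFun x * inner ℝ (H10.grad u x) (H10.grad w x) ∂(volume.restrict Ω)

/-- `z ∈ W(S)` solves `a_S(z, w) = -(v, w)_{L²(G)}` for all `w ∈ W(S)`. -/
def IsEnrichedCorrection {α β : ℝ} (A : Coefficient Ω α β) (T : Mesh Ω) (p : ℕ)
    (S : Set (EuclideanSpace ℝ (Fin d))) (G : BoxIntegral.Box (Fin d)) (v : L2 Ω)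
    (z : H10 Ω) : Prop :=
  z ∈ T.kerProjOn p S ∧ ∀ w ∈ T.kerProjOn p S,
    A.form S z w = -∫ x in cell G, v x * H10.toL2 w x ∂(volume.restrict Ω)

/-! ### Well-posedness of the corrector problems -/

theorem inner_gradient (φ : EuclideanSpace ℝ (Fin d) → ℝ) (x e : EuclideanSpace ℝ (Fin d)) :
    inner ℝ (∇ φ x) e = fderiv ℝ φ x e := by
  simp [gradient]

theorem setIntegral_eq_of_ae {f g : EuclideanSpace ℝ (Fin d) → ℝ}
    (h : f =ᵐ[volume.restrict Ω] g) (h0 : ∀ x, x ∉ Ω → g x = 0) :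
    ∫ x, f x ∂(volume.restrict Ω) = ∫ x, g x :=
  (integral_congr_ae h).trans (setIntegral_eq_integral_of_forall_compl_eq_zero h0)

/-- Integration by parts: `u.1.snd` is the weak gradient of the extension of `u` by zero. -/
theorem H10.integral_weak_grad (u : H10 Ω) {ψ : EuclideanSpace ℝ (Fin d) → ℝ}
    (hψ : ContDiff ℝ ∞ ψ) (hc : HasCompactSupport ψ) (e : EuclideanSpace ℝ (Fin d)) :
    ∫ x, ψ x * inner ℝ (H10.grad u x) e ∂(volume.restrict Ω) =
      -∫ x, H10.toL2 u x * fderiv ℝ ψ x e ∂(volume.restrict Ω) := by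
  have m1 : MemLp (fun x => ψ x • e) 2 (volume.restrict Ω) :=
    (hψ.continuous.smul continuous_const).memLp_of_hasCompactSupport (hc.smul_right)
  have hcont : Continuous fun x => fderiv ℝ ψ x e :=
    (hψ.continuous_fderiv (by simp)).clm_apply continuous_const
  have hcs : HasCompactSupport fun x => fderiv ℝ ψ x e :=
    (hc.fderiv ℝ).comp_left (g := fun l : EuclideanSpace ℝ (Fin d) →L[ℝ] ℝ => l e) rfl
  have m2 : MemLp (fun x => fderiv ℝ ψ x e) 2 (volume.restrict Ω) :=
    hcont.memLp_of_hasCompactSupport hcs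
  have e1 : ∀ g : L2Vec Ω, ∫ x, ψ x * inner ℝ (g x) e ∂(volume.restrict Ω) =
      inner ℝ g (m1.toLp _) := by
    intro g
    rw [L2.inner_def]
    refine integral_congr_ae ?_
    filter_upwards [m1.coeFn_toLp] with x hx
    rw [hx, inner_smul_right]
  have e2 : ∀ g : L2 Ω, ∫ x, g x * fderiv ℝ ψ x e ∂(volume.restrict Ω) =
      inner ℝ g (m2.toLp _) := by
    intro g
    rw [L2.inner_def]
    refine integral_congr_ae ?_
    filter_upwards [m2.coeFn_toLp] with x hx
    rw [hx]; simp [mul_comm]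
  have key : ∀ x ∈ (testGraph Ω).topologicalClosure,
      (inner ℝ x.snd (m1.toLp _) : ℝ) = -inner ℝ x.fst (m2.toLp _) := by
    intro x hx
    have hclosed : IsClosed {x : WithLp 2 (L2 Ω × L2Vec Ω) |
        (inner ℝ x.snd (m1.toLp _) : ℝ) = -inner ℝ x.fst (m2.toLp _)} :=
      isClosed_eq ((WithLp.sndL 2 ℝ (L2 Ω) (L2Vec Ω)).continuous.inner continuous_const)
        ((WithLp.fstL 2 ℝ (L2 Ω) (L2Vec Ω)).continuous.inner continuous_const).neg
    refine closure_minimal ?_ hclosed hx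
    rintro y ⟨φ, h1, h2, h3, h4, h5⟩
    change (inner ℝ y.snd (m1.toLp _) : ℝ) = -inner ℝ y.fst (m2.toLp _)
    rw [← e1, ← e2]
    have i1 : ∫ x, ψ x * inner ℝ (y.snd x) e ∂(volume.restrict Ω) =
        ∫ x, ψ x * fderiv ℝ φ x e := by
      refine setIntegral_eq_of_ae ?_ ?_
      · filter_upwards [h5] with x hx
        rw [hx, inner_gradient]
      · intro x hx
        have : x ∉ tsupport (fderiv ℝ φ) := fun h => hx (h3 (tsupport_fderiv_subset (𝕜 := ℝ) h))
        rw [image_eq_zero_of_notMem_tsupport this]; simp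
    have i2 : ∫ x, y.fst x * fderiv ℝ ψ x e ∂(volume.restrict Ω) =
        ∫ x, φ x * fderiv ℝ ψ x e := by
      refine setIntegral_eq_of_ae ?_ ?_
      · filter_upwards [h4] with x hx
        rw [hx]
      · intro x hx
        have : x ∉ tsupport φ := fun h => hx (h3 h)
        rw [image_eq_zero_of_notMem_tsupport this]; simp
    rw [i1, i2]
    have hcont' : Continuous fun x => fderiv ℝ φ x e :=
      (h1.continuous_fderiv (by simp)).clm_apply continuous_const
    have := integral_mul_fderiv_eq_neg_fderiv_mul_of_integrable
      (μ := (volume : Measure (EuclideanSpace ℝ (Fin d)))) (f := ψ) (g := φ) (v := e)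
      ((hcont.mul h1.continuous).integrable_of_hasCompactSupport h2.mul_left)
      ((hψ.continuous.mul hcont').integrable_of_hasCompactSupport hc.mul_right)
      ((hψ.continuous.mul h1.continuous).integrable_of_hasCompactSupport hc.mul_right)
      (fun x _ => hψ.differentiable (by simp) x) (fun x _ => h1.differentiable (by simp) x)
    rw [this]
    simp only [mul_comm]
  rw [e1, e2]
  exact key u.1 u.2

/-- The weak gradient of a function that vanishes outside of a closed set vanishes there, too. -/
theorem H10.grad_eq_zero (u : H10 Ω) {S : Set (EuclideanSpace ℝ (Fin d))} (hS : IsClosed S)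
    (h : ∀ᵐ x ∂(volume.restrict Ω), x ∉ S → H10.toL2 u x = 0) :
    ∀ᵐ x ∂(volume.restrict Ω), x ∉ S → H10.grad u x = 0 := by
  have hi : ∀ i : Fin d, ∀ᵐ x ∂(volume.restrict Ω), x ∈ Sᶜ →
      inner ℝ (H10.grad u x) (EuclideanSpace.single i (1 : ℝ)) = 0 := by
    intro i
    have hloc : LocallyIntegrable (fun x => inner ℝ (H10.grad u x)
        (EuclideanSpace.single i (1 : ℝ))) (volume.restrict Ω) :=
      ((Lp.memLp (H10.grad u)).inner_const _).locallyIntegrable (by norm_num)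
    refine hS.isOpen_compl.ae_eq_zero_of_integral_contDiff_smul_eq_zero
      (hloc.locallyIntegrableOn _) ?_
    intro ψ hψ hc hsub
    simp only [smul_eq_mul]
    rw [H10.integral_weak_grad u hψ hc, neg_eq_zero]
    refine integral_eq_zero_of_ae ?_
    filter_upwards [h] with x hx
    by_cases hxS : x ∈ S
    · have : x ∉ tsupport (fderiv ℝ ψ) := fun h => (hsub (tsupport_fderiv_subset (𝕜 := ℝ) h)) hxS
      rw [image_eq_zero_of_notMem_tsupport this]; simp
    · rw [hx hxS]; simp
  filter_upwards [ae_all_iff.2 hi] with x hx hxS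
  ext i
  have := hx i hxS
  simpa [EuclideanSpace.inner_single_right] using this

theorem friedrichs_aux [NeZero d] {R : ℝ} (hR0 : 0 < R) (hR : ∀ x ∈ Ω, ‖x‖ ≤ R)
    {φ : EuclideanSpace ℝ (Fin d) → ℝ} (h1 : ContDiff ℝ ∞ φ) (h2 : HasCompactSupport φ)
    (h3 : tsupport φ ⊆ Ω) :
    ∫ x, φ x ^ 2 ≤ (2 * R) ^ 2 * ∫ x, ‖fderiv ℝ φ x‖ ^ 2 := by
  obtain ⟨e, he⟩ : ∃ e : EuclideanSpace ℝ (Fin d), ‖e‖ = 1 :=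
    ⟨EuclideanSpace.single 0 1, by simp⟩
  obtain ⟨ξ, hξ⟩ : ∃ ξ : EuclideanSpace ℝ (Fin d) →L[ℝ] ℝ, ∀ x, ξ x = inner ℝ e x :=
    ⟨innerSL ℝ e, fun x => rfl⟩
  have hξe : ξ e = 1 := by rw [hξ, real_inner_self_eq_norm_sq, he, one_pow]
  have hd : ∀ x, fderiv ℝ (fun x => φ x ^ 2) x e = 2 * φ x * fderiv ℝ φ x e := by
    intro x
    have := ((h1.differentiable (by simp) x).hasFDerivAt.pow 2).fderiv
    rw [this]; simp
  have hcont' : Continuous fun x => fderiv ℝ φ x e :=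
    (h1.continuous_fderiv (by simp)).clm_apply continuous_const
  have hsq : HasCompactSupport fun x => φ x ^ 2 :=
    h2.comp_left (g := fun t : ℝ => t ^ 2) (by simp)
  have hcsq : Continuous fun x => φ x ^ 2 := h1.continuous.pow 2
  have isq : Integrable (fun x => φ x ^ 2) (volume : Measure (EuclideanSpace ℝ (Fin d))) :=
    hcsq.integrable_of_hasCompactSupport hsq
  have ifd : Integrable (fun x => ‖fderiv ℝ φ x‖ ^ 2)
      (volume : Measure (EuclideanSpace ℝ (Fin d))) := by
    have c1 : Continuous fun x => ‖fderiv ℝ φ x‖ ^ 2 :=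
      (h1.continuous_fderiv (by simp)).norm.pow 2
    refine c1.integrable_of_hasCompactSupport ((h2.fderiv (𝕜 := ℝ)).mono ?_)
    intro x hx hx'
    exact hx (by simp [hx'])
  have ib : Integrable (fun x => ξ x * (2 * φ x * fderiv ℝ φ x e))
      (volume : Measure (EuclideanSpace ℝ (Fin d))) := by
    have c1 : Continuous (fun x => ξ x * (2 * φ x * fderiv ℝ φ x e)) :=
      ξ.continuous.mul ((continuous_const.mul h1.continuous).mul hcont')
    refine c1.integrable_of_hasCompactSupport (h2.mono ?_)
    intro x hx hx'
    exact hx (by simp [hx'])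
  have ia : Integrable (fun x => ξ x * φ x ^ 2)
      (volume : Measure (EuclideanSpace ℝ (Fin d))) := by
    refine (ξ.continuous.mul hcsq).integrable_of_hasCompactSupport (h2.mono ?_)
    intro x hx hx'
    exact hx (by simp [hx'])
  have ipart := integral_mul_fderiv_eq_neg_fderiv_mul_of_integrable
      (μ := (volume : Measure (EuclideanSpace ℝ (Fin d)))) (f := ξ) (g := fun x => φ x ^ 2)
      (v := e) (by simp only [ContinuousLinearMap.fderiv, hξe, one_mul]; exact isq)
      (by
        simp only [hd]
        exact ib)
      ia
      (fun x _ => ξ.differentiableAt)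
      (fun x _ => (h1.differentiable (by simp) x).pow 2)
  simp only [hd, ContinuousLinearMap.fderiv, hξe, one_mul] at ipart
  have i2 : Integrable (fun x => φ x ^ 2 / 2)
      (volume : Measure (EuclideanSpace ℝ (Fin d))) := isq.div_const 2
  have i3 : Integrable (fun x => 2 * R ^ 2 * ‖fderiv ℝ φ x‖ ^ 2)
      (volume : Measure (EuclideanSpace ℝ (Fin d))) := ifd.const_mul (2 * R ^ 2)
  have ir : Integrable (fun x => φ x ^ 2 / 2 + 2 * R ^ 2 * ‖fderiv ℝ φ x‖ ^ 2)
      (volume : Measure (EuclideanSpace ℝ (Fin d))) := i2.add i3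
  have hle : ∫ x, φ x ^ 2 ≤ ∫ x, (φ x ^ 2 / 2 + 2 * R ^ 2 * ‖fderiv ℝ φ x‖ ^ 2) := by
    have : ∫ x, φ x ^ 2 = ∫ x, -(ξ x * (2 * φ x * fderiv ℝ φ x e)) := by
      rw [integral_neg, ipart, neg_neg]
    rw [this]
    have ic : Integrable (fun x => -(ξ x * (2 * φ x * fderiv ℝ φ x e)))
        (volume : Measure (EuclideanSpace ℝ (Fin d))) := ib.neg
    have pw : ∀ x, -(ξ x * (2 * φ x * fderiv ℝ φ x e)) ≤
        φ x ^ 2 / 2 + 2 * R ^ 2 * ‖fderiv ℝ φ x‖ ^ 2 := by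
      intro x
      by_cases hx : x ∈ Ω
      · have b1 : |ξ x| ≤ R := by
          have := abs_real_inner_le_norm e x
          rw [he, one_mul] at this
          rw [hξ]
          exact this.trans (hR x hx)
        have b2 : |fderiv ℝ φ x e| ≤ ‖fderiv ℝ φ x‖ := by
          have := (fderiv ℝ φ x).le_opNorm e
          rwa [he, mul_one] at this
        have b3 : |ξ x * fderiv ℝ φ x e| ≤ R * ‖fderiv ℝ φ x‖ := by
          rw [abs_mul]
          exact mul_le_mul b1 b2 (abs_nonneg _) hR0.le
        have b4 : (ξ x * fderiv ℝ φ x e) ^ 2 ≤ (R * ‖fderiv ℝ φ x‖) ^ 2 :=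
          sq_le_sq' (by linarith [neg_abs_le (ξ x * fderiv ℝ φ x e)])
            ((le_abs_self _).trans b3)
        nlinarith [sq_nonneg (φ x + 2 * (ξ x * fderiv ℝ φ x e))]
      · have : x ∉ tsupport φ := fun h => hx (h3 h)
        rw [image_eq_zero_of_notMem_tsupport this]
        have : 0 ≤ 2 * R ^ 2 * ‖fderiv ℝ φ x‖ ^ 2 := by positivity
        simpa using this
    exact integral_mono ic ir pw
  rw [integral_add i2 i3, integral_div, integral_const_mul] at hle
  linarith

/-- The Friedrichs inequality. -/
theorem H10.norm_le_grad [NeZero d] (hb : Bornology.IsBounded Ω) :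
    ∃ R : ℝ, 0 ≤ R ∧ ∀ u : H10 Ω, ‖H10.toL2 u‖ ≤ R * ‖H10.grad u‖ := by
  obtain ⟨R, hR0, hR⟩ := hb.exists_pos_norm_le
  refine ⟨2 * R, by positivity, ?_⟩
  suffices h : ∀ x ∈ (testGraph Ω).topologicalClosure, ‖x.fst‖ ≤ 2 * R * ‖x.snd‖ from
    fun u => h u.1 u.2
  intro x hx
  have hclosed : IsClosed {x : WithLp 2 (L2 Ω × L2Vec Ω) | ‖x.fst‖ ≤ 2 * R * ‖x.snd‖} :=
    isClosed_le (WithLp.fstL 2 ℝ (L2 Ω) (L2Vec Ω)).continuous.norm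
      (continuous_const.mul (WithLp.sndL 2 ℝ (L2 Ω) (L2Vec Ω)).continuous.norm)
  refine closure_minimal ?_ hclosed hx
  rintro y ⟨φ, h1, h2, h3, h4, h5⟩
  change ‖y.fst‖ ≤ 2 * R * ‖y.snd‖
  have n1 : ‖y.fst‖ ^ 2 = ∫ x, φ x ^ 2 := by
    rw [← real_inner_self_eq_norm_sq, L2.inner_def]
    refine setIntegral_eq_of_ae ?_ ?_
    · filter_upwards [h4] with x hx
      rw [hx]; simp [sq]
    · intro x hx
      have : x ∉ tsupport φ := fun h => hx (h3 h)
      rw [image_eq_zero_of_notMem_tsupport this]; simp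
  have n2 : ‖y.snd‖ ^ 2 = ∫ x, ‖fderiv ℝ φ x‖ ^ 2 := by
    rw [← real_inner_self_eq_norm_sq, L2.inner_def]
    refine setIntegral_eq_of_ae ?_ ?_
    · filter_upwards [h5] with x hx
      rw [hx, real_inner_self_eq_norm_sq]; simp [gradient]
    · intro x hx
      have : x ∉ tsupport (fderiv ℝ φ) := fun h => hx (h3 (tsupport_fderiv_subset (𝕜 := ℝ) h))
      rw [image_eq_zero_of_notMem_tsupport this]; simp
  have := friedrichs_aux hR0 hR h1 h2 h3
  rw [← n1, ← n2, ← mul_pow] at this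
  exact le_of_sq_le_sq this (by positivity)

theorem Mesh.isBounded (T : Mesh Ω) : Bornology.IsBounded Ω := by
  refine Bornology.IsBounded.subset ?_ (subset_closure (s := Ω))
  rw [← T.iUnion_cell]
  refine (Bornology.isBounded_biUnion_finset T.cells).2 fun K _ => ?_
  have h : cell K = WithLp.ofLp ⁻¹' (BoxIntegral.Box.Icc K) := by
    ext x; simp [cell, BoxIntegral.Box.Icc_def, Pi.le_def, forall_and]
  rw [h]
  exact (PiLp.antilipschitzWith_ofLp 2 _).isBounded_preimage K.isBounded_Icc

theorem Mesh.isClosed_kerProjOn (T : Mesh Ω) (p : ℕ) {S : Set (EuclideanSpace ℝ (Fin d))}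
    (hS : IsClosed S) : IsClosed (T.kerProjOn p S : Set (H10 Ω)) := by
  have h1 : IsClosed {w : H10 Ω | T.proj p (H10.toL2 w) = 0} :=
    isClosed_eq ((T.proj p).continuous.comp H10.toL2.continuous) continuous_const
  let r : L2 Ω →L[ℝ] Lp ℝ 2 ((volume.restrict Ω).restrict Sᶜ) :=
    LpToLpRestrictCLM (EuclideanSpace ℝ (Fin d)) ℝ ℝ (volume.restrict Ω) 2 Sᶜ
  have h2 : IsClosed {w : H10 Ω | r (H10.toL2 w) = 0} :=
    isClosed_eq (r.continuous.comp H10.toL2.continuous) continuous_const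
  convert h1.inter h2 using 1
  ext w
  refine and_congr Iff.rfl ?_
  change _ ↔ r (H10.toL2 w) = 0
  rw [Lp.eq_zero_iff_ae_eq_zero]
  have h3 := LpToLpRestrictCLM_coeFn (X := EuclideanSpace ℝ (Fin d)) (F := ℝ) ℝ
    (p := 2) (μ := volume.restrict Ω) Sᶜ (H10.toL2 w)
  change _ ↔ ∀ᵐ x ∂((volume.restrict Ω).restrict Sᶜ), r (H10.toL2 w) x = 0
  have h4 : (∀ᵐ x ∂((volume.restrict Ω).restrict Sᶜ), r (H10.toL2 w) x = 0) ↔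
      ∀ᵐ x ∂((volume.restrict Ω).restrict Sᶜ), H10.toL2 w x = 0 :=
    eventually_congr (h3.mono fun x hx => by rw [hx])
  rw [h4, ae_restrict_iff' hS.isOpen_compl.measurableSet]
  rfl

section form

variable {α β : ℝ} (A : Coefficient Ω α β) (S : Set (EuclideanSpace ℝ (Fin d)))

theorem Coefficient.integrable_form (u w : H10 Ω) :
    Integrable (fun x => A.toFun x * inner ℝ (H10.grad u x) (H10.grad w x))
      (volume.restrict Ω) := by
  refine (L2.integrable_inner (𝕜 := ℝ) (H10.grad u) (H10.grad w)).bdd_mul (c := max |α| |β|)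
    A.aestronglyMeasurable ?_
  filter_upwards [A.bounds] with x hx
  exact abs_le_max_abs_abs hx.1 hx.2

theorem Coefficient.form_comm (u w : H10 Ω) : A.form S u w = A.form S w u := by
  unfold Coefficient.form
  exact integral_congr_ae (Eventually.of_forall fun x => by
    change _ * _ = _ * _
    rw [real_inner_comm])

theorem Coefficient.form_add (u u' w : H10 Ω) :
    A.form S (u + u') w = A.form S u w + A.form S u' w := by
  unfold Coefficient.form
  rw [← integral_add (A.integrable_form u w).integrableOn (A.integrable_form u' w).integrableOn,
    map_add]
  refine integral_congr_ae (ae_restrict_of_ae ?_)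
  filter_upwards [Lp.coeFn_add (H10.grad u) (H10.grad u')] with x hx
  rw [hx, Pi.add_apply, inner_add_left, mul_add]

theorem Coefficient.form_smul (c : ℝ) (u w : H10 Ω) :
    A.form S (c • u) w = c * A.form S u w := by
  unfold Coefficient.form
  rw [← integral_const_mul, map_smul]
  refine integral_congr_ae (ae_restrict_of_ae ?_)
  filter_upwards [Lp.coeFn_smul c (H10.grad u)] with x hx
  rw [hx, Pi.smul_apply, inner_smul_left]
  simp only [conj_trivial]
  ring

theorem Coefficient.form_self_nonneg (u : H10 Ω) : 0 ≤ A.form S u u := by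
  refine integral_nonneg_of_ae (ae_restrict_of_ae ?_)
  filter_upwards [A.bounds] with x hx
  exact mul_nonneg (A.pos.le.trans hx.1) real_inner_self_nonneg

theorem Coefficient.form_self_le (u : H10 Ω) : A.form S u u ≤ β * ‖H10.grad u‖ ^ 2 := by
  rw [← real_inner_self_eq_norm_sq, L2.inner_def, ← integral_const_mul]
  have hi := A.integrable_form u u
  have hj : Integrable (fun x => β * inner ℝ (H10.grad u x) (H10.grad u x))
      (volume.restrict Ω) := (L2.integrable_inner (𝕜 := ℝ) _ _).const_mul β
  refine (setIntegral_le_integral hi ?_).trans (integral_mono_ae hi hj ?_)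
  · filter_upwards [A.bounds] with x hx
    exact mul_nonneg (A.pos.le.trans hx.1) real_inner_self_nonneg
  · filter_upwards [A.bounds] with x hx
    exact mul_le_mul_of_nonneg_right hx.2 real_inner_self_nonneg

theorem Coefficient.le_form_self (u : H10 Ω) (hS : IsClosed S)
    (h : ∀ᵐ x ∂(volume.restrict Ω), x ∉ S → H10.toL2 u x = 0) :
    α * ‖H10.grad u‖ ^ 2 ≤ A.form S u u := by
  have hi := A.integrable_form u u
  have hj : Integrable (fun x => α * inner ℝ (H10.grad u x) (H10.grad u x))
      (volume.restrict Ω) := (L2.integrable_inner (𝕜 := ℝ) _ _).const_mul α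
  have : A.form S u u =
      ∫ x, A.toFun x * inner ℝ (H10.grad u x) (H10.grad u x) ∂(volume.restrict Ω) := by
    refine setIntegral_eq_integral_of_ae_compl_eq_zero ?_
    filter_upwards [H10.grad_eq_zero u hS h] with x hx hxS
    rw [hx hxS]; simp
  rw [this, ← real_inner_self_eq_norm_sq, L2.inner_def, ← integral_const_mul]
  refine integral_mono_ae hj hi ?_
  filter_upwards [A.bounds] with x hx
  exact mul_le_mul_of_nonneg_right hx.1 real_inner_self_nonneg

end form

/-- The form `a_S` as a bilinear map. -/
def Coefficient.bilinForm {α β : ℝ} (A : Coefficient Ω α β)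
    (S : Set (EuclideanSpace ℝ (Fin d))) : LinearMap.BilinForm ℝ (H10 Ω) :=
  LinearMap.mk₂ ℝ (A.form S) (A.form_add S) (fun c u w => A.form_smul S c u w)
    (fun u w w' => by
      rw [A.form_comm S u, A.form_add, A.form_comm S w, A.form_comm S w'])
    (fun c u w => by
      rw [A.form_comm S u, A.form_smul, A.form_comm S w]; rfl)

theorem H10.norm_sq (u : H10 Ω) : ‖u‖ ^ 2 = ‖H10.toL2 u‖ ^ 2 + ‖H10.grad u‖ ^ 2 :=
  WithLp.prod_norm_sq_eq_of_L2 u.1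

theorem Coefficient.abs_form_le {α β : ℝ} (A : Coefficient Ω α β)
    (S : Set (EuclideanSpace ℝ (Fin d))) (u w : H10 Ω) :
    |A.form S u w| ≤ |β| * ‖u‖ * ‖w‖ := by
  have hb : ∀ u : H10 Ω, A.form S u u ≤ |β| * ‖u‖ ^ 2 := fun u =>
    (A.form_self_le S u).trans (mul_le_mul (le_abs_self β)
      (by rw [H10.norm_sq u]; linarith [sq_nonneg ‖H10.toL2 u‖]) (by positivity) (abs_nonneg β))
  have hcs : A.form S u w * A.form S w u ≤ A.form S u u * A.form S w w :=
    LinearMap.BilinForm.apply_mul_apply_le_of_forall_zero_le (A.bilinForm S)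
      (A.form_self_nonneg S) u w
  rw [A.form_comm S w u] at hcs
  refine abs_le_of_sq_le_sq ?_ (by positivity)
  calc A.form S u w ^ 2 ≤ A.form S u u * A.form S w w := by rw [sq]; exact hcs
    _ ≤ (|β| * ‖u‖ ^ 2) * (|β| * ‖w‖ ^ 2) :=
        mul_le_mul (hb u) (hb w) (A.form_self_nonneg S w) (by positivity)
    _ = (|β| * ‖u‖ * ‖w‖) ^ 2 := by ring

theorem exists_rhs (G : BoxIntegral.Box (Fin d)) (v : L2 Ω) :
    ∃ F : H10 Ω →L[ℝ] ℝ, ∀ w, F w =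
      -∫ x in cell G, v x * H10.toL2 w x ∂(volume.restrict Ω) := by
  let r : L2 Ω →L[ℝ] Lp ℝ 2 ((volume.restrict Ω).restrict (cell G)) :=
    LpToLpRestrictCLM (EuclideanSpace ℝ (Fin d)) ℝ ℝ (volume.restrict Ω) 2 (cell G)
  refine ⟨-((innerSL ℝ (r v)).comp (r.comp H10.toL2)), fun w => ?_⟩
  change -(inner ℝ (r v) (r (H10.toL2 w)) : ℝ) = _
  rw [L2.inner_def]
  congr 1
  refine integral_congr_ae ?_
  have h3 := fun g : L2 Ω => LpToLpRestrictCLM_coeFn (X := EuclideanSpace ℝ (Fin d)) (F := ℝ) ℝ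
    (p := 2) (μ := volume.restrict Ω) (cell G) g
  filter_upwards [h3 v, h3 (H10.toL2 w)] with x h1 h2
  change inner ℝ (r v x) (r (H10.toL2 w) x) = _
  rw [h1, h2]
  simp [mul_comm]

instance : CompleteSpace (H10 Ω) :=
  (Submodule.isClosed_topologicalClosure (testGraph Ω)).completeSpace_coe

theorem existsUnique_of_coercive {E : Type*} [NormedAddCommGroup E] [InnerProductSpace ℝ E]
    (V : Submodule ℝ E) [CompleteSpace V] (a : LinearMap.BilinForm ℝ E) {M c : ℝ}
    (hM : ∀ u w, |a u w| ≤ M * ‖u‖ * ‖w‖) (hc : 0 < c) (hcoer : ∀ u ∈ V, c * ‖u‖ * ‖u‖ ≤ a u u)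
    (F : E →L[ℝ] ℝ) : ∃! z, z ∈ V ∧ ∀ w ∈ V, a z w = F w := by
  let B : V →L[ℝ] V →L[ℝ] ℝ :=
    LinearMap.mkContinuous₂ (a.compl₁₂ V.subtype V.subtype) M (fun u w => hM u.1 w.1)
  have hB : ∀ u w : V, B u w = a u.1 w.1 := fun u w => rfl
  have hBc : IsCoercive B := ⟨c, hc, fun u => hcoer u.1 u.2⟩
  let f : V := (InnerProductSpace.toDual ℝ V).symm (F.comp V.subtypeL)
  let z : V := hBc.continuousLinearEquivOfBilin.symm f
  have hz : ∀ w : V, a z.1 w.1 = F w.1 := by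
    intro w
    rw [← hB, ← hBc.continuousLinearEquivOfBilin_apply]
    simp only [z, ContinuousLinearEquiv.apply_symm_apply]
    simp [f]
  refine ⟨z.1, ⟨z.2, fun w hw => hz ⟨w, hw⟩⟩, ?_⟩
  rintro y ⟨hy, hy'⟩
  have hyz : y - z.1 ∈ V := V.sub_mem hy z.2
  have h5 := hcoer _ hyz
  rw [LinearMap.map_sub₂, hy' _ hyz, hz ⟨_, hyz⟩, sub_self] at h5
  by_contra hne
  have : 0 < ‖y - z.1‖ := norm_pos_iff.2 (sub_ne_zero.2 hne)
  have : 0 < c * ‖y - z.1‖ * ‖y - z.1‖ := by positivity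
  linarith

theorem existsUnique_enrichedCorrection [NeZero d] {α β : ℝ} (A : Coefficient Ω α β) (T : Mesh Ω)
    (p : ℕ) {S : Set (EuclideanSpace ℝ (Fin d))} (hS : IsClosed S)
    (G : BoxIntegral.Box (Fin d)) (v : L2 Ω) :
    ∃! z, IsEnrichedCorrection A T p S G v z := by
  have hV : CompleteSpace (T.kerProjOn p S) := (T.isClosed_kerProjOn p hS).completeSpace_coe
  obtain ⟨R, hR0, hR⟩ := H10.norm_le_grad (Ω := Ω) T.isBounded
  obtain ⟨F, hF⟩ := exists_rhs G v
  have h := existsUnique_of_coercive (T.kerProjOn p S) (A.bilinForm S) (A.abs_form_le S)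
    (div_pos A.pos (by positivity : 0 < R ^ 2 + 1)) (fun u hu => ?_) F
  · simp only [hF] at h
    exact h
  · have h1 := A.le_form_self S u hS hu.2
    have h2 := H10.norm_sq u
    have h3 : ‖H10.toL2 u‖ ^ 2 ≤ (R * ‖H10.grad u‖) ^ 2 :=
      pow_le_pow_left₀ (norm_nonneg _) (hR u) 2
    refine le_trans ?_ h1
    have h4 : ‖u‖ * ‖u‖ ≤ (R ^ 2 + 1) * ‖H10.grad u‖ ^ 2 := by
      rw [← sq, h2]
      nlinarith
    rw [mul_assoc, div_mul_eq_mul_div, div_le_iff₀ (by positivity)]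
    nlinarith [A.pos]

/-- The localized element-wise enriched correction operator `D_G^[ℓ]`: the unique
`D_G^[ℓ] v ∈ W(N^ℓ(G))` with `a_{N^ℓ(G)}(D_G^[ℓ] v, w) = -(v, w)_{L²(G)}` for all
`w ∈ W(N^ℓ(G))`. -/
def localEnrichedCorrector [NeZero d] {α β : ℝ} (A : Coefficient Ω α β) (T : Mesh Ω) (p : ℕ)
    (G : BoxIntegral.Box (Fin d)) (ℓ : ℕ) (v : L2 Ω) : H10 Ω :=
  (existsUnique_enrichedCorrection A T p (T.isClosed_patch (cell G) ℓ) G v).choose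

theorem localEnrichedCorrector_spec [NeZero d] {α β : ℝ} (A : Coefficient Ω α β) (T : Mesh Ω)
    (p : ℕ) (G : BoxIntegral.Box (Fin d)) (ℓ : ℕ) (v : L2 Ω) :
    IsEnrichedCorrection A T p (T.patch (cell G) ℓ) G v (localEnrichedCorrector A T p G ℓ v) :=
  (existsUnique_enrichedCorrection A T p (T.isClosed_patch (cell G) ℓ) G v).choose_spec.1

/-- The global element-wise enriched correction operator `D_G`, whose patch is the whole domain:
the unique `D_G v ∈ W` with `a(D_G v, w) = -(v, w)_{L²(G)}` for all `w ∈ W`. -/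
def enrichedCorrector [NeZero d] {α β : ℝ} (A : Coefficient Ω α β) (T : Mesh Ω) (p : ℕ)
    (G : BoxIntegral.Box (Fin d)) (v : L2 Ω) : H10 Ω :=
  (existsUnique_enrichedCorrection A T p (isClosed_closure (s := Ω)) G v).choose

theorem enrichedCorrector_spec [NeZero d] {α β : ℝ} (A : Coefficient Ω α β) (T : Mesh Ω) (p : ℕ)
    (G : BoxIntegral.Box (Fin d)) (v : L2 Ω) :
    IsEnrichedCorrection A T p (closure Ω) G v (enrichedCorrector A T p G v) :=
  (existsUnique_enrichedCorrection A T p (isClosed_closure (s := Ω)) G v).choose_spec.1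

end LOD

end

/-!
The corrector `z = D_G v` satisfies `a(z, w) = 0` for all `w ∈ W` that vanish on `G`. Given a patch
around `G`, multiply `z` by a cutoff that is `0` on the patch and `1` outside one further layer of
elements. The product is no longer in `W`, but its moments are wrong only in that layer, where they
are corrected element by element with bubble functions dual to the polynomials of degree at most
`p`; since `z` has mean zero on every element, Poincaré's inequality bounds the resulting `w ∈ W`
element by element by the energy of `z`. Testing with `w` shows that the energy of `z` outside the
enlarged patch is at most a constant times its energy in the layer, so enlarging the patch by one
layer reduces the outside energy by a fixed factor `θ < 1`. The localized corrector is
quasi-optimal in `W(N^ℓ(G))`, and comparing it with `z - w` turns this decay into the error bound.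
-/

namespace LOD

variable {d : ℕ} {Ω : Set (EuclideanSpace ℝ (Fin d))}

open scoped Distributions

/-! ### Cells, meshes and layers of cells -/

section Cell

variable (K : BoxIntegral.Box (Fin d))

theorem cell_eq_preimage :
    cell K = (EuclideanSpace.equiv (Fin d) ℝ).toHomeomorph ⁻¹'
      (Set.univ.pi fun i => Icc (K.lower i) (K.upper i)) := by
  ext x
  exact ⟨fun hx i _ => hx i, fun hx i => hx i (mem_univ i)⟩

theorem interior_cell :
    interior (cell K) = {x | ∀ i, x i ∈ Ioo (K.lower i) (K.upper i)} := by
  rw [cell_eq_preimage, ← Homeomorph.preimage_interior, interior_pi_set finite_univ]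
  ext x
  simp

theorem convex_cell : Convex ℝ (cell K) :=
  fun _ hx _ hy _ _ ha hb hab i => convex_Icc _ _ (hx i) (hy i) ha hb hab

theorem nonempty_interior_cell : (interior (cell K)).Nonempty := by
  rw [interior_cell]
  choose x hx using fun i => nonempty_Ioo.2 (K.lower_lt_upper i)
  exact ⟨WithLp.toLp 2 x, hx⟩

theorem closure_interior_cell : closure (interior (cell K)) = cell K := by
  rw [(convex_cell K).closure_interior_eq_closure_of_nonempty_interior (nonempty_interior_cell K),
    (isClosed_cell K).closure_eq]

theorem measurableSet_cell : MeasurableSet (cell K) :=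
  (isClosed_cell K).measurableSet

theorem isCompact_cell : IsCompact (cell K) := by
  rw [cell_eq_preimage, Homeomorph.isCompact_preimage]
  exact isCompact_univ_pi fun _ => isCompact_Icc

theorem interior_cell_ae_eq : interior (cell K) =ᵐ[volume] cell K :=
  interior_ae_eq_of_null_frontier ((convex_cell K).addHaar_frontier volume)

theorem volume_real_cell_pos : 0 < volume.real (cell K) :=
  ENNReal.toReal_pos
    (Measure.measure_pos_of_nonempty_interior _ (nonempty_interior_cell K)).ne'
    (isCompact_cell K).measure_lt_top.ne

end Cell

theorem IsLipschitzDomain.interior_closure_eq (hΩ : IsLipschitzDomain Ω) :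
    interior (closure Ω) = Ω := by
  refine Subset.antisymm (fun x hx => ?_) (interior_maximal subset_closure hΩ.isOpen)
  by_contra hxΩ
  have hx_frontier : x ∈ frontier Ω := by
    rw [hΩ.isOpen.frontier_eq]
    exact ⟨interior_subset hx, hxΩ⟩
  obtain ⟨e, he, r, hr, L, f, hf, hΩf⟩ := hΩ.lipschitz_boundary x hx_frontier
  have hf_cont : Continuous f := hf.continuous
  let height : EuclideanSpace ℝ (Fin d) → ℝ := fun y => inner ℝ e y - f (y - inner ℝ e y • e)
  have height_cont : Continuous height := by fun_prop
  have height_le : height x ≤ 0 :=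
    sub_nonpos.2 (not_lt.1 fun h => hxΩ ((hΩf x (Metric.mem_ball_self hr)).2 h))
  have height_sub (t : ℝ) : height (x - t • e) = height x - t := by
    have h_inner : inner ℝ e (x - t • e) = inner ℝ e x - t := by
      rw [inner_sub_right, inner_smul_right, real_inner_self_eq_norm_sq, he, one_pow, mul_one]
    have h_horizontal : x - t • e - (inner ℝ e x - t) • e = x - inner ℝ e x • e := by module
    simp only [height, h_inner, h_horizontal]
    ring
  have below_tendsto : Tendsto (fun t : ℝ => x - t • e) (𝓝[>] 0) (𝓝 x) :=
    (Continuous.tendsto' (by fun_prop) 0 x (by simp)).mono_left nhdsWithin_le_nhds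
  obtain ⟨t, ⟨ht_ball, ht_closure⟩, ht⟩ :=
    ((below_tendsto.eventually (inter_mem (Metric.ball_mem_nhds x hr)
      (mem_interior_iff_mem_nhds.1 hx))).and self_mem_nhdsWithin).exists
  have ht_below : x - t • e ∈ {y | height y < 0} := by
    rw [mem_ofPred_eq, height_sub]
    exact sub_neg.2 (height_le.trans_lt ht)
  obtain ⟨y, ⟨hy_below, hy_ball⟩, hyΩ⟩ := mem_closure_iff.1 ht_closure _
    ((isOpen_lt height_cont continuous_const).inter Metric.isOpen_ball) ⟨ht_below, ht_ball⟩
  exact lt_asymm hy_below (sub_pos.2 ((hΩf y hy_ball).1 hyΩ))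

namespace Mesh

variable (T : Mesh Ω) {K K' : BoxIntegral.Box (Fin d)}

theorem disjoint_interior_cell (hK : K ∈ T.cells) (hK' : K' ∈ T.cells) (h : K ≠ K') :
    Disjoint (interior (cell K)) (cell K') := by
  rw [← closure_interior_cell K']
  exact (T.disjoint_interior K hK K' hK' h).closure_right isOpen_interior

theorem aedisjoint_cell (hK : K ∈ T.cells) (hK' : K' ∈ T.cells) (h : K ≠ K') :
    AEDisjoint volume (cell K) (cell K') :=
  (T.disjoint_interior_cell hK hK' h).aedisjoint.congr (interior_cell_ae_eq K).symm ae_eq_rfl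

theorem ae_notMem_cell (hK : K ∈ T.cells) (hK' : K' ∈ T.cells) (h : K ≠ K') :
    ∀ᵐ x ∂(volume.restrict Ω), x ∈ cell K → x ∉ cell K' := by
  refine ae_restrict_of_ae ?_
  filter_upwards [measure_eq_zero_iff_ae_notMem.1 (T.aedisjoint_cell hK hK' h)] with x hx hxK hxK'
  exact hx ⟨hxK, hxK'⟩

theorem exists_mem_cell {x : EuclideanSpace ℝ (Fin d)} (hx : x ∈ Ω) :
    ∃ K ∈ T.cells, x ∈ cell K := by
  simpa only [← T.iUnion_cell, mem_iUnion₂, exists_prop] using subset_closure hx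

theorem ae_exists_mem_cell : ∀ᵐ x ∂(volume.restrict Ω), ∃ K ∈ T.cells, x ∈ cell K := by
  have h : ∀ᵐ x ∂(volume.restrict Ω), x ∈ closure Ω :=
    ae_mono (Measure.restrict_mono subset_closure le_rfl)
      (ae_restrict_mem isClosed_closure.measurableSet)
  filter_upwards [h] with x hx
  simpa only [← T.iUnion_cell, mem_iUnion₂, exists_prop] using hx

theorem ae_of_forall_cell {P : EuclideanSpace ℝ (Fin d) → Prop}
    (h : ∀ K ∈ T.cells, ∀ᵐ x ∂(volume.restrict Ω), x ∈ cell K → P x) :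
    ∀ᵐ x ∂(volume.restrict Ω), P x := by
  filter_upwards [T.ae_exists_mem_cell, (eventually_all_finset T.cells).2 h] with x ⟨K, hK, hx⟩ hP
  exact hP K hK hx

theorem sum_setIntegral_cell {f : EuclideanSpace ℝ (Fin d) → ℝ}
    (hf : Integrable f (volume.restrict Ω)) :
    ∑ K ∈ T.cells, ∫ x in cell K, f x ∂(volume.restrict Ω) = ∫ x, f x ∂(volume.restrict Ω) := by
  rw [← setIntegral_eq_integral_of_ae_compl_eq_zero (s := ⋃ K : T.cells, cell K.1),
    integral_iUnion_ae (s := fun K : T.cells => cell K.1)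
      (fun K => (measurableSet_cell K.1).nullMeasurableSet) ?_ hf.integrableOn,
    tsum_fintype, Finset.sum_coe_sort T.cells fun K => ∫ x in cell K, f x ∂(volume.restrict Ω)]
  · exact fun K K' h => Measure.absolutelyContinuous_of_le Measure.restrict_le_self
      (T.aedisjoint_cell K.2 K'.2 (Subtype.coe_ne_coe.2 h))
  · filter_upwards [T.ae_exists_mem_cell] with x ⟨K, hK, hxK⟩ hx
    exact absurd (mem_iUnion.2 ⟨⟨K, hK⟩, hxK⟩) hx

theorem interior_cell_subset (hΩ : interior (closure Ω) = Ω) (hK : K ∈ T.cells) :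
    interior (cell K) ⊆ Ω := by
  rw [← hΩ, ← T.iUnion_cell]
  exact interior_mono (subset_biUnion_of_mem (u := fun K => cell K) hK)

theorem restrict_restrict_cell (hΩ : interior (closure Ω) = Ω) (hK : K ∈ T.cells) :
    (volume.restrict Ω).restrict (cell K) = volume.restrict (cell K) := by
  rw [Measure.restrict_restrict (measurableSet_cell K),
    ← Measure.restrict_congr_set (interior_cell_ae_eq K)]
  refine Measure.restrict_congr_set ?_
  have h := (interior_cell_ae_eq K).symm.inter (ae_eq_refl Ω)
  rwa [inter_eq_left.2 (T.interior_cell_subset hΩ hK)] at h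

end Mesh

theorem Icc_adjacent_or_eq {a b a' b' : ℝ} (hab : a < b) (hab' : a' < b') {I : Set ℝ}
    (hI : I = Icc a b ∩ Icc a' b') (h : I = {a} ∨ I = {b} ∨ I = Icc a b)
    (h' : I = {a'} ∨ I = {b'} ∨ I = Icc a' b') :
    b' = a ∨ a' = b ∨ a' = a ∧ b' = b := by
  rw [Icc_inter_Icc] at hI
  subst hI
  rw [Icc_eq_singleton_iff, Icc_eq_singleton_iff] at h h'
  have eq_of_Icc_eq {u v u' v' : ℝ} (huv : u < v) (e : Icc u' v' = Icc u v) :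
      u' = u ∧ v' = v := by
    have hu : u ∈ Icc u' v' := e ▸ left_mem_Icc.2 huv.le
    have hv : v ∈ Icc u' v' := e ▸ right_mem_Icc.2 huv.le
    have hu' : u' ∈ Icc u v := e ▸ left_mem_Icc.2 (hu.1.trans hu.2)
    have hv' : v' ∈ Icc u v := e ▸ right_mem_Icc.2 (hu.1.trans hu.2)
    exact ⟨le_antisymm hu.1 hu'.1, le_antisymm hv'.2 hv.2⟩
  have h₁ := h.imp_right (Or.imp_right (eq_of_Icc_eq hab))
  have h₁' := h'.imp_right (Or.imp_right (eq_of_Icc_eq hab'))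
  rcases le_total a a' with ha | ha <;> rcases le_total b b' with hb | hb <;>
    simp only [ha, hb, sup_of_le_left, sup_of_le_right, inf_of_le_left, inf_of_le_right]
      at h₁ h₁' <;>
    grind

theorem toLp_update_mem_iff {s : Fin d → Set ℝ} {x : EuclideanSpace ℝ (Fin d)}
    (hx : ∀ j, x j ∈ s j) (i : Fin d) (t : ℝ) :
    (∀ j, (WithLp.toLp 2 (Function.update x.ofLp i t) : EuclideanSpace ℝ (Fin d)) j ∈ s j) ↔
      t ∈ s i := by
  refine ⟨fun h => by simpa using h i, fun ht j => ?_⟩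
  obtain rfl | hj := eq_or_ne j i
  · simpa using ht
  · simpa [hj] using hx j

theorem IsFace.slice_eq {F : Set (EuclideanSpace ℝ (Fin d))} {K : BoxIntegral.Box (Fin d)}
    (hF : IsFace F K) {x : EuclideanSpace ℝ (Fin d)} (hx : x ∈ F) (i : Fin d) {I : Set ℝ}
    (hI : ∀ t, t ∈ I ↔ WithLp.toLp 2 (Function.update x.ofLp i t) ∈ F) :
    I = {K.lower i} ∨ I = {K.upper i} ∨ I = Icc (K.lower i) (K.upper i) := by
  obtain ⟨s, hs, rfl⟩ := hF
  rw [show I = s i from Set.ext fun t => (hI t).trans (toLp_update_mem_iff hx i t)]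
  exact hs i

namespace Mesh

variable (T : Mesh Ω) {K K' : BoxIntegral.Box (Fin d)}

theorem adjacent_or_aligned (hK : K ∈ T.cells) (hK' : K' ∈ T.cells)
    (h : (cell K ∩ cell K').Nonempty) (i : Fin d) :
    K'.upper i = K.lower i ∨ K'.lower i = K.upper i ∨
      K'.lower i = K.lower i ∧ K'.upper i = K.upper i := by
  obtain ⟨hF, hF'⟩ := T.conforming K hK K' hK' h
  obtain ⟨x, hx⟩ := h
  have h_slice (t : ℝ) : t ∈ Icc (K.lower i) (K.upper i) ∩ Icc (K'.lower i) (K'.upper i) ↔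
      WithLp.toLp 2 (Function.update x.ofLp i t) ∈ cell K ∩ cell K' :=
    (and_congr (toLp_update_mem_iff hx.1 i t) (toLp_update_mem_iff hx.2 i t)).symm
  exact Icc_adjacent_or_eq (K.lower_lt_upper i) (K'.lower_lt_upper i) rfl
    (hF.slice_eq hx i h_slice) (hF'.slice_eq hx i h_slice)

open Classical in
/-- The elements that meet some element of `I`: one layer of elements around `I`, together
with `I` itself. -/
noncomputable def layer (I : Finset (BoxIntegral.Box (Fin d))) :
    Finset (BoxIntegral.Box (Fin d)) :=
  T.cells.filter fun K => ∃ K' ∈ I, (cell K' ∩ cell K).Nonempty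

variable {T}

theorem mem_layer {I : Finset (BoxIntegral.Box (Fin d))} :
    K ∈ T.layer I ↔ K ∈ T.cells ∧ ∃ K' ∈ I, (cell K' ∩ cell K).Nonempty := by
  simp only [layer, Finset.mem_filter]

theorem mem_layer_singleton :
    K' ∈ T.layer {K} ↔ K' ∈ T.cells ∧ (cell K ∩ cell K').Nonempty := by
  simp only [mem_layer, Finset.mem_singleton, exists_eq_left]

theorem layer_subset {I : Finset (BoxIntegral.Box (Fin d))} : T.layer I ⊆ T.cells :=
  fun _ hK => (mem_layer.1 hK).1

theorem subset_layer {I : Finset (BoxIntegral.Box (Fin d))} (hI : I ⊆ T.cells) :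
    I ⊆ T.layer I := fun K hK =>
  mem_layer.2 ⟨hI hK, K, hK, by
    simpa only [inter_self] using (nonempty_interior_cell K).mono interior_subset⟩

theorem eq_of_Ioo_inter_nonempty (hK : K ∈ T.cells) (hK' : K' ∈ T.cells)
    (h : ∀ i, (Ioo (K.lower i) (K.upper i) ∩ Ioo (K'.lower i) (K'.upper i)).Nonempty) :
    K = K' := by
  by_contra hne
  choose x hx using h
  have hxK : WithLp.toLp 2 x ∈ interior (cell K) := by
    rw [interior_cell]
    exact fun i => (hx i).1
  have hxK' : WithLp.toLp 2 x ∈ interior (cell K') := by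
    rw [interior_cell]
    exact fun i => (hx i).2
  exact Set.disjoint_left.1 (T.disjoint_interior K hK K' hK' hne) hxK hxK'

open Classical in
/-- The position of `K'` relative to an element `K` that it meets: in each direction it lies
below (`0`), above (`1`) or beside (`2`) `K`. -/
noncomputable def relativePosition (K K' : BoxIntegral.Box (Fin d)) (i : Fin d) : Fin 3 :=
  if K'.upper i = K.lower i then 0 else if K'.lower i = K.upper i then 1 else 2

theorem injOn_relativePosition (hK : K ∈ T.cells) :
    InjOn (relativePosition K) (T.layer {K}) := by
  intro K₁ h₁ K₂ h₂ h
  rw [Finset.mem_coe, mem_layer_singleton] at h₁ h₂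
  refine eq_of_Ioo_inter_nonempty h₁.1 h₂.1 fun i => ?_
  have hi : relativePosition K K₁ i = relativePosition K K₂ i := congrFun h i
  have hK_lt := K.lower_lt_upper i
  have hK₁_lt := K₁.lower_lt_upper i
  have hK₂_lt := K₂.lower_lt_upper i
  rw [Ioo_inter_Ioo, nonempty_Ioo, sup_lt_iff, lt_inf_iff, lt_inf_iff]
  have h₁_pos := T.adjacent_or_aligned hK h₁.1 h₁.2 i
  have h₂_pos := T.adjacent_or_aligned hK h₂.1 h₂.2 i
  unfold relativePosition at hi
  grind

theorem card_layer_singleton_le (hK : K ∈ T.cells) : (T.layer {K}).card ≤ 3 ^ d := by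
  simpa using Finset.card_le_card_of_injOn (t := Finset.univ) (relativePosition K)
    (fun _ _ => Finset.mem_univ _) (injOn_relativePosition hK)

end Mesh

/-! ### Cutoff functions adapted to the mesh -/

theorem exists_bound_deriv_smoothTransition :
    ∃ L : ℝ, ∀ t, |deriv Real.smoothTransition t| ≤ L := by
  have deriv_eq_zero : ∀ t ∉ Icc (0 : ℝ) 1, deriv Real.smoothTransition t = 0 := by
    intro t ht
    rw [mem_Icc, not_and_or, not_le, not_le] at ht
    obtain ht | ht := ht
    · have h : Real.smoothTransition =ᶠ[𝓝 t] fun _ => 0 := by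
        filter_upwards [Iio_mem_nhds ht] with s hs
        exact Real.smoothTransition.zero_of_nonpos (le_of_lt hs)
      rw [h.deriv_eq, deriv_const]
    · have h : Real.smoothTransition =ᶠ[𝓝 t] fun _ => 1 := by
        filter_upwards [Ioi_mem_nhds ht] with s hs
        exact Real.smoothTransition.one_of_one_le (le_of_lt hs)
      rw [h.deriv_eq, deriv_const]
  exact (HasCompactSupport.intro isCompact_Icc deriv_eq_zero).exists_bound_of_continuous
    ((Real.smoothTransition.contDiff (n := 1)).continuous_deriv le_rfl)

theorem norm_fderiv_prod_le {E ι : Type*} [NormedAddCommGroup E] [NormedSpace ℝ E]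
    (s : Finset ι) {f : ι → E → ℝ} {x : E} {B : ι → ℝ}
    (hf : ∀ i ∈ s, DifferentiableAt ℝ (f i) x) (hf_le : ∀ i ∈ s, |f i x| ≤ 1)
    (hB : ∀ i ∈ s, ‖fderiv ℝ (f i) x‖ ≤ B i) :
    ‖fderiv ℝ (fun y => ∏ i ∈ s, f i y) x‖ ≤ ∑ i ∈ s, B i := by
  classical
  rw [(HasFDerivAt.finsetProd fun i hi => (hf i hi).hasFDerivAt).fderiv]
  refine (norm_sum_le _ _).trans (Finset.sum_le_sum fun i hi => ?_)
  rw [norm_smul, norm_prod]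
  refine (mul_le_of_le_one_left (norm_nonneg _) ?_).trans (hB i hi)
  exact Finset.prod_le_one (fun _ _ => norm_nonneg _)
    fun j hj => hf_le j (Finset.mem_of_mem_erase hj)

/-- A smooth function on the line that is `1` on `[a, b]` and `0` at distance at least `h / 2`
from `[a, b]`. -/
noncomputable def plateau (a b h t : ℝ) : ℝ :=
  Real.smoothTransition (2 / h * (t - a) + 1) * Real.smoothTransition (2 / h * (b - t) + 1)

section plateau

variable {a b h : ℝ}

theorem contDiff_plateau : ContDiff ℝ ∞ (plateau a b h) :=
  (Real.smoothTransition.contDiff.comp (by fun_prop)).mul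
    (Real.smoothTransition.contDiff.comp (by fun_prop))

theorem plateau_mem_Icc (t : ℝ) : plateau a b h t ∈ Icc (0 : ℝ) 1 :=
  ⟨mul_nonneg (Real.smoothTransition.nonneg _) (Real.smoothTransition.nonneg _),
    mul_le_one₀ (Real.smoothTransition.le_one _) (Real.smoothTransition.nonneg _)
      (Real.smoothTransition.le_one _)⟩

theorem plateau_eq_one (hh : 0 < h) {t : ℝ} (ht : t ∈ Icc a b) : plateau a b h t = 1 := by
  have ha : 0 ≤ 2 / h * (t - a) := mul_nonneg (by positivity) (sub_nonneg.2 ht.1)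
  have hb : 0 ≤ 2 / h * (b - t) := mul_nonneg (by positivity) (sub_nonneg.2 ht.2)
  rw [plateau, Real.smoothTransition.one_of_one_le (by linarith),
    Real.smoothTransition.one_of_one_le (by linarith), one_mul]

theorem plateau_eq_zero (hh : 0 < h) {t : ℝ} (ht : t ≤ a - h / 2 ∨ b + h / 2 ≤ t) :
    plateau a b h t = 0 := by
  have scaled_nonpos {s : ℝ} (hs : s ≤ -(h / 2)) : 2 / h * s + 1 ≤ 0 := by
    calc 2 / h * s + 1 ≤ 2 / h * -(h / 2) + 1 := by gcongr
      _ = 0 := by field_simp; ring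
  refine mul_eq_zero.2 (ht.imp (fun ht => ?_) fun ht => ?_) <;>
    exact Real.smoothTransition.zero_of_nonpos (scaled_nonpos (by linarith))

theorem abs_deriv_plateau_le {L : ℝ} (hL : ∀ t, |deriv Real.smoothTransition t| ≤ L)
    (hh : 0 < h) (t : ℝ) : |deriv (plateau a b h) t| ≤ 4 * L / h := by
  have transition_deriv {g : ℝ → ℝ} {c : ℝ} (hg : HasDerivAt g c t) :
      HasDerivAt (fun s => Real.smoothTransition (g s))
        (deriv Real.smoothTransition (g t) * c) t :=
    HasDerivAt.comp t ((Real.smoothTransition.contDiff (n := 1)).differentiable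
      one_ne_zero _).hasDerivAt hg
  have h_left := transition_deriv ((((hasDerivAt_id t).sub_const a).const_mul (2 / h)).add_const 1)
  have h_right := transition_deriv ((((hasDerivAt_id t).const_sub b).const_mul (2 / h)).add_const 1)
  have factor_le {s c e : ℝ} (hc : |c| = 2 / h) (he : 0 ≤ e) (he_one : e ≤ 1) :
      |deriv Real.smoothTransition s * c * e| ≤ 2 * L / h := by
    rw [abs_mul, abs_mul, hc, abs_of_nonneg he]
    calc |deriv Real.smoothTransition s| * (2 / h) * e
        ≤ |deriv Real.smoothTransition s| * (2 / h) := mul_le_of_le_one_right (by positivity) he_one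
      _ ≤ L * (2 / h) := by gcongr; exact hL s
      _ = 2 * L / h := by ring
  rw [show deriv (plateau a b h) t = _ from (h_left.mul h_right).deriv]
  have h_pos : 0 < 2 / h := by positivity
  calc |_| ≤ 2 * L / h + 2 * L / h := (abs_add_le _ _).trans <| add_le_add
        (factor_le (by rw [mul_one, abs_of_pos h_pos]) (Real.smoothTransition.nonneg _)
          (Real.smoothTransition.le_one _))
        (by
          rw [mul_comm]
          exact factor_le (by rw [mul_neg_one, abs_neg, abs_of_pos h_pos])
            (Real.smoothTransition.nonneg _) (Real.smoothTransition.le_one _))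
    _ = 4 * L / h := by ring

end plateau

/-- A smooth function that is `1` on the rectangle `K` and `0` at distance at least `h / 2` from
`K` in some coordinate. -/
noncomputable def cellBump (K : BoxIntegral.Box (Fin d)) (h : ℝ) (x : EuclideanSpace ℝ (Fin d)) :
    ℝ :=
  ∏ i, plateau (K.lower i) (K.upper i) h (x i)

section cellBump

variable {K : BoxIntegral.Box (Fin d)} {h : ℝ}

theorem contDiff_cellBump : ContDiff ℝ ∞ (cellBump K h) :=
  contDiff_prod fun _ _ => contDiff_plateau.comp (by fun_prop)

theorem cellBump_mem_Icc (x : EuclideanSpace ℝ (Fin d)) : cellBump K h x ∈ Icc (0 : ℝ) 1 :=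
  ⟨Finset.prod_nonneg fun i _ => (plateau_mem_Icc (x i)).1,
    Finset.prod_le_one (fun i _ => (plateau_mem_Icc (x i)).1) fun i _ => (plateau_mem_Icc (x i)).2⟩

theorem cellBump_eq_one (hh : 0 < h) {x : EuclideanSpace ℝ (Fin d)} (hx : x ∈ cell K) :
    cellBump K h x = 1 :=
  Finset.prod_eq_one fun i _ => plateau_eq_one hh (hx i)

theorem cellBump_eq_zero (hh : 0 < h) {x : EuclideanSpace ℝ (Fin d)} {i : Fin d}
    (hx : x i ≤ K.lower i - h / 2 ∨ K.upper i + h / 2 ≤ x i) : cellBump K h x = 0 :=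
  Finset.prod_eq_zero (Finset.mem_univ i) (plateau_eq_zero hh hx)

theorem norm_proj_le_one (i : Fin d) :
    ‖(EuclideanSpace.proj i : EuclideanSpace ℝ (Fin d) →L[ℝ] ℝ)‖ ≤ 1 :=
  ContinuousLinearMap.opNorm_le_bound _ zero_le_one fun y => by
    simpa using PiLp.norm_apply_le y i

theorem norm_fderiv_cellBump_le {L : ℝ} (hL : ∀ t, |deriv Real.smoothTransition t| ≤ L)
    (hh : 0 < h) (x : EuclideanSpace ℝ (Fin d)) :
    ‖fderiv ℝ (cellBump K h) x‖ ≤ 4 * d * L / h := by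
  have factor_deriv (i : Fin d) : HasFDerivAt (fun y : EuclideanSpace ℝ (Fin d) =>
      plateau (K.lower i) (K.upper i) h (y i))
      (deriv (plateau (K.lower i) (K.upper i) h) (x i) • EuclideanSpace.proj i) x :=
    ((contDiff_plateau.differentiable (by simp) _).hasDerivAt).comp_hasFDerivAt x
      (EuclideanSpace.proj i : EuclideanSpace ℝ (Fin d) →L[ℝ] ℝ).hasFDerivAt
  have factor_le (i : Fin d) : ‖fderiv ℝ (fun y : EuclideanSpace ℝ (Fin d) =>
      plateau (K.lower i) (K.upper i) h (y i)) x‖ ≤ 4 * L / h := by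
    rw [(factor_deriv i).fderiv, norm_smul]
    exact (mul_le_of_le_one_right (norm_nonneg _) (norm_proj_le_one i)).trans
      (abs_deriv_plateau_le hL hh (x i))
  calc ‖fderiv ℝ (cellBump K h) x‖ ≤ ∑ _i : Fin d, 4 * L / h :=
        norm_fderiv_prod_le _ (fun i _ => (factor_deriv i).differentiableAt)
          (fun i _ => by
            rw [abs_of_nonneg (plateau_mem_Icc (x i)).1]
            exact (plateau_mem_Icc (x i)).2)
          fun i _ => factor_le i
    _ = 4 * d * L / h := by
        rw [Finset.sum_const, Finset.card_univ, Fintype.card_fin, nsmul_eq_mul]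
        ring

end cellBump

namespace Mesh

section bump

variable (T : Mesh Ω) {K : BoxIntegral.Box (Fin d)} {h : ℝ}

theorem meets_of_near (hside : ∀ K ∈ T.cells, ∀ i, h ≤ K.upper i - K.lower i)
    {K₁ K₂ : BoxIntegral.Box (Fin d)} (hK : K ∈ T.cells) (hK₁ : K₁ ∈ T.cells)
    (hK₂ : K₂ ∈ T.cells) (hKK₁ : (cell K ∩ cell K₁).Nonempty) {x : EuclideanSpace ℝ (Fin d)}
    (hx₁ : x ∈ cell K₁) (hx₂ : x ∈ cell K₂)
    (hx : ∀ i, K.lower i - h < x i ∧ x i < K.upper i + h) : (cell K ∩ cell K₂).Nonempty := by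
  have h_inter (i : Fin d) :
      (Icc (K.lower i) (K.upper i) ∩ Icc (K₂.lower i) (K₂.upper i)).Nonempty := by
    obtain ⟨hx₁_lower, hx₁_upper⟩ := hx₁ i
    obtain ⟨hx₂_lower, hx₂_upper⟩ := hx₂ i
    obtain ⟨hx_lower, hx_upper⟩ := hx i
    have hK₁_side := hside K₁ hK₁ i
    have hK_lt := K.lower_lt_upper i
    have hK₂_lt := K₂.lower_lt_upper i
    rw [Icc_inter_Icc, nonempty_Icc, sup_le_iff, le_inf_iff, le_inf_iff]
    have hKK₁_pos := T.adjacent_or_aligned hK hK₁ hKK₁ i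
    have hK₁K₂_pos := T.adjacent_or_aligned hK₁ hK₂ ⟨x, hx₁, hx₂⟩ i
    grind
  choose t ht using h_inter
  exact ⟨WithLp.toLp 2 t, fun i => (ht i).1, fun i => (ht i).2⟩

open Classical in
/-- The function `cellBump K h`, set to zero outside of the elements that meet `K`. Elements that
do not meet `K` can be close to it when `Ω` is not convex, hence the truncation. -/
noncomputable def bump (K : BoxIntegral.Box (Fin d)) (h : ℝ) (x : EuclideanSpace ℝ (Fin d)) : ℝ :=
  if ∀ K' ∈ T.cells, x ∈ cell K' → (cell K ∩ cell K').Nonempty then cellBump K h x else 0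

theorem bump_mem_Icc (x : EuclideanSpace ℝ (Fin d)) : T.bump K h x ∈ Icc (0 : ℝ) 1 := by
  unfold bump
  split_ifs
  exacts [cellBump_mem_Icc x, left_mem_Icc.2 zero_le_one]

theorem bump_eq_one (hh : 0 < h) {x : EuclideanSpace ℝ (Fin d)} (hx : x ∈ cell K) :
    T.bump K h x = 1 := by
  rw [bump, if_pos fun K' _ hx' => ⟨x, hx, hx'⟩, cellBump_eq_one hh hx]

theorem bump_eq_zero {K' : BoxIntegral.Box (Fin d)} (hK' : K' ∈ T.cells)
    (hKK' : ¬ (cell K ∩ cell K').Nonempty) {x : EuclideanSpace ℝ (Fin d)} (hx : x ∈ cell K') :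
    T.bump K h x = 0 :=
  if_neg fun H => hKK' (H K' hK' hx)

theorem eventually_mem_cell_imp (x : EuclideanSpace ℝ (Fin d)) :
    ∀ᶠ y in 𝓝 x, ∀ K ∈ T.cells, y ∈ cell K → x ∈ cell K := by
  refine (eventually_all_finset T.cells).2 fun K _ => ?_
  by_cases hx : x ∈ cell K
  · exact Eventually.of_forall fun _ _ => hx
  · filter_upwards [(isClosed_cell K).isOpen_compl.mem_nhds hx] with y hy hy'
    exact absurd hy' hy

theorem bump_eventuallyEq (hΩ : IsOpen Ω) (hh : 0 < h)
    (hside : ∀ K ∈ T.cells, ∀ i, h ≤ K.upper i - K.lower i) (hK : K ∈ T.cells)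
    {x : EuclideanSpace ℝ (Fin d)} (hx : x ∈ Ω) :
    T.bump K h =ᶠ[𝓝 x] cellBump K h ∨ T.bump K h =ᶠ[𝓝 x] fun _ => 0 := by
  by_cases h_meets : ∀ K' ∈ T.cells, x ∈ cell K' → (cell K ∩ cell K').Nonempty
  · left
    filter_upwards [T.eventually_mem_cell_imp x] with y hy
    exact if_pos fun K' hK' hy' => h_meets K' hK' (hy K' hK' hy')
  right
  push Not at h_meets
  obtain ⟨K₂, hK₂, hx₂, hKK₂⟩ := h_meets
  by_cases h_near : ∀ i, K.lower i - h < x i ∧ x i < K.upper i + h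
  · filter_upwards [T.eventually_mem_cell_imp x, hΩ.mem_nhds hx] with y hy hyΩ
    obtain ⟨K₁, hK₁, hy₁⟩ := T.exists_mem_cell hyΩ
    refine T.bump_eq_zero hK₁ (fun hKK₁ => ?_) hy₁
    exact (T.meets_of_near hside hK hK₁ hK₂ hKK₁ (hy K₁ hK₁ hy₁) hx₂ h_near).ne_empty hKK₂
  · push Not at h_near
    obtain ⟨i, hi⟩ := h_near
    have coord_cont : Continuous fun y : EuclideanSpace ℝ (Fin d) => y i := by fun_prop
    have h_far : x i < K.lower i - h / 2 ∨ K.upper i + h / 2 < x i :=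
      (le_or_gt (x i) (K.lower i - h)).imp (fun hx => by linarith)
        fun hx => by linarith [hi hx]
    filter_upwards [((isOpen_lt coord_cont continuous_const).union
      (isOpen_lt continuous_const coord_cont)).mem_nhds h_far] with y hy
    rw [bump, cellBump_eq_zero hh (hy.imp le_of_lt le_of_lt), ite_self]

theorem contDiffAt_bump (hΩ : IsOpen Ω) (hh : 0 < h)
    (hside : ∀ K ∈ T.cells, ∀ i, h ≤ K.upper i - K.lower i) (hK : K ∈ T.cells)
    {x : EuclideanSpace ℝ (Fin d)} (hx : x ∈ Ω) : ContDiffAt ℝ ∞ (T.bump K h) x :=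
  (T.bump_eventuallyEq hΩ hh hside hK hx).elim contDiff_cellBump.contDiffAt.congr_of_eventuallyEq
    contDiffAt_const.congr_of_eventuallyEq

theorem norm_fderiv_bump_le {L : ℝ} (hL : ∀ t, |deriv Real.smoothTransition t| ≤ L)
    (hΩ : IsOpen Ω) (hh : 0 < h)
    (hside : ∀ K ∈ T.cells, ∀ i, h ≤ K.upper i - K.lower i) (hK : K ∈ T.cells)
    {x : EuclideanSpace ℝ (Fin d)} (hx : x ∈ Ω) :
    ‖fderiv ℝ (T.bump K h) x‖ ≤ 4 * d * L / h := by
  obtain e | e := T.bump_eventuallyEq hΩ hh hside hK hx <;> rw [e.fderiv_eq]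
  · exact norm_fderiv_cellBump_le hL hh x
  · have hL_nonneg : 0 ≤ L := (abs_nonneg _).trans (hL 0)
    rw [fderiv_const_apply, norm_zero]
    positivity

theorem fderiv_bump_eq_zero {K' : BoxIntegral.Box (Fin d)} (hK' : K' ∈ T.cells)
    (hKK' : ¬ (cell K ∩ cell K').Nonempty) {x : EuclideanSpace ℝ (Fin d)} (hx : x ∈ cell K') :
    fderiv ℝ (T.bump K h) x = 0 :=
  IsLocalMin.fderiv_eq_zero <| Eventually.of_forall fun y => by
    rw [T.bump_eq_zero hK' hKK' hx]
    exact (T.bump_mem_Icc y).1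

end bump

/-- A cutoff function on `Ω` that vanishes on the elements in `I` and is `1` on the elements that
do not meet any of them. It is smooth if all sides of the elements have length at least `h`. -/
noncomputable def cutoff (T : Mesh Ω) (I : Finset (BoxIntegral.Box (Fin d))) (h : ℝ)
    (x : EuclideanSpace ℝ (Fin d)) : ℝ :=
  ∏ K ∈ I, (1 - T.bump K h x)

section cutoff

variable (T : Mesh Ω) {I : Finset (BoxIntegral.Box (Fin d))} {K : BoxIntegral.Box (Fin d)} {h : ℝ}

theorem one_sub_bump_mem_Icc (x : EuclideanSpace ℝ (Fin d)) :
    1 - T.bump K h x ∈ Icc (0 : ℝ) 1 :=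
  Icc.mem_iff_one_sub_mem.1 (T.bump_mem_Icc x)

theorem contDiffOn_cutoff (hΩ : IsOpen Ω) (hh : 0 < h)
    (hside : ∀ K ∈ T.cells, ∀ i, h ≤ K.upper i - K.lower i) (hI : I ⊆ T.cells) :
    ContDiffOn ℝ ∞ (T.cutoff I h) Ω := fun _ hx =>
  (contDiffAt_prod fun _ hK =>
    contDiffAt_const.sub (T.contDiffAt_bump hΩ hh hside (hI hK) hx)).contDiffWithinAt

theorem cutoff_mem_Icc (x : EuclideanSpace ℝ (Fin d)) : T.cutoff I h x ∈ Icc (0 : ℝ) 1 :=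
  ⟨Finset.prod_nonneg fun _ _ => (T.one_sub_bump_mem_Icc x).1,
    Finset.prod_le_one (fun _ _ => (T.one_sub_bump_mem_Icc x).1)
      fun _ _ => (T.one_sub_bump_mem_Icc x).2⟩

theorem cutoff_eq_zero (hh : 0 < h) (hK : K ∈ I) {x : EuclideanSpace ℝ (Fin d)}
    (hx : x ∈ cell K) : T.cutoff I h x = 0 :=
  Finset.prod_eq_zero hK (by rw [T.bump_eq_one hh hx, sub_self])

theorem cutoff_eq_one (hK : K ∈ T.cells) (hKI : K ∉ T.layer I) {x : EuclideanSpace ℝ (Fin d)}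
    (hx : x ∈ cell K) : T.cutoff I h x = 1 := by
  refine Finset.prod_eq_one fun K' hK' => ?_
  rw [T.bump_eq_zero hK (fun h_meets => hKI (mem_layer.2 ⟨hK, K', hK', h_meets⟩)) hx, sub_zero]

theorem norm_fderiv_cutoff_le {L : ℝ} (hL : ∀ t, |deriv Real.smoothTransition t| ≤ L)
    (hΩ : IsOpen Ω) (hh : 0 < h)
    (hside : ∀ K ∈ T.cells, ∀ i, h ≤ K.upper i - K.lower i) (hI : I ⊆ T.cells)
    {x : EuclideanSpace ℝ (Fin d)} (hx : x ∈ Ω) :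
    ‖fderiv ℝ (T.cutoff I h) x‖ ≤ 3 ^ d * (4 * d * L) / h := by
  classical
  obtain ⟨K, hK, hxK⟩ := T.exists_mem_cell hx
  have hL_nonneg : 0 ≤ L := (abs_nonneg _).trans (hL 0)
  have factor_le : ∀ K' ∈ I, ‖fderiv ℝ (fun y => 1 - T.bump K' h y) x‖ ≤
      if K' ∈ T.layer {K} then 4 * d * L / h else 0 := by
    intro K' hK'
    rw [fderiv_const_sub, norm_neg]
    split_ifs with h_layer
    · exact T.norm_fderiv_bump_le hL hΩ hh hside (hI hK') hx
    · rw [T.fderiv_bump_eq_zero hK (fun h_meets => h_layer (mem_layer_singleton.2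
        ⟨hI hK', inter_comm _ _ ▸ h_meets⟩)) hxK, norm_zero]
  have card_le : ((I.filter fun K' => K' ∈ T.layer {K}).card : ℝ) ≤ 3 ^ d := by
    exact_mod_cast (Finset.card_le_card fun K' hK' => (Finset.mem_filter.1 hK').2).trans
      (card_layer_singleton_le hK)
  calc ‖fderiv ℝ (T.cutoff I h) x‖
      ≤ ∑ K' ∈ I, if K' ∈ T.layer {K} then 4 * d * L / h else 0 :=
        norm_fderiv_prod_le I
          (fun K' hK' => (differentiableAt_const _).sub
            ((T.contDiffAt_bump hΩ hh hside (hI hK') hx).differentiableAt (by simp)))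
          (fun K' _ => by
            rw [abs_of_nonneg (T.one_sub_bump_mem_Icc x).1]
            exact (T.one_sub_bump_mem_Icc x).2)
          factor_le
    _ = (I.filter fun K' => K' ∈ T.layer {K}).card * (4 * d * L / h) := by
        rw [← Finset.sum_filter, Finset.sum_const, nsmul_eq_mul]
    _ ≤ 3 ^ d * (4 * d * L / h) := by gcongr
    _ = 3 ^ d * (4 * d * L) / h := by ring

end cutoff

end Mesh

/-! ### The Poincaré inequality on convex sets -/

theorem sq_integral_mul_le {X : Type*} [MeasurableSpace X] {μ : Measure X} {f g : X → ℝ}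
    (hf : MemLp f 2 μ) (hg : MemLp g 2 μ) :
    (∫ x, f x * g x ∂μ) ^ 2 ≤ (∫ x, f x ^ 2 ∂μ) * ∫ x, g x ^ 2 ∂μ := by
  have inner_toLp : ∀ {f g : X → ℝ} (hf : MemLp f 2 μ) (hg : MemLp g 2 μ),
      (inner ℝ (hf.toLp f) (hg.toLp g) : ℝ) = ∫ x, f x * g x ∂μ := by
    intro f g hf hg
    rw [L2.inner_def]
    refine integral_congr_ae ?_
    filter_upwards [hf.coeFn_toLp, hg.coeFn_toLp] with x hfx hgx
    rw [hfx, hgx, RCLike.inner_apply, conj_trivial, mul_comm]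
  have cauchy_schwarz := real_inner_mul_inner_self_le (hf.toLp f) (hg.toLp g)
  simp only [inner_toLp] at cauchy_schwarz
  simpa only [sq] using cauchy_schwarz

theorem integral_prod_sub_sq {X : Type*} [MeasurableSpace X] {μ : Measure X} [IsFiniteMeasure μ]
    {f : X → ℝ} (hf : MemLp f 2 μ) :
    ∫ z, (f z.1 - f z.2) ^ 2 ∂μ.prod μ =
      2 * (μ.real univ * (∫ x, f x ^ 2 ∂μ) - (∫ x, f x ∂μ) ^ 2) := by
  have hf1 : Integrable f μ := hf.integrable one_le_two
  have hsq1 : Integrable (fun z : X × X => f z.1 ^ 2) (μ.prod μ) := hf.integrable_sq.comp_fst μ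
  have hsq2 : Integrable (fun z : X × X => f z.2 ^ 2) (μ.prod μ) := hf.integrable_sq.comp_snd μ
  have expand : ∀ z : X × X,
      (f z.1 - f z.2) ^ 2 = (f z.1 ^ 2 - 2 * (f z.1 * f z.2)) + f z.2 ^ 2 := fun z => by ring
  simp only [expand]
  have hmul : Integrable (fun z : X × X => 2 * (f z.1 * f z.2)) (μ.prod μ) :=
    (hf1.mul_prod hf1).const_mul 2
  rw [integral_add (by exact hsq1.sub hmul) hsq2, integral_sub hsq1 hmul,
    integral_fun_fst (fun x => f x ^ 2), integral_fun_snd (fun x => f x ^ 2), integral_const_mul,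
    integral_prod_mul]
  simp only [smul_eq_mul]
  ring

section Segment

variable {E : Type*} [NormedAddCommGroup E] [NormedSpace ℝ E]

theorem sq_sub_le_integral_segment {φ : E → ℝ} (hφ : ContDiff ℝ 1 φ) (x y : E) :
    (φ x - φ y) ^ 2 ≤
      ‖y - x‖ ^ 2 * ∫ t in Ioc (0 : ℝ) 1, ‖fderiv ℝ φ (x + t • (y - x))‖ ^ 2 := by
  have : Continuous (fderiv ℝ φ) := hφ.continuous_fderiv one_ne_zero
  have memLp_of_continuous : ∀ {g : ℝ → ℝ}, Continuous g → MemLp g 2 (volume.restrict (Ioc 0 1)) :=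
    fun hg => (memLp_two_iff_integrable_sq hg.aestronglyMeasurable).2
      (Continuous.integrableOn_Ioc (by fun_prop))
  have hline : ∀ t : ℝ, HasDerivAt (fun t : ℝ => φ (x + t • (y - x)))
      (fderiv ℝ φ (x + t • (y - x)) (y - x)) t := fun t =>
    (hφ.differentiable one_ne_zero _).hasFDerivAt.comp_hasDerivAt t <| by
      simpa using ((hasDerivAt_id t).smul_const (y - x)).const_add x
  have ftc : ∫ t in Ioc (0 : ℝ) 1, fderiv ℝ φ (x + t • (y - x)) (y - x) = φ y - φ x := by
    rw [← intervalIntegral.integral_of_le zero_le_one,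
      intervalIntegral.integral_eq_sub_of_hasDerivAt (fun t _ => hline t)
        (Continuous.intervalIntegrable (by fun_prop) _ _)]
    simp
  have cauchy_schwarz := sq_integral_mul_le (memLp_of_continuous continuous_const)
    (memLp_of_continuous (g := fun t => fderiv ℝ φ (x + t • (y - x)) (y - x)) (by fun_prop))
    (f := fun _ => 1)
  simp only [one_mul, ftc, one_pow, integral_const, measureReal_restrict_apply_univ,
    Real.volume_real_Ioc_of_le zero_le_one, sub_zero, smul_eq_mul, mul_one] at cauchy_schwarz
  rw [← neg_sub, neg_sq, ← integral_const_mul]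
  refine cauchy_schwarz.trans (integral_mono (Continuous.integrableOn_Ioc (by fun_prop))
    (Continuous.integrableOn_Ioc (by fun_prop)) fun t => ?_)
  rw [← mul_pow, ← sq_abs, mul_comm]
  exact pow_le_pow_left₀ (abs_nonneg _) ((fderiv ℝ φ _).le_opNorm _) 2

theorem ofReal_sq_sub_le_lintegral_segment {φ : E → ℝ} (hφ : ContDiff ℝ 1 φ) {S : Set E}
    (hS : Convex ℝ S) {D : ℝ} (hD : ∀ x ∈ S, ∀ y ∈ S, ‖y - x‖ ≤ D) {x y : E} (hx : x ∈ S)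
    (hy : y ∈ S) :
    ENNReal.ofReal ((φ x - φ y) ^ 2) ≤ ENNReal.ofReal (D ^ 2) * ∫⁻ t in Ioc (0 : ℝ) 1,
      S.indicator (fun z => ENNReal.ofReal (‖fderiv ℝ φ z‖ ^ 2)) (x + t • (y - x)) := by
  have : Continuous (fderiv ℝ φ) := hφ.continuous_fderiv one_ne_zero
  have segment_mem : ∀ t ∈ Ioc (0 : ℝ) 1, x + t • (y - x) ∈ S := fun t ht =>
    hS.add_smul_sub_mem hx hy ⟨ht.1.le, ht.2⟩
  have bound : (φ x - φ y) ^ 2 ≤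
      D ^ 2 * ∫ t in Ioc (0 : ℝ) 1, ‖fderiv ℝ φ (x + t • (y - x))‖ ^ 2 := by
    refine (sq_sub_le_integral_segment hφ x y).trans ?_
    gcongr
    exact hD x hx y hy
  refine (ENNReal.ofReal_le_ofReal bound).trans_eq ?_
  rw [ENNReal.ofReal_mul (sq_nonneg D), ofReal_integral_eq_lintegral_ofReal
    (Continuous.integrableOn_Ioc (by fun_prop)) (Eventually.of_forall fun t => sq_nonneg _)]
  congr 1
  refine setLIntegral_congr_fun measurableSet_Ioc fun t ht => ?_
  simp only [indicator_of_mem (segment_mem t ht)]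

variable [MeasurableSpace E] [BorelSpace E] [FiniteDimensional ℝ E]
  {μ : Measure E} [μ.IsAddHaarMeasure]

theorem lintegral_comp_add_smul (a : E) {t : ℝ} (ht : t ≠ 0) {G : E → ENNReal}
    (hG : Measurable G) :
    ∫⁻ y, G (a + t • y) ∂μ =
      ENNReal.ofReal |(t ^ Module.finrank ℝ E)⁻¹| * ∫⁻ y, G y ∂μ := by
  rw [← lintegral_map (f := fun z => G (a + z)) (g := (t • ·)) (by fun_prop) (by fun_prop),
    Measure.map_addHaar_smul _ ht, lintegral_smul_measure, lintegral_add_left_eq_self, smul_eq_mul]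

theorem lintegral_comp_add_smul_le (a : E) {t : ℝ} (ht : 1 / 2 ≤ t) {G : E → ENNReal}
    (hG : Measurable G) :
    ∫⁻ y, G (a + t • y) ∂μ ≤ 2 ^ Module.finrank ℝ E * ∫⁻ y, G y ∂μ := by
  have ht0 : 0 < t := one_half_pos.trans_le ht
  rw [lintegral_comp_add_smul a ht0.ne' hG]
  gcongr
  rw [← ENNReal.ofReal_ofNat 2, ← ENNReal.ofReal_pow two_pos.le, abs_of_pos (by positivity),
    ← inv_pow]
  refine ENNReal.ofReal_le_ofReal (pow_le_pow_left₀ (by positivity) ?_ _)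
  rw [inv_le_comm₀ ht0 two_pos, ← one_div]
  exact ht

/- For each `t`, one of `y ↦ x + t • (y - x)` and `x ↦ x + t • (y - x)` scales volumes by at least
`2 ^ (-dim E)`. -/
theorem setLIntegral_setLIntegral_segment_le {S : Set E} {G : E → ENNReal} (hG : Measurable G)
    (hS : μ S ≠ ⊤) (t : ℝ) :
    ∫⁻ x in S, ∫⁻ y in S, G (x + t • (y - x)) ∂μ ∂μ ≤
      2 ^ Module.finrank ℝ E * μ S * ∫⁻ y, G y ∂μ := by
  have : Fact (μ S < ⊤) := ⟨hS.lt_top⟩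
  have setLIntegral_le : ∀ F : E → ENNReal,
      (∀ x, F x ≤ 2 ^ Module.finrank ℝ E * ∫⁻ y, G y ∂μ) →
      ∫⁻ x in S, F x ∂μ ≤ 2 ^ Module.finrank ℝ E * μ S * ∫⁻ y, G y ∂μ := by
    intro F hF
    refine (lintegral_mono hF).trans_eq ?_
    rw [lintegral_const, Measure.restrict_apply_univ]
    ring
  rcases le_total (1 / 2) t with ht | ht
  · refine setLIntegral_le _ fun x => (setLIntegral_le_lintegral _ _).trans ?_
    have regroup : ∀ y, x + t • (y - x) = (x - t • x) + t • y := fun y => by module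
    simp only [regroup]
    exact lintegral_comp_add_smul_le _ ht hG
  · rw [lintegral_lintegral_swap (by fun_prop)]
    refine setLIntegral_le _ fun y => (setLIntegral_le_lintegral _ _).trans ?_
    have regroup : ∀ x, x + t • (y - x) = t • y + (1 - t) • x := fun x => by module
    simp only [regroup]
    exact lintegral_comp_add_smul_le _ (by linarith) hG

theorem setLIntegral_setLIntegral_sq_sub_le {φ : E → ℝ} (hφ : ContDiff ℝ 1 φ) {S : Set E}
    (hSc : IsCompact S) (hS : Convex ℝ S) {D : ℝ} (hD : ∀ x ∈ S, ∀ y ∈ S, ‖y - x‖ ≤ D) :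
    ∫⁻ x in S, ∫⁻ y in S, ENNReal.ofReal ((φ x - φ y) ^ 2) ∂μ ∂μ ≤
      ENNReal.ofReal (D ^ 2) * (2 ^ Module.finrank ℝ E * μ S *
        ∫⁻ y in S, ENNReal.ofReal (‖fderiv ℝ φ y‖ ^ 2) ∂μ) := by
  have hSm : MeasurableSet S := hSc.measurableSet
  have : Fact (μ S < ⊤) := ⟨hSc.measure_lt_top⟩
  set G : E → ENNReal := S.indicator fun z => ENNReal.ofReal (‖fderiv ℝ φ z‖ ^ 2) with hGdef
  have hG : Measurable G := by
    have := hφ.continuous_fderiv one_ne_zero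
    exact Measurable.indicator (by fun_prop) hSm
  have hGt : Measurable fun q : (E × ℝ) × E => G (q.1.1 + q.1.2 • (q.2 - q.1.1)) := by fun_prop
  calc ∫⁻ x in S, ∫⁻ y in S, ENNReal.ofReal ((φ x - φ y) ^ 2) ∂μ ∂μ
    _ ≤ ∫⁻ x in S, ∫⁻ y in S, ENNReal.ofReal (D ^ 2) *
          (∫⁻ t in Ioc (0 : ℝ) 1, G (x + t • (y - x))) ∂μ ∂μ :=
        setLIntegral_mono' hSm fun x hx => setLIntegral_mono' hSm fun y hy =>
          ofReal_sq_sub_le_lintegral_segment hφ hS hD hx hy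
    _ = ENNReal.ofReal (D ^ 2) *
          ∫⁻ x in S, (∫⁻ t in Ioc (0 : ℝ) 1, (∫⁻ y in S, G (x + t • (y - x)) ∂μ)) ∂μ := by
        simp_rw [lintegral_const_mul' _ _ ENNReal.ofReal_ne_top]
        congr! 3 with x
        exact lintegral_lintegral_swap (by fun_prop)
    _ = ENNReal.ofReal (D ^ 2) *
          ∫⁻ t in Ioc (0 : ℝ) 1, (∫⁻ x in S, ∫⁻ y in S, G (x + t • (y - x)) ∂μ ∂μ) := by
        rw [lintegral_lintegral_swap (hGt.lintegral_prod_right').aemeasurable]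
    _ ≤ ENNReal.ofReal (D ^ 2) *
          ∫⁻ _ in Ioc (0 : ℝ) 1, 2 ^ Module.finrank ℝ E * μ S * ∫⁻ y, G y ∂μ := by
        gcongr with t
        exact setLIntegral_setLIntegral_segment_le hG hSc.measure_ne_top t
    _ = _ := by
        rw [setLIntegral_const, Real.volume_Ioc, sub_zero, ENNReal.ofReal_one, mul_one, hGdef,
          lintegral_indicator hSm]

theorem variance_le_integral_norm_fderiv_sq {φ : E → ℝ} (hφ : ContDiff ℝ 1 φ) {S : Set E}
    (hSc : IsCompact S) (hS : Convex ℝ S) {D : ℝ} (hD : ∀ x ∈ S, ∀ y ∈ S, ‖y - x‖ ≤ D) :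
    2 * (μ.real S * (∫ x in S, φ x ^ 2 ∂μ) - (∫ x in S, φ x ∂μ) ^ 2) ≤
      2 ^ Module.finrank ℝ E * D ^ 2 * μ.real S * ∫ x in S, ‖fderiv ℝ φ x‖ ^ 2 ∂μ := by
  have : Fact (μ S < ⊤) := ⟨hSc.measure_lt_top⟩
  have : Continuous (fderiv ℝ φ) := hφ.continuous_fderiv one_ne_zero
  have hφc : Continuous φ := hφ.continuous
  have hint : ∀ {f : E → ℝ}, Continuous f → IntegrableOn f S μ :=
    fun hf => hf.continuousOn.integrableOn_compact hSc
  have hL2 : MemLp φ 2 (μ.restrict S) :=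
    (memLp_two_iff_integrable_sq hφc.aestronglyMeasurable).2 (hint (by fun_prop))
  have hL2' : Integrable (fun z : E × E => (φ z.1 - φ z.2) ^ 2)
      ((μ.restrict S).prod (μ.restrict S)) :=
    ((hL2.comp_fst _).sub (hL2.comp_snd _)).integrable_sq
  have bound := setLIntegral_setLIntegral_sq_sub_le (μ := μ) hφ hSc hS hD
  rw [← lintegral_prod (fun z : E × E => ENNReal.ofReal ((φ z.1 - φ z.2) ^ 2)) (by fun_prop),
    ← ofReal_integral_eq_lintegral_ofReal hL2' (Eventually.of_forall fun z => sq_nonneg _),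
    integral_prod_sub_sq hL2,
    ← ofReal_integral_eq_lintegral_ofReal (hint (by fun_prop))
      (Eventually.of_forall fun x => sq_nonneg _), ← ENNReal.ofReal_toReal hSc.measure_ne_top,
    ← ENNReal.ofReal_ofNat 2, ← ENNReal.ofReal_pow two_pos.le,
    ← ENNReal.ofReal_mul (by positivity), ← ENNReal.ofReal_mul (by positivity),
    ← ENNReal.ofReal_mul (by positivity), ENNReal.ofReal_le_ofReal_iff (by positivity),
    measureReal_restrict_apply_univ] at bound
  exact bound.trans_eq (by rw [measureReal_def]; ring)

end Segment

/-! ### Calculus in `H¹₀(Ω)` -/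

theorem exists_continuousLinearMap_bilin {X E F G : Type*} [MeasurableSpace X] {μ : Measure X}
    [NormedAddCommGroup E] [NormedSpace ℝ E] [NormedAddCommGroup F] [NormedSpace ℝ F]
    [NormedAddCommGroup G] [NormedSpace ℝ G] (L : E →L[ℝ] F →L[ℝ] G) {g : X → E}
    (hg : MemLp g ⊤ μ) {q : ENNReal} [Fact (1 ≤ q)] :
    ∃ B : Lp F q μ →L[ℝ] Lp G q μ, ∀ f, B f =ᵐ[μ] fun x => L (g x) (f x) := by
  refine ⟨L.holderL μ ⊤ q q (hg.toLp g), fun f => ?_⟩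
  filter_upwards [L.coeFn_holder (r := q) (hg.toLp g) f, hg.coeFn_toLp] with x hx hgx
  exact hx.trans (by rw [hgx])

theorem continuous_setIntegral_norm_sq {X F : Type*} [MeasurableSpace X] [NormedAddCommGroup F]
    [InnerProductSpace ℝ F] (μ : Measure X) (S : Set X) :
    Continuous fun f : Lp F 2 μ => ∫ x in S, ‖f x‖ ^ 2 ∂μ := by
  let restrict : Lp F 2 μ →L[ℝ] Lp F 2 (μ.restrict S) := LpToLpRestrictCLM X F ℝ μ 2 S
  have norm_sq_restrict : ∀ f : Lp F 2 μ, ∫ x in S, ‖f x‖ ^ 2 ∂μ = ‖restrict f‖ ^ 2 := by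
    intro f
    rw [← real_inner_self_eq_norm_sq, L2.inner_def]
    refine integral_congr_ae ?_
    filter_upwards [LpToLpRestrictCLM_coeFn (X := X) (F := F) ℝ (p := 2) (μ := μ) S f] with x hx
    rw [real_inner_self_eq_norm_sq]
    exact congrArg (fun z => ‖z‖ ^ 2) hx.symm
  simp only [norm_sq_restrict]
  exact restrict.continuous.norm.pow 2

theorem integrable_norm_sq {X F : Type*} [MeasurableSpace X] [NormedAddCommGroup F]
    {μ : Measure X} (f : Lp F 2 μ) : Integrable (fun x => ‖f x‖ ^ 2) μ :=
  (Lp.memLp f).integrable_norm_pow two_ne_zero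

theorem norm_gradient (φ : EuclideanSpace ℝ (Fin d) → ℝ) (x : EuclideanSpace ℝ (Fin d)) :
    ‖∇ φ x‖ = ‖fderiv ℝ φ x‖ :=
  LinearIsometryEquiv.norm_map _ _

theorem gradient_mul {η φ : EuclideanSpace ℝ (Fin d) → ℝ} {x : EuclideanSpace ℝ (Fin d)}
    (hη : DifferentiableAt ℝ η x) (hφ : DifferentiableAt ℝ φ x) :
    ∇ (fun y => η y * φ y) x = η x • ∇ φ x + φ x • ∇ η x := by
  simp only [gradient, fderiv_fun_mul hη hφ, map_add, map_smulₛₗ, conj_trivial]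

/-- The smooth function `φ` with compact support in `Ω` and its gradient represent `u`. -/
structure H10.IsTest (u : H10 Ω) (φ : EuclideanSpace ℝ (Fin d) → ℝ) : Prop where
  contDiff : ContDiff ℝ ∞ φ
  hasCompactSupport : HasCompactSupport φ
  tsupport_subset : tsupport φ ⊆ Ω
  toL2_ae_eq : H10.toL2 u =ᵐ[volume.restrict Ω] φ
  grad_ae_eq : H10.grad u =ᵐ[volume.restrict Ω] ∇ φ

theorem H10.induction_closed {P : H10 Ω → Prop} (hP : IsClosed {u | P u})
    (h : ∀ u φ, H10.IsTest u φ → P u) (u : H10 Ω) : P u := by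
  have hdense : DenseRange (Set.inclusion (testGraph Ω).le_topologicalClosure) :=
    (denseRange_inclusion_iff _).2 subset_rfl
  refine hdense.induction_on (p := P) u hP ?_
  rintro ⟨y, φ, hφ, hcompact, hsupp, hval, hgrad⟩
  exact h _ φ ⟨hφ, hcompact, hsupp, hval, hgrad⟩

theorem H10.exists_isTest {φ : EuclideanSpace ℝ (Fin d) → ℝ} (hφ : ContDiff ℝ ∞ φ)
    (hcompact : HasCompactSupport φ) (hsupp : tsupport φ ⊆ Ω) : ∃ u : H10 Ω, H10.IsTest u φ := by
  have hval : MemLp φ 2 (volume.restrict Ω) := hφ.continuous.memLp_of_hasCompactSupport hcompact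
  have hgrad := memLp_gradient hφ hcompact (volume.restrict Ω)
  exact ⟨⟨WithLp.toLp 2 (hval.toLp φ, hgrad.toLp (∇ φ)), (testGraph Ω).le_topologicalClosure
    ⟨φ, hφ, hcompact, hsupp, hval.coeFn_toLp, hgrad.coeFn_toLp⟩⟩,
    hφ, hcompact, hsupp, hval.coeFn_toLp, hgrad.coeFn_toLp⟩

theorem contDiff_mul_of_contDiffOn (hΩ : IsOpen Ω) {η φ : EuclideanSpace ℝ (Fin d) → ℝ}
    (hη : ContDiffOn ℝ ∞ η Ω) (hφ : ContDiff ℝ ∞ φ) (hsupp : tsupport φ ⊆ Ω) :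
    ContDiff ℝ ∞ fun x => η x * φ x := by
  refine contDiff_iff_contDiffAt.2 fun x => ?_
  by_cases hx : x ∈ tsupport fun x => η x * φ x
  · exact (hη.contDiffAt (hΩ.mem_nhds (hsupp (tsupport_mul_subset_right hx)))).mul hφ.contDiffAt
  · exact contDiffAt_const.congr_of_eventuallyEq (notMem_tsupport_iff_eventuallyEq.1 hx)

theorem H10.exists_mul (hΩ : IsOpen Ω) {η : EuclideanSpace ℝ (Fin d) → ℝ}
    (hη : ContDiffOn ℝ ∞ η Ω) {M N : ℝ} (hM : ∀ x ∈ Ω, |η x| ≤ M)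
    (hN : ∀ x ∈ Ω, ‖fderiv ℝ η x‖ ≤ N) (u : H10 Ω) :
    ∃ w : H10 Ω, (H10.toL2 w =ᵐ[volume.restrict Ω] fun x => η x * H10.toL2 u x) ∧
      H10.grad w =ᵐ[volume.restrict Ω] fun x => η x • H10.grad u x + H10.toL2 u x • ∇ η x := by
  have mem_Ω : ∀ᵐ x ∂volume.restrict Ω, x ∈ Ω := ae_restrict_mem hΩ.measurableSet
  have hη_bdd : MemLp η ⊤ (volume.restrict Ω) :=
    memLp_top_of_bound (hη.continuousOn.aestronglyMeasurable hΩ.measurableSet) M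
      (mem_Ω.mono fun x hx => hM x hx)
  have hgrad_cont : ContinuousOn (∇ η) Ω :=
    (InnerProductSpace.toDual ℝ _).symm.continuous.comp_continuousOn
      (hη.continuousOn_fderiv_of_isOpen hΩ (by simp))
  have hgrad_bdd : MemLp (∇ η) ⊤ (volume.restrict Ω) :=
    memLp_top_of_bound (hgrad_cont.aestronglyMeasurable hΩ.measurableSet) N
      (mem_Ω.mono fun x hx => (norm_gradient η x).trans_le (hN x hx))
  obtain ⟨mulη, hmulη⟩ :=
    exists_continuousLinearMap_bilin (ContinuousLinearMap.lsmul ℝ ℝ (E := ℝ)) hη_bdd (q := 2)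
  obtain ⟨smulη, hsmulη⟩ := exists_continuousLinearMap_bilin
    (ContinuousLinearMap.lsmul ℝ ℝ (E := EuclideanSpace ℝ (Fin d))) hη_bdd (q := 2)
  obtain ⟨smulGrad, hsmulGrad⟩ := exists_continuousLinearMap_bilin
    (ContinuousLinearMap.lsmul ℝ ℝ (E := EuclideanSpace ℝ (Fin d))).flip hgrad_bdd (q := 2)
  let F : WithLp 2 (L2 Ω × L2Vec Ω) → WithLp 2 (L2 Ω × L2Vec Ω) := fun y =>
    WithLp.toLp 2 (mulη y.fst, smulη y.snd + smulGrad y.fst)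
  have hF : Continuous F := by fun_prop
  have snd_F : ∀ y, (F y).snd =ᵐ[volume.restrict Ω] fun x => η x • y.snd x + y.fst x • ∇ η x := by
    intro y
    filter_upwards [Lp.coeFn_add (smulη y.snd) (smulGrad y.fst), hsmulη y.snd,
      hsmulGrad y.fst] with x hadd hx hx'
    exact hadd.trans (congrArg₂ (· + ·) hx hx')
  have hmaps : MapsTo F (testGraph Ω) (testGraph Ω) := by
    rintro y ⟨φ, hφ, hcompact, hsupp, hval, hgrad⟩
    refine ⟨fun x => η x * φ x, contDiff_mul_of_contDiffOn hΩ hη hφ hsupp, hcompact.mul_left,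
      tsupport_mul_subset_right.trans hsupp, ?_, ?_⟩
    · filter_upwards [hmulη y.fst, hval] with x hx hφx
      exact hx.trans (by rw [hφx]; rfl)
    · filter_upwards [snd_F y, hval, hgrad, mem_Ω] with x hx hφx hgx hxΩ
      rw [hx, hφx, hgx, gradient_mul ((hη.contDiffAt (hΩ.mem_nhds hxΩ)).differentiableAt (by simp))
        (hφ.differentiable (by simp) x)]
  exact ⟨⟨F u.1, map_mem_closure hF u.2 hmaps⟩, hmulη _, snd_F _⟩

theorem ae_mem_interior_cell (K : BoxIntegral.Box (Fin d)) :
    ∀ᵐ x ∂volume.restrict Ω, x ∈ cell K → x ∈ interior (cell K) :=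
  ae_restrict_of_ae ((interior_cell_ae_eq K).mem_iff.mono fun _ h => h.2)

theorem H10.grad_eq_zero_on_cell (u : H10 Ω) {K : BoxIntegral.Box (Fin d)}
    (h : ∀ᵐ x ∂volume.restrict Ω, x ∈ cell K → H10.toL2 u x = 0) :
    ∀ᵐ x ∂volume.restrict Ω, x ∈ cell K → H10.grad u x = 0 := by
  have hgrad := H10.grad_eq_zero u (isOpen_interior (s := cell K)).isClosed_compl
    (h.mono fun x hx hxK => hx (interior_subset (not_notMem.1 hxK)))
  filter_upwards [hgrad, ae_mem_interior_cell (Ω := Ω) K] with x hx hint hxK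
  exact hx fun hxc => hxc (hint hxK)

theorem H10.grad_eq_on_cell {u v : H10 Ω} {K : BoxIntegral.Box (Fin d)}
    (h : ∀ᵐ x ∂volume.restrict Ω, x ∈ cell K → H10.toL2 u x = H10.toL2 v x) :
    ∀ᵐ x ∂volume.restrict Ω, x ∈ cell K → H10.grad u x = H10.grad v x := by
  have hsub : ∀ᵐ x ∂volume.restrict Ω, x ∈ cell K → H10.toL2 (u - v) x = 0 := by
    rw [map_sub]
    filter_upwards [h, Lp.coeFn_sub (H10.toL2 u) (H10.toL2 v)] with x hx hsubx hxK
    rw [hsubx, Pi.sub_apply, hx hxK, sub_self]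
  have hgrad := H10.grad_eq_zero_on_cell (u - v) hsub
  rw [map_sub] at hgrad
  filter_upwards [hgrad, Lp.coeFn_sub (H10.grad u) (H10.grad v)] with x hx hsubx hxK
  exact sub_eq_zero.1 (hsubx.symm.trans (hx hxK))

theorem setIntegral_restrict_of_eq_zero {f : EuclideanSpace ℝ (Fin d) → ℝ}
    {S : Set (EuclideanSpace ℝ (Fin d))} (hS : MeasurableSet S) (hf : ∀ x ∉ Ω, f x = 0) :
    ∫ x in S, f x ∂(volume.restrict Ω) = ∫ x in S, f x := by
  rw [← integral_indicator hS, ← integral_indicator hS]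
  exact setIntegral_eq_integral_of_forall_compl_eq_zero fun x hx =>
    indicator_apply_eq_zero.2 fun _ => hf x hx

theorem H10.IsTest.variance_le {u : H10 Ω} {φ : EuclideanSpace ℝ (Fin d) → ℝ}
    (h : H10.IsTest u φ) (K : BoxIntegral.Box (Fin d)) {D : ℝ}
    (hD : ∀ x ∈ cell K, ∀ y ∈ cell K, ‖y - x‖ ≤ D) :
    2 * (volume.real (cell K) * (∫ x in cell K, ‖H10.toL2 u x‖ ^ 2 ∂(volume.restrict Ω)) -
      (∫ x in cell K, H10.toL2 u x ∂(volume.restrict Ω)) ^ 2) ≤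
      2 ^ d * D ^ 2 * volume.real (cell K) *
        ∫ x in cell K, ‖H10.grad u x‖ ^ 2 ∂(volume.restrict Ω) := by
  have hK := measurableSet_cell K
  have φ_eq_zero : ∀ x ∉ Ω, φ x = 0 := fun x hx =>
    image_eq_zero_of_notMem_tsupport fun hx' => hx (h.tsupport_subset hx')
  have fderiv_eq_zero : ∀ x ∉ Ω, fderiv ℝ φ x = 0 := fun x hx =>
    image_eq_zero_of_notMem_tsupport fun hx' =>
      hx (h.tsupport_subset (tsupport_fderiv_subset (𝕜 := ℝ) hx'))
  have integral_sq : ∫ x in cell K, ‖H10.toL2 u x‖ ^ 2 ∂(volume.restrict Ω) =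
      ∫ x in cell K, φ x ^ 2 := by
    rw [← setIntegral_restrict_of_eq_zero (Ω := Ω) hK fun x hx => by rw [φ_eq_zero x hx, sq,
      zero_mul]]
    refine integral_congr_ae (ae_restrict_of_ae (h.toL2_ae_eq.mono fun x hx => ?_))
    simp only [hx, Real.norm_eq_abs, sq_abs]
  have integral_val : ∫ x in cell K, H10.toL2 u x ∂(volume.restrict Ω) = ∫ x in cell K, φ x := by
    rw [← setIntegral_restrict_of_eq_zero (Ω := Ω) hK φ_eq_zero]
    exact integral_congr_ae (ae_restrict_of_ae h.toL2_ae_eq)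
  have integral_grad : ∫ x in cell K, ‖H10.grad u x‖ ^ 2 ∂(volume.restrict Ω) =
      ∫ x in cell K, ‖fderiv ℝ φ x‖ ^ 2 := by
    rw [← setIntegral_restrict_of_eq_zero (Ω := Ω) hK fun x hx => by rw [fderiv_eq_zero x hx,
      norm_zero, sq, zero_mul]]
    refine integral_congr_ae (ae_restrict_of_ae (h.grad_ae_eq.mono fun x hx => ?_))
    simp only [hx, norm_gradient]
  have hvar := variance_le_integral_norm_fderiv_sq (μ := volume) (h.contDiff.of_le (by simp))
    (isCompact_cell K) (convex_cell K) hD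
  rwa [finrank_euclideanSpace_fin, ← integral_sq, ← integral_val, ← integral_grad] at hvar

theorem H10.variance_le (K : BoxIntegral.Box (Fin d)) {D : ℝ}
    (hD : ∀ x ∈ cell K, ∀ y ∈ cell K, ‖y - x‖ ≤ D) (u : H10 Ω) :
    2 * (volume.real (cell K) * (∫ x in cell K, ‖H10.toL2 u x‖ ^ 2 ∂(volume.restrict Ω)) -
      (∫ x in cell K, H10.toL2 u x ∂(volume.restrict Ω)) ^ 2) ≤
      2 ^ d * D ^ 2 * volume.real (cell K) *
        ∫ x in cell K, ‖H10.grad u x‖ ^ 2 ∂(volume.restrict Ω) := by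
  refine H10.induction_closed ?_ (fun u φ h => h.variance_le K hD) u
  have hfin : (volume.restrict Ω) (cell K) ≠ ⊤ :=
    ((Measure.restrict_apply_le _ _).trans_lt (isCompact_cell K).measure_lt_top).ne
  have hmean : Continuous fun f : L2 Ω => ∫ x in cell K, f x ∂(volume.restrict Ω) := by
    simp only [← L2.inner_indicatorConstLp_one (𝕜 := ℝ) (measurableSet_cell K) hfin]
    fun_prop
  exact isClosed_le (continuous_const.mul ((continuous_const.mul
    ((continuous_setIntegral_norm_sq _ _).comp H10.toL2.continuous)).sub
      ((hmean.comp H10.toL2.continuous).pow 2)))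
    (continuous_const.mul ((continuous_setIntegral_norm_sq _ _).comp H10.grad.continuous))

theorem H10.poincare (K : BoxIntegral.Box (Fin d)) {D : ℝ}
    (hD : ∀ x ∈ cell K, ∀ y ∈ cell K, ‖y - x‖ ≤ D) (u : H10 Ω)
    (hmean : ∫ x in cell K, H10.toL2 u x ∂(volume.restrict Ω) = 0) :
    ∫ x in cell K, H10.toL2 u x ^ 2 ∂(volume.restrict Ω) ≤
      2 ^ d * D ^ 2 * ∫ x in cell K, ‖H10.grad u x‖ ^ 2 ∂(volume.restrict Ω) := by
  have hpos := volume_real_cell_pos K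
  have hvar := H10.variance_le K hD u
  simp only [hmean, Real.norm_eq_abs, sq_abs] at hvar
  have hnonneg : 0 ≤ ∫ x in cell K, H10.toL2 u x ^ 2 ∂(volume.restrict Ω) :=
    integral_nonneg fun x => sq_nonneg _
  refine le_of_mul_le_mul_left ?_ hpos
  nlinarith [mul_nonneg hpos.le hnonneg]

/-! ### Bubble functions dual to polynomials -/

section DualTestFunctions

variable {E ι : Type*} [NormedAddCommGroup E] [NormedSpace ℝ E] [MeasurableSpace E]
  [BorelSpace E] {μ : Measure E} {U : TopologicalSpace.Opens E} {f : ι → E → ℝ}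

/-- The moments `(∫ φ fⱼ)ⱼ` of a test function `φ`. -/
noncomputable def moments (μ : Measure E) (U : TopologicalSpace.Opens E) (f : ι → E → ℝ) :
    𝓓(U, ℝ) →ₗ[ℝ] ι → ℝ :=
  LinearMap.pi fun j =>
    (TestFunction.integralAgainstBilinCLM (.mul ℝ ℝ) μ (f j) : 𝓓(U, ℝ) →L[ℝ] ℝ).toLinearMap

theorem moments_apply (hf : ∀ j, LocallyIntegrableOn (f j) U μ) (φ : 𝓓(U, ℝ)) (j : ι) :
    moments μ U f φ j = ∫ x, φ x * f j x ∂μ :=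
  TestFunction.integralAgainstBilinCLM_eq_integral (hf j)

variable [FiniteDimensional ℝ E] [Fintype ι]

theorem range_moments_eq_top (hf : ∀ j, LocallyIntegrableOn (f j) U μ)
    (hindep : ∀ c : ι → ℝ, (∀ᵐ x ∂μ, x ∈ U → ∑ j, c j * f j x = 0) → c = 0) :
    LinearMap.range (moments μ U f) = ⊤ := by
  classical
  by_contra hne
  obtain ⟨Λ, hΛ, hker⟩ := Submodule.exists_le_ker_of_lt_top _ (lt_top_iff_ne_top.2 hne)
  let c : ι → ℝ := fun j => Λ fun i => if j = i then 1 else 0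
  have hΛ_eq : ∀ y, Λ y = ∑ j, y j * c j := fun y => LinearMap.pi_apply_eq_sum_univ Λ y
  have hloc : LocallyIntegrableOn (fun x => ∑ j, c j * f j x) U μ := fun x hx => by
    choose s hs hint using fun j => hf j x hx
    exact ⟨⋂ j, s j, Filter.iInter_mem.2 hs, integrable_finsetSum _ fun j _ =>
      ((hint j).mono_set (iInter_subset s j)).const_mul (c j)⟩
  have hc : c = 0 := by
    refine hindep c (U.2.ae_eq_zero_of_integral_contDiff_smul_eq_zero hloc fun φ hφ hφc hφU => ?_)
    let ψ : 𝓓(U, ℝ) := ⟨φ, hφ, hφc, hφU⟩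
    have hψ : Λ (moments μ U f ψ) = 0 := hker ⟨ψ, rfl⟩
    have hint : ∀ j, Integrable (fun x => ψ x * f j x) μ := fun j =>
      ψ.integrable_bilin (.mul ℝ ℝ) (hf j)
    simp only [hΛ_eq, moments_apply hf, ← integral_mul_const] at hψ
    rw [← integral_finsetSum _ fun j _ => (hint j).mul_const (c j)] at hψ
    refine Eq.trans (integral_congr_ae (ae_of_all μ fun x => ?_)) hψ
    change φ x • ∑ j, c j * f j x = ∑ j, φ x * f j x * c j
    rw [smul_eq_mul, Finset.mul_sum]
    exact Finset.sum_congr rfl fun j _ => by ring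
  exact hΛ (LinearMap.ext fun y => by simp [hΛ_eq, hc])

theorem exists_dual_testFunction [DecidableEq ι] (hf : ∀ j, LocallyIntegrableOn (f j) U μ)
    (hindep : ∀ c : ι → ℝ, (∀ᵐ x ∂μ, x ∈ U → ∑ j, c j * f j x = 0) → c = 0) :
    ∃ b : ι → 𝓓(U, ℝ), ∀ k j, ∫ x, b k x * f j x ∂μ = if k = j then 1 else 0 := by
  choose b hb using fun k : ι =>
    LinearMap.range_eq_top.1 (range_moments_eq_top hf hindep) (Pi.single k 1)
  refine ⟨b, fun k j => ?_⟩
  rw [← moments_apply hf, hb, Pi.single_apply]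
  simp only [eq_comm]

end DualTestFunctions

section Polynomial

variable {p : ℕ} {q : MvPolynomial (Fin d) ℝ}

theorem continuous_eval (q : MvPolynomial (Fin d) ℝ) :
    Continuous fun x : EuclideanSpace ℝ (Fin d) => MvPolynomial.eval (fun i => x i) q :=
  (MvPolynomial.continuous_eval q).comp (by fun_prop)

theorem degreeOf_affine_le (s t : ℝ) (i j : Fin d) :
    MvPolynomial.degreeOf i (.C s + .C t * .X j : MvPolynomial (Fin d) ℝ) ≤
      if i = j then 1 else 0 := by
  refine (MvPolynomial.degreeOf_add_le _ _ _).trans (max_le ?_ ?_)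
  · simp only [MvPolynomial.degreeOf_C, zero_le]
  · exact (MvPolynomial.degreeOf_C_mul_le _ _ _).trans (MvPolynomial.degreeOf_X i j).le

theorem bind₁_affine_mem_restrictDegree (s t : Fin d → ℝ)
    (hq : q ∈ MvPolynomial.restrictDegree (Fin d) ℝ p) :
    MvPolynomial.bind₁ (fun i => .C (s i) + .C (t i) * .X i) q ∈
      MvPolynomial.restrictDegree (Fin d) ℝ p := by
  rw [MvPolynomial.mem_restrictDegree] at hq
  rw [q.as_sum, map_sum]
  refine Submodule.sum_mem _ fun n hn => ?_
  rw [MvPolynomial.bind₁_monomial, ← MvPolynomial.smul_eq_C_mul]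
  refine Submodule.smul_mem _ _ ((MvPolynomial.mem_restrictDegree _ _ _).2 fun m hm i => ?_)
  refine (MvPolynomial.degreeOf_le_iff.1 ?_ m hm).trans (hq n hn i)
  calc MvPolynomial.degreeOf i (∏ j ∈ n.support, (.C (s j) + .C (t j) * .X j) ^ n j)
      ≤ ∑ j ∈ n.support, n j * if i = j then 1 else 0 :=
        (MvPolynomial.degreeOf_prod_le _ _ _).trans <| Finset.sum_le_sum fun j _ =>
          (MvPolynomial.degreeOf_pow_le _ _ _).trans <|
            Nat.mul_le_mul_left _ (degreeOf_affine_le _ _ _ _)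
    _ ≤ n i := by
        simp only [mul_ite, mul_one, mul_zero, Finset.sum_ite_eq]
        split_ifs <;> simp only [zero_le, le_refl]

end Polynomial

/-- The open unit cube `(0,1)ᵈ`, the reference element. -/
def unitCube (d : ℕ) : TopologicalSpace.Opens (EuclideanSpace ℝ (Fin d)) where
  carrier := {x | ∀ i, x i ∈ Ioo (0 : ℝ) 1}
  is_open' := by
    rw [ofPred_forall]
    exact isOpen_iInter_of_finite fun i => isOpen_Ioo.preimage (by fun_prop)

theorem eq_zero_of_ae_eval_eq_zero {q : MvPolynomial (Fin d) ℝ}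
    (h : ∀ᵐ x : EuclideanSpace ℝ (Fin d), x ∈ unitCube d →
      MvPolynomial.eval (fun i => x i) q = 0) : q = 0 := by
  have hcube : EqOn (fun x : EuclideanSpace ℝ (Fin d) => MvPolynomial.eval (fun i => x i) q) 0
      (unitCube d) :=
    Measure.eqOn_open_of_ae_eq ((ae_restrict_iff' (unitCube d).2.measurableSet).2 h)
      (unitCube d).2 (continuous_eval q).continuousOn continuousOn_const
  refine MvPolynomial.funext_set (fun _ => Ioo (0 : ℝ) 1) (fun _ => Ioo_infinite zero_lt_one)
    fun x hx => ?_
  rw [map_zero]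
  exact hcube (x := WithLp.toLp 2 x) fun i => hx i (mem_univ i)

/-- The test functions `b k` on the unit cube are dual to the basis `e` of the polynomials of
partial degree at most `p`. -/
def IsDualBubbleFamily {p : ℕ} {ι : Type*} [DecidableEq ι]
    (e : Module.Basis ι ℝ (MvPolynomial.restrictDegree (Fin d) ℝ p))
    (b : ι → 𝓓(unitCube d, ℝ)) : Prop :=
  ∀ k j, ∫ x, b k x * MvPolynomial.eval (fun i => x i) (e j).1 = if k = j then 1 else 0

theorem exists_isDualBubbleFamily {p : ℕ} {ι : Type*} [Finite ι] [DecidableEq ι]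
    (e : Module.Basis ι ℝ (MvPolynomial.restrictDegree (Fin d) ℝ p)) :
    ∃ b, IsDualBubbleFamily e b := by
  have := Fintype.ofFinite ι
  refine exists_dual_testFunction
    (fun j => (continuous_eval (e j).1).locallyIntegrable.locallyIntegrableOn _) fun c hc => ?_
  have hsum : ∑ j, c j • e j = 0 := Subtype.ext <| eq_zero_of_ae_eval_eq_zero <| by
    simpa [MvPolynomial.smul_eval] using hc
  exact funext (Fintype.linearIndependent_iff.1 e.linearIndependent c hsum)

/-! ### Scaling to an element -/

section Scale

variable (K : BoxIntegral.Box (Fin d))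

theorem side_pos (i : Fin d) : 0 < K.upper i - K.lower i := sub_pos.2 (K.lower_lt_upper i)

/-- The linear part of the affine map of the rectangle `K` onto the unit cube. -/
noncomputable def scaleLin : EuclideanSpace ℝ (Fin d) ≃L[ℝ] EuclideanSpace ℝ (Fin d) :=
  LinearEquiv.toContinuousLinearEquiv
    { toFun := fun x => WithLp.toLp 2 fun i => (K.upper i - K.lower i)⁻¹ * x i
      invFun := fun x => WithLp.toLp 2 fun i => (K.upper i - K.lower i) * x i
      map_add' := fun x y => by ext i; simp [mul_add]
      map_smul' := fun c x => by ext i; simp [mul_left_comm]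
      left_inv := fun x => by ext i; simp [(side_pos K i).ne']
      right_inv := fun x => by ext i; simp [(side_pos K i).ne'] }

/-- The affine map of the rectangle `K` onto the unit cube. -/
noncomputable def scale : EuclideanSpace ℝ (Fin d) ≃ₜ EuclideanSpace ℝ (Fin d) :=
  (Homeomorph.subRight (WithLp.toLp 2 K.lower)).trans (scaleLin K).toHomeomorph

/-- The volume of the rectangle `K`, as the Jacobian determinant of the inverse of `scale K`. -/
noncomputable def jacobian : ℝ :=
  |(LinearMap.det (scaleLin K : EuclideanSpace ℝ (Fin d) →ₗ[ℝ] EuclideanSpace ℝ (Fin d)))⁻¹|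

theorem scaleLin_apply (x : EuclideanSpace ℝ (Fin d)) (i : Fin d) :
    scaleLin K x i = (K.upper i - K.lower i)⁻¹ * x i := rfl

theorem scale_apply (x : EuclideanSpace ℝ (Fin d)) (i : Fin d) :
    scale K x i = (K.upper i - K.lower i)⁻¹ * (x i - K.lower i) := rfl

theorem hasFDerivAt_scale (x : EuclideanSpace ℝ (Fin d)) :
    HasFDerivAt (scale K)
      (scaleLin K : EuclideanSpace ℝ (Fin d) →L[ℝ] EuclideanSpace ℝ (Fin d)) x :=
  (scaleLin K).hasFDerivAt.comp x ((hasFDerivAt_id x).sub_const (WithLp.toLp 2 K.lower))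

theorem contDiff_scale : ContDiff ℝ ∞ (scale K) :=
  (scaleLin K).contDiff.comp (contDiff_id.sub contDiff_const)

theorem norm_scaleLin_le {h : ℝ} (hh : 0 < h) (hside : ∀ i, h ≤ K.upper i - K.lower i) :
    ‖(scaleLin K : EuclideanSpace ℝ (Fin d) →L[ℝ] EuclideanSpace ℝ (Fin d))‖ ≤ h⁻¹ := by
  refine ContinuousLinearMap.opNorm_le_bound _ (by positivity) fun x => ?_
  refine le_of_sq_le_sq ?_ (by positivity)
  rw [mul_pow, EuclideanSpace.norm_sq_eq, EuclideanSpace.norm_sq_eq, Finset.mul_sum]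
  refine Finset.sum_le_sum fun i _ => ?_
  rw [ContinuousLinearEquiv.coe_coe, scaleLin_apply, norm_mul, mul_pow, Real.norm_eq_abs,
    abs_of_pos (inv_pos.2 (side_pos K i))]
  have hinv : (K.upper i - K.lower i)⁻¹ ≤ h⁻¹ := inv_anti₀ hh (hside i)
  have hnonneg : 0 ≤ (K.upper i - K.lower i)⁻¹ := (inv_pos.2 (side_pos K i)).le
  gcongr

theorem preimage_scale_unitCube : scale K ⁻¹' unitCube d = interior (cell K) := by
  rw [interior_cell]
  ext x
  refine forall_congr' fun i => ?_
  rw [scale_apply, mem_Ioo, mem_Ioo, inv_mul_lt_one₀ (side_pos K i),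
    mul_pos_iff_of_pos_left (inv_pos.2 (side_pos K i)), sub_pos, sub_lt_sub_iff_right]

theorem jacobian_pos : 0 < jacobian K :=
  abs_pos.2 (inv_ne_zero (scaleLin K).toLinearEquiv.isUnit_det'.ne_zero)

theorem integral_comp_scale (f : EuclideanSpace ℝ (Fin d) → ℝ) :
    ∫ x, f (scale K x) = jacobian K * ∫ x, f x := by
  have hmap : Measure.map (scaleLin K) volume = ENNReal.ofReal (jacobian K) • volume :=
    Measure.map_linearMap_addHaar_eq_smul_addHaar volume
      (scaleLin K).toLinearEquiv.isUnit_det'.ne_zero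
  calc ∫ x, f (scale K x)
      = ∫ x, f (scaleLin K x) :=
        integral_sub_right_eq_self (fun x => f (scaleLin K x)) (WithLp.toLp 2 K.lower)
    _ = ∫ x, f x ∂Measure.map (scaleLin K) volume :=
        ((scaleLin K).toHomeomorph.measurableEmbedding.integral_map f).symm
    _ = jacobian K * ∫ x, f x := by
        rw [hmap, integral_smul_measure, ENNReal.toReal_ofReal (jacobian_pos K).le, smul_eq_mul]

theorem setIntegral_comp_scale (f : EuclideanSpace ℝ (Fin d) → ℝ) :
    ∫ x in cell K, f (scale K x) = jacobian K * ∫ x in unitCube d, f x := by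
  rw [← setIntegral_congr_set (interior_cell_ae_eq K), ← preimage_scale_unitCube,
    ← integral_indicator ((unitCube d).isOpen.preimage (scale K).continuous).measurableSet,
    ← integral_indicator (unitCube d).isOpen.measurableSet, ← integral_comp_scale]
  rfl

theorem exists_eval_eq_eval_scale {p : ℕ} {q : MvPolynomial (Fin d) ℝ}
    (hq : q ∈ MvPolynomial.restrictDegree (Fin d) ℝ p) :
    ∃ r ∈ MvPolynomial.restrictDegree (Fin d) ℝ p, ∀ x : EuclideanSpace ℝ (Fin d),
      MvPolynomial.eval (fun i => x i) q = MvPolynomial.eval (fun i => scale K x i) r := by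
  refine ⟨_, bind₁_affine_mem_restrictDegree K.lower (fun i => K.upper i - K.lower i) hq,
    fun x => ?_⟩
  have hx : ∀ i, K.lower i + (K.upper i - K.lower i) * scale K x i = x i := fun i => by
    rw [scale_apply, mul_inv_cancel_left₀ (side_pos K i).ne', add_sub_cancel]
  rw [MvPolynomial.eval, MvPolynomial.eval, MvPolynomial.eval₂Hom_bind₁]
  simp only [map_add, map_mul, MvPolynomial.eval₂Hom_C, MvPolynomial.eval₂Hom_X', RingHom.id_apply,
    hx]

/-- The interior of the rectangle `K`, as an open set. -/
def cellInterior : TopologicalSpace.Opens (EuclideanSpace ℝ (Fin d)) :=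
  ⟨interior (cell K), isOpen_interior⟩

/-- A test function on the unit cube transported to the rectangle `K`. -/
noncomputable def cellBubble (b : 𝓓(unitCube d, ℝ)) : 𝓓(cellInterior K, ℝ) where
  toFun x := b (scale K x)
  contDiff' := b.contDiff.comp (contDiff_scale K)
  hasCompactSupport' := b.hasCompactSupport.comp_homeomorph (scale K)
  tsupport_subset' := by
    change _ ⊆ interior (cell K)
    rw [← preimage_scale_unitCube, ← Function.comp_def, tsupport_comp_eq_preimage]
    exact preimage_mono b.tsupport_subset

theorem cellBubble_apply (b : 𝓓(unitCube d, ℝ)) (x : EuclideanSpace ℝ (Fin d)) :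
    cellBubble K b x = b (scale K x) := rfl

theorem norm_fderiv_cellBubble_le {h : ℝ} (hh : 0 < h)
    (hside : ∀ i, h ≤ K.upper i - K.lower i) (b : 𝓓(unitCube d, ℝ))
    (x : EuclideanSpace ℝ (Fin d)) :
    ‖fderiv ℝ (cellBubble K b) x‖ ≤ h⁻¹ * ‖fderiv ℝ b (scale K x)‖ := by
  have hderiv : HasFDerivAt (cellBubble K b) ((fderiv ℝ b (scale K x)).comp
      (scaleLin K : EuclideanSpace ℝ (Fin d) →L[ℝ] EuclideanSpace ℝ (Fin d))) x :=
    (b.contDiff.differentiable (by simp) _).hasFDerivAt.comp x (hasFDerivAt_scale K x)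
  rw [hderiv.fderiv, mul_comm]
  exact (ContinuousLinearMap.opNorm_comp_le _ _).trans
    (mul_le_mul_of_nonneg_left (norm_scaleLin_le K hh hside) (norm_nonneg _))

end Scale

/-! ### Correction of the moments on an element -/

theorem memLp_restrict_cell {ν : Measure (EuclideanSpace ℝ (Fin d))}
    [IsFiniteMeasureOnCompacts ν] (K : BoxIntegral.Box (Fin d))
    {f : EuclideanSpace ℝ (Fin d) → ℝ} (hf : Continuous f) : MemLp f 2 (ν.restrict (cell K)) := by
  obtain ⟨C, hC⟩ := (isCompact_cell K).exists_bound_of_continuousOn hf.continuousOn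
  have : IsFiniteMeasure (ν.restrict (cell K)) := ⟨by
    rw [Measure.restrict_apply_univ]
    exact (isCompact_cell K).measure_lt_top⟩
  exact MemLp.of_bound hf.aestronglyMeasurable C
    (ae_restrict_of_forall_mem (measurableSet_cell K) hC)

section Correction

variable {p : ℕ} {ι : Type*}
  {e : Module.Basis ι ℝ (MvPolynomial.restrictDegree (Fin d) ℝ p)} {b : ι → 𝓓(unitCube d, ℝ)}
  {K : BoxIntegral.Box (Fin d)} {u v : EuclideanSpace ℝ (Fin d) → ℝ}

/-- The scaled moment of `u` on `K` against the transported basis polynomial `e k`; it is the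
coefficient of the `k`-th bubble in `cellCorrection`. -/
noncomputable def scaledMoment (K : BoxIntegral.Box (Fin d))
    (e : Module.Basis ι ℝ (MvPolynomial.restrictDegree (Fin d) ℝ p))
    (u : EuclideanSpace ℝ (Fin d) → ℝ) (k : ι) : ℝ :=
  (jacobian K)⁻¹ * ∫ x in cell K, MvPolynomial.eval (fun i => scale K x i) (e k).1 * u x

theorem memLp_eval_scale (q : MvPolynomial (Fin d) ℝ) :
    MemLp (fun x => MvPolynomial.eval (fun i => scale K x i) q) 2 (volume.restrict (cell K)) :=
  memLp_restrict_cell K ((continuous_eval q).comp (scale K).continuous)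

theorem integral_eval_mul_eq_of_scaledMoment_eq [Finite ι]
    (hu : MemLp u 2 (volume.restrict (cell K))) (hv : MemLp v 2 (volume.restrict (cell K)))
    (h : scaledMoment K e u = scaledMoment K e v) {q : MvPolynomial (Fin d) ℝ}
    (hq : q ∈ MvPolynomial.restrictDegree (Fin d) ℝ p) :
    ∫ x in cell K, MvPolynomial.eval (fun i => x i) q * u x =
      ∫ x in cell K, MvPolynomial.eval (fun i => x i) q * v x := by
  have := Fintype.ofFinite ι
  obtain ⟨r, hr, hqr⟩ := exists_eval_eq_eval_scale K hq
  have expand : ∀ w : EuclideanSpace ℝ (Fin d) → ℝ, MemLp w 2 (volume.restrict (cell K)) →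
      ∫ x in cell K, MvPolynomial.eval (fun i => x i) q * w x =
        jacobian K * ∑ k, e.repr ⟨r, hr⟩ k * scaledMoment K e w k := fun w hw => by
    have hsum : ∀ x, MvPolynomial.eval (fun i => x i) q * w x = ∑ k, e.repr ⟨r, hr⟩ k *
        (MvPolynomial.eval (fun i => scale K x i) (e k).1 * w x) := fun x => by
      have hrepr : r = ∑ k, e.repr ⟨r, hr⟩ k • (e k).1 := by
        simpa only [Submodule.coe_sum, Submodule.coe_smul] using
          congrArg Subtype.val (e.sum_repr ⟨r, hr⟩).symm
      rw [hqr]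
      conv_lhs => rw [hrepr]
      simp only [map_sum, MvPolynomial.smul_eval, Finset.sum_mul, mul_assoc]
    simp only [hsum, scaledMoment, Finset.mul_sum]
    rw [integral_finsetSum _ fun k _ => Integrable.const_mul
      (f := fun x => MvPolynomial.eval (fun i => scale K x i) (e k).1 * w x)
      ((memLp_eval_scale _).integrable_mul hw) _]
    refine Finset.sum_congr rfl fun k _ => ?_
    rw [integral_const_mul, mul_left_comm, mul_inv_cancel_left₀ (jacobian_pos K).ne']
  rw [expand u hu, expand v hv, h]

theorem sq_scaledMoment_le (hu : MemLp u 2 (volume.restrict (cell K))) (k : ι) :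
    scaledMoment K e u k ^ 2 ≤ (jacobian K)⁻¹ *
      (∫ x in (unitCube d : Set (EuclideanSpace ℝ (Fin d))),
        MvPolynomial.eval (fun i => x i) (e k).1 ^ 2) *
        ∫ x in cell K, u x ^ 2 := by
  rw [scaledMoment, mul_pow]
  refine (mul_le_mul_of_nonneg_left (sq_integral_mul_le (memLp_eval_scale _) hu)
    (sq_nonneg _)).trans_eq ?_
  rw [setIntegral_comp_scale K fun y => MvPolynomial.eval (fun i => y i) (e k).1 ^ 2]
  field_simp [(jacobian_pos K).ne']

variable [Fintype ι]

/-- The combination of bubbles on `K` that has the same moments as `u` against the polynomials of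
partial degree at most `p`. -/
noncomputable def cellCorrection (K : BoxIntegral.Box (Fin d))
    (e : Module.Basis ι ℝ (MvPolynomial.restrictDegree (Fin d) ℝ p)) (b : ι → 𝓓(unitCube d, ℝ))
    (u : EuclideanSpace ℝ (Fin d) → ℝ) : 𝓓(cellInterior K, ℝ) :=
  ∑ k, scaledMoment K e u k • cellBubble K (b k)

theorem cellCorrection_apply (x : EuclideanSpace ℝ (Fin d)) :
    cellCorrection K e b u x = ∑ k, scaledMoment K e u k * b k (scale K x) := by
  simp only [cellCorrection, sum_apply, smul_apply, cellBubble_apply, smul_eq_mul]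

theorem scaledMoment_cellCorrection [DecidableEq ι] (hb : IsDualBubbleFamily e b) :
    scaledMoment K e (cellCorrection K e b u) = scaledMoment K e u := by
  funext j
  have hdual : ∀ k, ∫ x in cell K, b k (scale K x) *
      MvPolynomial.eval (fun i => scale K x i) (e j).1 =
        jacobian K * if k = j then 1 else 0 := fun k => by
    rw [setIntegral_comp_scale K fun y => b k y * MvPolynomial.eval (fun i => y i) (e j).1,
      ← hb k j]
    congr 1
    refine setIntegral_eq_integral_of_forall_compl_eq_zero fun x hx => ?_
    rw [image_eq_zero_of_notMem_tsupport fun h => hx ((b k).tsupport_subset h), zero_mul]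
  have hint : ∀ k, Integrable (fun x => scaledMoment K e u k * (b k (scale K x) *
      MvPolynomial.eval (fun i => scale K x i) (e j).1)) (volume.restrict (cell K)) := fun k =>
    ((memLp_restrict_cell K ((b k).continuous.comp (scale K).continuous)).integrable_mul
      (memLp_eval_scale _)).const_mul _
  have hsum : ∀ x, MvPolynomial.eval (fun i => scale K x i) (e j).1 * cellCorrection K e b u x =
      ∑ k, scaledMoment K e u k * (b k (scale K x) *
        MvPolynomial.eval (fun i => scale K x i) (e j).1) := fun x => by
    rw [cellCorrection_apply, Finset.mul_sum]
    exact Finset.sum_congr rfl fun k _ => by ring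
  rw [scaledMoment]
  simp only [hsum]
  rw [integral_finsetSum _ fun k _ => hint k]
  simp only [integral_const_mul, hdual, mul_ite, mul_one, mul_zero, Finset.sum_ite_eq',
    Finset.mem_univ, if_true]
  rw [mul_left_comm, inv_mul_cancel₀ (jacobian_pos K).ne', mul_one]

/-- The constant in the inverse estimate `integral_norm_fderiv_cellCorrection_sq_le`. -/
noncomputable def correctionConst
    (e : Module.Basis ι ℝ (MvPolynomial.restrictDegree (Fin d) ℝ p))
    (b : ι → 𝓓(unitCube d, ℝ)) : ℝ :=
  Fintype.card ι * ∑ k, (∫ x in (unitCube d : Set (EuclideanSpace ℝ (Fin d))),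
        MvPolynomial.eval (fun i => x i) (e k).1 ^ 2) *
    ∫ x in (unitCube d : Set (EuclideanSpace ℝ (Fin d))), ‖fderiv ℝ (b k) x‖ ^ 2

theorem correctionConst_nonneg : 0 ≤ correctionConst e b :=
  mul_nonneg (Nat.cast_nonneg _) <| Finset.sum_nonneg fun _ _ =>
    mul_nonneg (integral_nonneg fun _ => sq_nonneg _) (integral_nonneg fun _ => sq_nonneg _)

theorem norm_fderiv_cellCorrection_sq_le {h : ℝ} (hh : 0 < h)
    (hside : ∀ i, h ≤ K.upper i - K.lower i) (x : EuclideanSpace ℝ (Fin d)) :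
    ‖fderiv ℝ (cellCorrection K e b u) x‖ ^ 2 ≤ Fintype.card ι / h ^ 2 *
      ∑ k, scaledMoment K e u k ^ 2 * ‖fderiv ℝ (b k) (scale K x)‖ ^ 2 := by
  have hderiv : fderiv ℝ (cellCorrection K e b u) x =
      ∑ k, scaledMoment K e u k • fderiv ℝ (cellBubble K (b k)) x := by
    rw [show ⇑(cellCorrection K e b u) = fun y => ∑ k, scaledMoment K e u k • cellBubble K (b k) y
      from funext fun y => cellCorrection_apply y]
    exact (HasFDerivAt.fun_sum fun k _ => (((cellBubble K (b k)).contDiff.differentiable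
      (by simp) x).hasFDerivAt).const_smul (scaledMoment K e u k)).fderiv
  have hterm : ∀ k, ‖scaledMoment K e u k • fderiv ℝ (cellBubble K (b k)) x‖ ≤
      h⁻¹ * (|scaledMoment K e u k| * ‖fderiv ℝ (b k) (scale K x)‖) := fun k => by
    rw [norm_smul, Real.norm_eq_abs, mul_left_comm]
    exact mul_le_mul_of_nonneg_left (norm_fderiv_cellBubble_le K hh hside (b k) x) (abs_nonneg _)
  calc ‖fderiv ℝ (cellCorrection K e b u) x‖ ^ 2
      ≤ (∑ k, h⁻¹ * (|scaledMoment K e u k| * ‖fderiv ℝ (b k) (scale K x)‖)) ^ 2 := by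
        rw [hderiv]
        gcongr
        exact norm_sum_le_of_le _ fun k _ => hterm k
    _ ≤ Fintype.card ι *
          ∑ k, (h⁻¹ * (|scaledMoment K e u k| * ‖fderiv ℝ (b k) (scale K x)‖)) ^ 2 :=
        sq_sum_le_card_mul_sum_sq
    _ = Fintype.card ι / h ^ 2 *
          ∑ k, scaledMoment K e u k ^ 2 * ‖fderiv ℝ (b k) (scale K x)‖ ^ 2 := by
        simp only [mul_pow, sq_abs, ← Finset.mul_sum, inv_pow]
        ring

theorem integral_norm_fderiv_cellCorrection_sq_le {h : ℝ} (hh : 0 < h)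
    (hside : ∀ i, h ≤ K.upper i - K.lower i) (hu : MemLp u 2 (volume.restrict (cell K))) :
    ∫ x in cell K, ‖fderiv ℝ (cellCorrection K e b u) x‖ ^ 2 ≤
      correctionConst e b / h ^ 2 * ∫ x in cell K, u x ^ 2 := by
  have hcont : ∀ k, Continuous fun x => ‖fderiv ℝ (b k) (scale K x)‖ := fun k =>
    (((b k).contDiff.continuous_fderiv (by simp)).comp (scale K).continuous).norm
  have hint : ∀ k, Integrable (fun x => scaledMoment K e u k ^ 2 *
      ‖fderiv ℝ (b k) (scale K x)‖ ^ 2) (volume.restrict (cell K)) := fun k =>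
    (memLp_restrict_cell K (hcont k)).integrable_sq.const_mul _
  have hscale : ∀ k, ∫ x in cell K, ‖fderiv ℝ (b k) (scale K x)‖ ^ 2 = jacobian K *
      ∫ x in (unitCube d : Set (EuclideanSpace ℝ (Fin d))), ‖fderiv ℝ (b k) x‖ ^ 2 := fun k =>
    setIntegral_comp_scale K fun y => ‖fderiv ℝ (b k) y‖ ^ 2
  calc ∫ x in cell K, ‖fderiv ℝ (cellCorrection K e b u) x‖ ^ 2
      ≤ ∫ x in cell K, Fintype.card ι / h ^ 2 *
          ∑ k, scaledMoment K e u k ^ 2 * ‖fderiv ℝ (b k) (scale K x)‖ ^ 2 :=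
        integral_mono_of_nonneg (ae_of_all _ fun x => sq_nonneg _)
          ((integrable_finsetSum _ fun k _ => hint k).const_mul _)
          (ae_of_all _ fun x => norm_fderiv_cellCorrection_sq_le hh hside x)
    _ = Fintype.card ι / h ^ 2 * ∑ k, scaledMoment K e u k ^ 2 *
          ∫ x in cell K, ‖fderiv ℝ (b k) (scale K x)‖ ^ 2 := by
        rw [integral_const_mul, integral_finsetSum _ fun k _ => hint k]
        simp only [integral_const_mul]
    _ ≤ Fintype.card ι / h ^ 2 * ∑ k, ((jacobian K)⁻¹ *
          (∫ x in (unitCube d : Set (EuclideanSpace ℝ (Fin d))),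
            MvPolynomial.eval (fun i => x i) (e k).1 ^ 2) * ∫ x in cell K, u x ^ 2) *
          ∫ x in cell K, ‖fderiv ℝ (b k) (scale K x)‖ ^ 2 := by
        gcongr with k
        exact sq_scaledMoment_le hu k
    _ = correctionConst e b / h ^ 2 * ∫ x in cell K, u x ^ 2 := by
        simp only [hscale, correctionConst, Finset.mul_sum, Finset.sum_mul, Finset.sum_div]
        refine Finset.sum_congr rfl fun k _ => ?_
        field_simp [(jacobian_pos K).ne']

end Correction

/-! ### Localization in the kernel of the projection -/

theorem integrable_eval_mul (K : BoxIntegral.Box (Fin d)) (q : MvPolynomial (Fin d) ℝ)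
    (u : L2 Ω) : Integrable (fun x => MvPolynomial.eval (fun i => x i) q * u x)
      ((volume.restrict Ω).restrict (cell K)) :=
  (memLp_restrict_cell K (continuous_eval q)).integrable_mul ((Lp.memLp u).restrict _)

namespace Mesh

variable (T : Mesh Ω) {p : ℕ} {w : H10 Ω}

theorem setIntegral_eval_mul_eq_zero_of_mem_kerProj (hw : w ∈ T.kerProj p)
    {K : BoxIntegral.Box (Fin d)} (hK : K ∈ T.cells) {q : MvPolynomial (Fin d) ℝ}
    (hq : q ∈ MvPolynomial.restrictDegree (Fin d) ℝ p) :
    ∫ x in cell K, MvPolynomial.eval (fun i => x i) q * H10.toL2 w x ∂(volume.restrict Ω) = 0 := by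
  have hproj : T.proj p (H10.toL2 w) = 0 := hw
  have horth := (Submodule.mem_orthogonal _ _).1
    ((Submodule.starProjection_apply_eq_zero_iff _).1 hproj)
  have hmem := (memLp_indicator_iff_restrict (measurableSet_cell K)).2
    (memLp_restrict_cell (ν := volume.restrict Ω) K (continuous_eval q))
  have hpoly : hmem.toLp _ ∈ T.polySpace p := by
    intro K' hK'
    by_cases h : K' = K
    · refine ⟨q, hq, ?_⟩
      filter_upwards [hmem.coeFn_toLp] with x hx hxK
      rw [hx, indicator_of_mem (h ▸ hxK)]
    · refine ⟨0, Submodule.zero_mem _, ?_⟩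
      filter_upwards [hmem.coeFn_toLp, T.ae_notMem_cell hK' hK h] with x hx hxK hxK'
      rw [hx, indicator_of_notMem (hxK hxK'), map_zero]
  rw [← horth _ hpoly, L2.inner_def, ← integral_indicator (measurableSet_cell K)]
  refine integral_congr_ae ?_
  filter_upwards [hmem.coeFn_toLp] with x hx
  rw [hx]
  by_cases hxK : x ∈ cell K
  · simp [indicator_of_mem hxK, mul_comm]
  · simp [indicator_of_notMem hxK]

theorem mem_kerProj_of_setIntegral_eval_mul_eq_zero
    (hw : ∀ K ∈ T.cells, ∀ q ∈ MvPolynomial.restrictDegree (Fin d) ℝ p,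
      ∫ x in cell K, MvPolynomial.eval (fun i => x i) q * H10.toL2 w x ∂(volume.restrict Ω) = 0) :
    w ∈ T.kerProj p := by
  change T.proj p (H10.toL2 w) = 0
  refine (Submodule.starProjection_apply_eq_zero_iff _).2 ((Submodule.mem_orthogonal _ _).2
    fun v hv => ?_)
  rw [L2.inner_def, ← T.sum_setIntegral_cell (L2.integrable_inner _ _)]
  refine Finset.sum_eq_zero fun K hK => ?_
  obtain ⟨q, hq, hvq⟩ := hv K hK
  rw [← hw K hK q hq]
  refine setIntegral_congr_ae (measurableSet_cell K) ?_
  filter_upwards [hvq] with x hx hxK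
  rw [hx hxK]
  simp [mul_comm]

variable {J : Finset (BoxIntegral.Box (Fin d))}

theorem exists_toL2_eq_on_cells (hΩ : interior (closure Ω) = Ω) (hJ : J ⊆ T.cells)
    (φ : ∀ K : BoxIntegral.Box (Fin d), 𝓓(cellInterior K, ℝ)) :
    ∃ w : H10 Ω,
      (∀ K ∈ J, ∀ᵐ x ∂(volume.restrict Ω), x ∈ cell K →
        H10.toL2 w x = φ K x ∧ H10.grad w x = ∇ (φ K) x) ∧
      ∀ K ∈ T.cells, K ∉ J → ∀ᵐ x ∂(volume.restrict Ω), x ∈ cell K → H10.toL2 w x = 0 := by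
  have exists_piece : ∀ K, ∃ u : H10 Ω, K ∈ J → H10.IsTest u (φ K) := fun K => by
    by_cases hK : K ∈ J
    · obtain ⟨u, hu⟩ := H10.exists_isTest (φ K).contDiff (φ K).hasCompactSupport
        ((φ K).tsupport_subset.trans (T.interior_cell_subset hΩ (hJ hK)))
      exact ⟨u, fun _ => hu⟩
    · exact ⟨0, fun h => absurd h hK⟩
  choose u hu using exists_piece
  have toL2_sum : ∀ᵐ x ∂(volume.restrict Ω),
      H10.toL2 (∑ K ∈ J, u K) x = ∑ K ∈ J, H10.toL2 (u K) x := by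
    rw [map_sum]
    exact Lp.coeFn_fun_finsetSum _ _
  have toL2_piece : ∀ᵐ x ∂(volume.restrict Ω), ∀ K ∈ J, H10.toL2 (u K) x = φ K x :=
    (eventually_all_finset J).2 fun K hK => (hu K hK).toL2_ae_eq
  have piece_eq_zero : ∀ K ∈ T.cells, ∀ᵐ x ∂(volume.restrict Ω), x ∈ cell K →
      ∀ K' ∈ J, K' ≠ K → φ K' x = 0 := fun K hK => by
    have disjoint := (eventually_all_finset J).2 fun K' hK' =>
      eventually_imp_distrib_left.2 fun h : K ≠ K' => T.ae_notMem_cell hK (hJ hK') h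
    filter_upwards [disjoint] with x hx hxK K' hK' hne
    exact image_eq_zero_of_notMem_tsupport fun h =>
      hx K' hK' hne.symm hxK (interior_subset ((φ K').tsupport_subset h))
  have toL2_eq : ∀ K ∈ J, ∀ᵐ x ∂(volume.restrict Ω), x ∈ cell K →
      H10.toL2 (∑ K ∈ J, u K) x = φ K x := fun K hK => by
    filter_upwards [toL2_sum, toL2_piece, piece_eq_zero K (hJ hK)] with x hsum hpiece hzero hxK
    rw [hsum, Finset.sum_congr rfl hpiece]
    exact Finset.sum_eq_single_of_mem K hK (hzero hxK)
  refine ⟨∑ K ∈ J, u K, fun K hK => ?_, fun K hK hKJ => ?_⟩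
  · have toL2_eq_piece : ∀ᵐ x ∂(volume.restrict Ω), x ∈ cell K →
        H10.toL2 (∑ K ∈ J, u K) x = H10.toL2 (u K) x := by
      filter_upwards [toL2_eq K hK, (hu K hK).toL2_ae_eq] with x hx hux hxK
      rw [hx hxK, hux]
    filter_upwards [toL2_eq K hK, H10.grad_eq_on_cell toL2_eq_piece, (hu K hK).grad_ae_eq]
      with x hx hgrad hux hxK
    exact ⟨hx hxK, (hgrad hxK).trans hux⟩
  · filter_upwards [toL2_sum, toL2_piece, piece_eq_zero K hK] with x hsum hpiece hzero hxK
    rw [hsum, Finset.sum_congr rfl hpiece]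
    exact Finset.sum_eq_zero fun K' hK' => hzero hxK K' hK' fun h => hKJ (h ▸ hK')

theorem exists_momentCorrection {ι : Type*} [Fintype ι] [DecidableEq ι]
    {e : Module.Basis ι ℝ (MvPolynomial.restrictDegree (Fin d) ℝ p)} {b : ι → 𝓓(unitCube d, ℝ)}
    (hb : IsDualBubbleFamily e b) (hΩ : interior (closure Ω) = Ω) (hJ : J ⊆ T.cells) {h : ℝ}
    (hh : 0 < h) (hside : ∀ K ∈ T.cells, ∀ i, h ≤ K.upper i - K.lower i) (u : L2 Ω) :
    ∃ w : H10 Ω,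
      (∀ K ∈ J, ∀ q ∈ MvPolynomial.restrictDegree (Fin d) ℝ p,
        ∫ x in cell K, MvPolynomial.eval (fun i => x i) q * H10.toL2 w x ∂(volume.restrict Ω) =
          ∫ x in cell K, MvPolynomial.eval (fun i => x i) q * u x ∂(volume.restrict Ω)) ∧
      (∀ K ∈ T.cells, K ∉ J → ∀ᵐ x ∂(volume.restrict Ω), x ∈ cell K → H10.toL2 w x = 0) ∧
      ∀ K ∈ T.cells, ∫ x in cell K, ‖H10.grad w x‖ ^ 2 ∂(volume.restrict Ω) ≤
        correctionConst e b / h ^ 2 * ∫ x in cell K, u x ^ 2 ∂(volume.restrict Ω) := by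
  obtain ⟨w, hwJ, hw⟩ := T.exists_toL2_eq_on_cells hΩ hJ fun K => cellCorrection K e b u
  have hu : ∀ K ∈ T.cells, MemLp u 2 (volume.restrict (cell K)) := fun K hK =>
    T.restrict_restrict_cell hΩ hK ▸ (Lp.memLp u).restrict (cell K)
  refine ⟨w, fun K hK q hq => ?_, hw, fun K hK => ?_⟩
  · have moments_eq := integral_eval_mul_eq_of_scaledMoment_eq
      (memLp_restrict_cell K (cellCorrection K e b u).continuous) (hu K (hJ hK))
      (scaledMoment_cellCorrection (u := u) hb) hq
    rw [setIntegral_congr_ae (measurableSet_cell K)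
      (g := fun x => MvPolynomial.eval (fun i => x i) q * cellCorrection K e b u x)
      ((hwJ K hK).mono fun x hx hxK => by rw [(hx hxK).1])]
    rwa [T.restrict_restrict_cell hΩ (hJ hK)]
  by_cases hKJ : K ∈ J
  · rw [setIntegral_congr_ae (measurableSet_cell K)
      (g := fun x => ‖fderiv ℝ (cellCorrection K e b u) x‖ ^ 2)
      ((hwJ K hKJ).mono fun x hx hxK => by rw [(hx hxK).2, norm_gradient]),
      T.restrict_restrict_cell hΩ hK]
    exact integral_norm_fderiv_cellCorrection_sq_le hh (hside K hK) (hu K hK)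
  · rw [setIntegral_congr_ae (measurableSet_cell K) (g := fun _ => 0)
      ((H10.grad_eq_zero_on_cell w (hw K hK hKJ)).mono fun x hx hxK => by
        rw [hx hxK, norm_zero, zero_pow two_ne_zero]), integral_zero]
    exact mul_nonneg (div_nonneg correctionConst_nonneg (sq_nonneg h))
      (integral_nonneg fun x => sq_nonneg _)

end Mesh

/-- The energy of `u` on the element `K`. -/
noncomputable def H10.energy (u : H10 Ω) (K : BoxIntegral.Box (Fin d)) : ℝ :=
  ∫ x in cell K, ‖H10.grad u x‖ ^ 2 ∂(volume.restrict Ω)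

theorem H10.energy_sub_le (u w : H10 Ω) (K : BoxIntegral.Box (Fin d)) :
    H10.energy (u - w) K ≤ 2 * H10.energy u K + 2 * H10.energy w K := by
  have hu := (integrable_norm_sq (H10.grad u)).integrableOn (s := cell K).const_mul 2
  have hw := (integrable_norm_sq (H10.grad w)).integrableOn (s := cell K).const_mul 2
  simp only [H10.energy]
  rw [← integral_const_mul, ← integral_const_mul, ← integral_add hu hw, map_sub]
  refine integral_mono_ae (integrable_norm_sq _).integrableOn (hu.add hw) (ae_restrict_of_ae ?_)
  filter_upwards [Lp.coeFn_sub (H10.grad u) (H10.grad w)] with x hx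
  rw [hx, Pi.sub_apply]
  nlinarith [pow_le_pow_left₀ (norm_nonneg _) (norm_sub_le (H10.grad u x) (H10.grad w x)) 2,
    sq_nonneg (‖H10.grad u x‖ - ‖H10.grad w x‖)]

namespace Mesh

variable {p : ℕ} {h r L : ℝ} {I : Finset (BoxIntegral.Box (Fin d))} {z : H10 Ω}

theorem poincare_of_mem_kerProj (T : Mesh Ω) (hz : z ∈ T.kerProj p)
    {K : BoxIntegral.Box (Fin d)} (hK : K ∈ T.cells) {D : ℝ} (hD : Metric.diam (cell K) ≤ D) :
    ∫ x in cell K, H10.toL2 z x ^ 2 ∂(volume.restrict Ω) ≤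
      2 ^ d * D ^ 2 * H10.energy z K := by
  have one_mem : (1 : MvPolynomial (Fin d) ℝ) ∈ MvPolynomial.restrictDegree (Fin d) ℝ p :=
    (MvPolynomial.mem_restrictDegree_iff_sup _ _ p).2 fun i => by
      simp only [MvPolynomial.degrees_one, Multiset.count_zero, Nat.zero_le]
  refine H10.poincare K (fun x hx y hy => ?_) z ?_
  · rw [← dist_eq_norm]
    exact (Metric.dist_le_diam_of_mem (isCompact_cell K).isBounded hy hx).trans hD
  · simpa only [map_one, one_mul] using T.setIntegral_eval_mul_eq_zero_of_mem_kerProj hz hK one_mem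

/-- The function `w` localizes `z` away from the elements in `I`: it vanishes on `I`, coincides
with `z` outside one layer around `I`, and on every element its energy is at most `C` times that
of `z`. -/
structure IsLocalization (T : Mesh Ω) (I : Finset (BoxIntegral.Box (Fin d))) (C : ℝ)
    (z w : H10 Ω) : Prop where
  eq_zero : ∀ K ∈ I, ∀ᵐ x ∂(volume.restrict Ω), x ∈ cell K → H10.toL2 w x = 0
  eq_self : ∀ K ∈ T.cells, K ∉ T.layer I →
    ∀ᵐ x ∂(volume.restrict Ω), x ∈ cell K → H10.toL2 w x = H10.toL2 z x
  energy_le : ∀ K ∈ T.cells, H10.energy w K ≤ C * H10.energy z K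

theorem exists_cutoff_mul (T : Mesh Ω) (hL : ∀ t, |deriv Real.smoothTransition t| ≤ L)
    (hΩ : IsOpen Ω) (hh : 0 < h) (hside : ∀ K ∈ T.cells, ∀ i, h ≤ K.upper i - K.lower i)
    (hI : I ⊆ T.cells) (z : H10 Ω) :
    ∃ y : H10 Ω, (H10.toL2 y =ᵐ[volume.restrict Ω] fun x => T.cutoff I h x * H10.toL2 z x) ∧
      ∀ᵐ x ∂(volume.restrict Ω), ‖H10.grad y x‖ ^ 2 ≤
        2 * ‖H10.grad z x‖ ^ 2 + 2 * (3 ^ d * (4 * d * L) / h) ^ 2 * H10.toL2 z x ^ 2 := by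
  have cutoff_abs_le : ∀ x, |T.cutoff I h x| ≤ 1 := fun x =>
    abs_le.2 ⟨(neg_one_lt_zero.le).trans (T.cutoff_mem_Icc x).1, (T.cutoff_mem_Icc x).2⟩
  have norm_fderiv_le : ∀ x ∈ Ω, ‖fderiv ℝ (T.cutoff I h) x‖ ≤ 3 ^ d * (4 * d * L) / h :=
    fun x => T.norm_fderiv_cutoff_le hL hΩ hh hside hI
  obtain ⟨y, hy, hgrad⟩ := H10.exists_mul hΩ (T.contDiffOn_cutoff hΩ hh hside hI)
    (fun x _ => cutoff_abs_le x) norm_fderiv_le z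
  refine ⟨y, hy, ?_⟩
  filter_upwards [hgrad, ae_restrict_mem hΩ.measurableSet] with x hx hxΩ
  have norm_grad_le : ‖H10.grad y x‖ ≤
      ‖H10.grad z x‖ + 3 ^ d * (4 * d * L) / h * |H10.toL2 z x| := by
    rw [hx]
    refine norm_add_le_of_le ?_ ?_
    · rw [norm_smul, Real.norm_eq_abs]
      exact mul_le_of_le_one_left (norm_nonneg _) (cutoff_abs_le x)
    · rw [norm_smul, norm_gradient, mul_comm, Real.norm_eq_abs]
      exact mul_le_mul_of_nonneg_right (norm_fderiv_le x hxΩ) (abs_nonneg _)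
  calc ‖H10.grad y x‖ ^ 2
      ≤ (‖H10.grad z x‖ + 3 ^ d * (4 * d * L) / h * |H10.toL2 z x|) ^ 2 := by gcongr
    _ ≤ 2 * (‖H10.grad z x‖ ^ 2 + (3 ^ d * (4 * d * L) / h * |H10.toL2 z x|) ^ 2) := add_sq_le
    _ = 2 * ‖H10.grad z x‖ ^ 2 + 2 * (3 ^ d * (4 * d * L) / h) ^ 2 * H10.toL2 z x ^ 2 := by
      rw [mul_pow, sq_abs]; ring

theorem exists_isLocalization_abs_le (T : Mesh Ω)
    (hL : ∀ t, |deriv Real.smoothTransition t| ≤ L) (hΩ : IsOpen Ω) (hh : 0 < h)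
    (hside : ∀ K ∈ T.cells, ∀ i, h ≤ K.upper i - K.lower i)
    (hdiam : ∀ K ∈ T.cells, Metric.diam (cell K) ≤ r * h) (hI : I ⊆ T.cells)
    (hz : z ∈ T.kerProj p) :
    ∃ y : H10 Ω, T.IsLocalization I (2 + 2 * (3 ^ d * (4 * d * L)) ^ 2 * (2 ^ d * r ^ 2)) z y ∧
      ∀ᵐ x ∂(volume.restrict Ω), |H10.toL2 y x| ≤ |H10.toL2 z x| := by
  obtain ⟨y, hy, hgrad⟩ := T.exists_cutoff_mul hL hΩ hh hside hI z
  refine ⟨y, ⟨fun K hK => ?_, fun K hK hKI => ?_, fun K hK => ?_⟩, ?_⟩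
  · filter_upwards [hy] with x hx hxK
    rw [hx, T.cutoff_eq_zero hh hK hxK, zero_mul]
  · filter_upwards [hy] with x hx hxK
    rw [hx, T.cutoff_eq_one hK hKI hxK, one_mul]
  · set M := 3 ^ d * (4 * d * L)
    have hgrad_int := (integrable_norm_sq (H10.grad z)).integrableOn (s := cell K).const_mul 2
    have hval_int := ((Lp.memLp (H10.toL2 z)).integrable_sq.integrableOn (s := cell K)).const_mul
      (2 * (M / h) ^ 2)
    calc H10.energy y K
        ≤ ∫ x in cell K, (2 * ‖H10.grad z x‖ ^ 2 + 2 * (M / h) ^ 2 * H10.toL2 z x ^ 2)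
            ∂(volume.restrict Ω) :=
          integral_mono_ae (integrable_norm_sq _).integrableOn (hgrad_int.add hval_int)
            (ae_restrict_of_ae hgrad)
      _ = 2 * H10.energy z K +
            2 * (M / h) ^ 2 * ∫ x in cell K, H10.toL2 z x ^ 2 ∂(volume.restrict Ω) := by
          rw [integral_add hgrad_int hval_int, integral_const_mul, integral_const_mul]; rfl
      _ ≤ 2 * H10.energy z K + 2 * (M / h) ^ 2 * (2 ^ d * (r * h) ^ 2 * H10.energy z K) := by
          gcongr
          exact T.poincare_of_mem_kerProj hz hK (hdiam K hK)
      _ = (2 + 2 * M ^ 2 * (2 ^ d * r ^ 2)) * H10.energy z K := by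
          field_simp
  · filter_upwards [hy] with x hx
    rw [hx, abs_mul]
    exact mul_le_of_le_one_left (abs_nonneg _)
      ((abs_of_nonneg (T.cutoff_mem_Icc x).1).trans_le (T.cutoff_mem_Icc x).2)

theorem IsLocalization.mem_kerProj {T : Mesh Ω} {C : ℝ} {w : H10 Ω}
    (hw : T.IsLocalization I C z w) (hz : z ∈ T.kerProj p)
    (hmoments : ∀ K ∈ T.layer I, K ∉ I → ∀ q ∈ MvPolynomial.restrictDegree (Fin d) ℝ p,
      ∫ x in cell K, MvPolynomial.eval (fun i => x i) q * H10.toL2 w x ∂(volume.restrict Ω) = 0) :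
    w ∈ T.kerProj p := by
  refine T.mem_kerProj_of_setIntegral_eval_mul_eq_zero fun K hK q hq => ?_
  by_cases hKI : K ∈ I
  · rw [setIntegral_congr_ae (measurableSet_cell K) (g := fun _ => 0)
      ((hw.eq_zero K hKI).mono fun x hx hxK => by rw [hx hxK, mul_zero]), integral_zero]
  by_cases hKlayer : K ∈ T.layer I
  · exact hmoments K hKlayer hKI q hq
  · rw [← T.setIntegral_eval_mul_eq_zero_of_mem_kerProj hz hK hq]
    exact setIntegral_congr_ae (measurableSet_cell K)
      ((hw.eq_self K hK hKlayer).mono fun x hx hxK => by rw [hx hxK])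

theorem IsLocalization.sub {T : Mesh Ω} {C C' : ℝ} {y c : H10 Ω}
    (hy : T.IsLocalization I C z y) (hI : I ⊆ T.cells)
    (hc : ∀ K ∈ T.cells, K ∉ T.layer I ∨ K ∈ I →
      ∀ᵐ x ∂(volume.restrict Ω), x ∈ cell K → H10.toL2 c x = 0)
    (c_energy_le : ∀ K ∈ T.cells, H10.energy c K ≤ C' * H10.energy z K) :
    T.IsLocalization I (2 * C + 2 * C') z (y - c) := by
  refine ⟨fun K hK => ?_, fun K hK hKI => ?_, fun K hK => ?_⟩
  · rw [map_sub]
    filter_upwards [Lp.coeFn_sub (H10.toL2 y) (H10.toL2 c), hy.eq_zero K hK,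
      hc K (hI hK) (.inr hK)] with x hx hyx hcx hxK
    rw [hx, Pi.sub_apply, hyx hxK, hcx hxK, sub_zero]
  · rw [map_sub]
    filter_upwards [Lp.coeFn_sub (H10.toL2 y) (H10.toL2 c), hy.eq_self K hK hKI,
      hc K hK (.inl hKI)] with x hx hyx hcx hxK
    rw [hx, Pi.sub_apply, hyx hxK, hcx hxK, sub_zero]
  · linarith [H10.energy_sub_le y c K, hy.energy_le K hK, c_energy_le K hK]

theorem exists_isLocalization_mem_kerProj (T : Mesh Ω) {ι : Type*} [Fintype ι] [DecidableEq ι]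
    {e : Module.Basis ι ℝ (MvPolynomial.restrictDegree (Fin d) ℝ p)} {b : ι → 𝓓(unitCube d, ℝ)}
    (hb : IsDualBubbleFamily e b) (hL : ∀ t, |deriv Real.smoothTransition t| ≤ L)
    (hΩ : interior (closure Ω) = Ω) (hh : 0 < h)
    (hside : ∀ K ∈ T.cells, ∀ i, h ≤ K.upper i - K.lower i)
    (hdiam : ∀ K ∈ T.cells, Metric.diam (cell K) ≤ r * h) (hI : I ⊆ T.cells)
    (hz : z ∈ T.kerProj p) :
    ∃ w ∈ T.kerProj p, T.IsLocalization I (2 * (2 + 2 * (3 ^ d * (4 * d * L)) ^ 2 *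
      (2 ^ d * r ^ 2)) + 2 * (correctionConst e b * (2 ^ d * r ^ 2))) z w := by
  classical
  obtain ⟨y, hy, abs_le⟩ :=
    T.exists_isLocalization_abs_le hL (hΩ ▸ isOpen_interior) hh hside hdiam hI hz
  obtain ⟨c, moments_eq, c_eq_zero, c_energy_le⟩ := T.exists_momentCorrection hb hΩ
    (J := T.layer I \ I) (Finset.sdiff_subset.trans layer_subset) hh hside (H10.toL2 y)
  have hw := hy.sub hI (C' := correctionConst e b * (2 ^ d * r ^ 2))
    (fun K hK hKJ => c_eq_zero K hK (by grind)) fun K hK => ?_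
  · refine ⟨y - c, hw.mem_kerProj hz fun K hK hKI q hq => ?_, hw⟩
    rw [map_sub, integral_congr_ae (ae_restrict_of_ae ((Lp.coeFn_sub _ _).mono fun x hx => by
      rw [hx, Pi.sub_apply, mul_sub])), integral_sub (integrable_eval_mul K q _)
      (integrable_eval_mul K q _), moments_eq K (Finset.mem_sdiff.2 ⟨hK, hKI⟩) q hq, sub_self]
  have y_sq_le : ∫ x in cell K, H10.toL2 y x ^ 2 ∂(volume.restrict Ω) ≤
      2 ^ d * (r * h) ^ 2 * H10.energy z K :=
    (integral_mono_ae (Lp.memLp _).integrable_sq.integrableOn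
      (Lp.memLp _).integrable_sq.integrableOn
      (ae_restrict_of_ae (abs_le.mono fun x hx => sq_le_sq.2 hx))).trans
      (T.poincare_of_mem_kerProj hz hK (hdiam K hK))
  calc H10.energy c K
      ≤ correctionConst e b / h ^ 2 * (2 ^ d * (r * h) ^ 2 * H10.energy z K) :=
        (c_energy_le K hK).trans (mul_le_mul_of_nonneg_left y_sq_le
          (div_nonneg correctionConst_nonneg (sq_nonneg h)))
    _ = correctionConst e b * (2 ^ d * r ^ 2) * H10.energy z K := by field_simp

/-- The mesh admits localizations, with constant `C`, of the functions in the kernel of the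
projection around every set of elements, again in the kernel of the projection. -/
def HasLocalizations (T : Mesh Ω) (p : ℕ) (C : ℝ) : Prop :=
  ∀ I ⊆ T.cells, ∀ z ∈ T.kerProj p, ∃ w ∈ T.kerProj p, T.IsLocalization I C z w

theorem exists_hasLocalizations (d p : ℕ) (r : ℝ) : ∃ C : ℝ, 0 ≤ C ∧
    ∀ (Ω : Set (EuclideanSpace ℝ (Fin d))), interior (closure Ω) = Ω → ∀ (T : Mesh Ω) (h : ℝ),
      0 < h → (∀ K ∈ T.cells, ∀ i, h ≤ K.upper i - K.lower i) →
      (∀ K ∈ T.cells, Metric.diam (cell K) ≤ r * h) → T.HasLocalizations p C := by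
  classical
  obtain ⟨L, hL⟩ := exists_bound_deriv_smoothTransition
  let e := Module.finBasis ℝ (MvPolynomial.restrictDegree (Fin d) ℝ p)
  obtain ⟨b, hb⟩ := exists_isDualBubbleFamily e
  have := correctionConst_nonneg (e := e) (b := b)
  exact ⟨2 * (2 + 2 * (3 ^ d * (4 * d * L)) ^ 2 * (2 ^ d * r ^ 2)) +
    2 * (correctionConst e b * (2 ^ d * r ^ 2)), by positivity,
    fun Ω hΩ T h hh hside hdiam I hI z hz =>
      T.exists_isLocalization_mem_kerProj hb hL hΩ hh hside hdiam hI hz⟩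

end Mesh

/-! ### Decay of the energy away from an element -/

theorem H10.energy_nonneg (u : H10 Ω) (K : BoxIntegral.Box (Fin d)) : 0 ≤ H10.energy u K :=
  integral_nonneg fun _ => sq_nonneg _

theorem H10.energy_eq_zero {u : H10 Ω} {K : BoxIntegral.Box (Fin d)}
    (h : ∀ᵐ x ∂(volume.restrict Ω), x ∈ cell K → H10.toL2 u x = 0) : H10.energy u K = 0 := by
  rw [H10.energy, setIntegral_congr_ae (measurableSet_cell K) (g := fun _ => 0)
    ((H10.grad_eq_zero_on_cell u h).mono fun x hx hxK => by simp [hx hxK]), integral_zero]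

theorem Mesh.sum_energy (T : Mesh Ω) (u : H10 Ω) :
    ∑ K ∈ T.cells, H10.energy u K = ‖H10.grad u‖ ^ 2 := by
  rw [← real_inner_self_eq_norm_sq, L2.inner_def]
  simp only [real_inner_self_eq_norm_sq]
  exact T.sum_setIntegral_cell (integrable_norm_sq _)

open Classical in
/-- The energy of `u` on the elements that are not in `I`. -/
noncomputable def Mesh.energyOff (T : Mesh Ω) (I : Finset (BoxIntegral.Box (Fin d)))
    (u : H10 Ω) : ℝ :=
  ∑ K ∈ T.cells \ I, H10.energy u K

theorem Mesh.energyOff_le (T : Mesh Ω) (I : Finset (BoxIntegral.Box (Fin d))) (u : H10 Ω) :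
    T.energyOff I u ≤ ‖H10.grad u‖ ^ 2 := by
  classical
  rw [← T.sum_energy]
  exact Finset.sum_le_sum_of_subset_of_nonneg Finset.sdiff_subset
    fun K _ _ => H10.energy_nonneg u K

theorem Mesh.IsLocalization.norm_grad_sq_le {T : Mesh Ω}
    {I : Finset (BoxIntegral.Box (Fin d))} {C : ℝ} {z w : H10 Ω}
    (hw : T.IsLocalization I C z w) (hI : I ⊆ T.cells) :
    ‖H10.grad w‖ ^ 2 ≤ C * T.energyOff I z := by
  classical
  calc ‖H10.grad w‖ ^ 2
      = ∑ K ∈ T.cells \ I, H10.energy w K := by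
        rw [← T.sum_energy, ← Finset.sum_sdiff hI,
          Finset.sum_eq_zero fun K hK => H10.energy_eq_zero (hw.eq_zero K hK), add_zero]
    _ ≤ C * T.energyOff I z := by
        rw [Mesh.energyOff, Finset.mul_sum]
        exact Finset.sum_le_sum fun K hK => hw.energy_le K (Finset.sdiff_subset hK)

namespace Coefficient

variable {α β : ℝ} (A : Coefficient Ω α β)

theorem form_eq_univ {S : Set (EuclideanSpace ℝ (Fin d))} (u : H10 Ω) {w : H10 Ω}
    (h : ∀ᵐ x ∂(volume.restrict Ω), x ∉ S → H10.grad w x = 0) :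
    A.form S u w = A.form univ u w := by
  rw [form, form, Measure.restrict_univ]
  refine setIntegral_eq_integral_of_ae_compl_eq_zero ?_
  filter_upwards [h] with x hx hxS
  rw [hx hxS, inner_zero_right, mul_zero]

theorem sum_form_cell (T : Mesh Ω) (u w : H10 Ω) :
    ∑ K ∈ T.cells, A.form (cell K) u w = A.form univ u w := by
  rw [form, Measure.restrict_univ]
  exact T.sum_setIntegral_cell (A.integrable_form u w)

variable {K : BoxIntegral.Box (Fin d)} {u w : H10 Ω}

theorem form_cell_eq_zero (h : ∀ᵐ x ∂(volume.restrict Ω), x ∈ cell K → H10.toL2 w x = 0) :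
    A.form (cell K) u w = 0 := by
  rw [form, setIntegral_congr_ae (measurableSet_cell K) (g := fun _ => 0)
    ((H10.grad_eq_zero_on_cell w h).mono fun x hx hxK => by
      rw [hx hxK, inner_zero_right, mul_zero]), integral_zero]

theorem form_cell_congr_right {w' : H10 Ω}
    (h : ∀ᵐ x ∂(volume.restrict Ω), x ∈ cell K → H10.toL2 w x = H10.toL2 w' x) :
    A.form (cell K) u w = A.form (cell K) u w' :=
  setIntegral_congr_ae (measurableSet_cell K)
    ((H10.grad_eq_on_cell h).mono fun x hx hxK => by rw [hx hxK])

theorem mul_energy_le_form_self : α * H10.energy u K ≤ A.form (cell K) u u := by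
  rw [H10.energy, ← integral_const_mul]
  refine integral_mono_ae ((integrable_norm_sq _).integrableOn.const_mul _)
    (A.integrable_form u u).integrableOn (ae_restrict_of_ae ?_)
  filter_upwards [A.bounds] with x hx
  rw [real_inner_self_eq_norm_sq]
  exact mul_le_mul_of_nonneg_right hx.1 (sq_nonneg _)

theorem form_self_le_mul_energy : A.form (cell K) u u ≤ β * H10.energy u K := by
  rw [H10.energy, ← integral_const_mul]
  refine integral_mono_ae (A.integrable_form u u).integrableOn
    ((integrable_norm_sq _).integrableOn.const_mul _) (ae_restrict_of_ae ?_)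
  filter_upwards [A.bounds] with x hx
  rw [real_inner_self_eq_norm_sq]
  exact mul_le_mul_of_nonneg_right hx.2 (sq_nonneg _)

theorem form_add_self (S : Set (EuclideanSpace ℝ (Fin d))) (u w : H10 Ω) :
    A.form S (u + w) (u + w) = A.form S u u + 2 * A.form S u w + A.form S w w := by
  rw [A.form_add, A.form_comm S u (u + w), A.form_comm S w (u + w), A.form_add, A.form_add,
    A.form_comm S w u]
  ring

theorem neg_form_cell_le :
    -A.form (cell K) u w ≤ β / 2 * (H10.energy u K + H10.energy w K) := by
  have sum_nonneg := A.form_self_nonneg (cell K) (u + w)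
  rw [A.form_add_self] at sum_nonneg
  linarith [A.form_self_le_mul_energy (K := K) (u := u),
    A.form_self_le_mul_energy (K := K) (u := w)]

end Coefficient

namespace Mesh

variable {T : Mesh Ω} {α β C : ℝ} {I : Finset (BoxIntegral.Box (Fin d))} {z w : H10 Ω}

-- Test the equation for `z` with the localization `w`: outside the layer around `I` this gives the
-- energy of `z`, and only the elements of the layer that are not in `I` contribute an error.
theorem IsLocalization.mul_energyOff_layer_le (hw : T.IsLocalization I C z w) (hI : I ⊆ T.cells)
    (A : Coefficient Ω α β) (hβ : 0 ≤ β) (horth : A.form univ z w = 0) :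
    α * T.energyOff (T.layer I) z ≤
      β * (1 + C) / 2 * (T.energyOff I z - T.energyOff (T.layer I) z) := by
  classical
  have layer_le : ∀ K ∈ T.layer I \ I,
      -A.form (cell K) z w ≤ β * (1 + C) / 2 * H10.energy z K := fun K hK =>
    calc -A.form (cell K) z w
        ≤ β / 2 * (H10.energy z K + H10.energy w K) := A.neg_form_cell_le
      _ ≤ β / 2 * (H10.energy z K + C * H10.energy z K) := by
        gcongr
        exact hw.energy_le K (layer_subset (Finset.sdiff_subset hK))
      _ = β * (1 + C) / 2 * H10.energy z K := by ring
  have form_sum : ∑ K ∈ T.cells \ T.layer I, A.form (cell K) z w =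
      ∑ K ∈ T.layer I \ I, -A.form (cell K) z w := by
    have on_I : ∑ K ∈ I, A.form (cell K) z w = 0 :=
      Finset.sum_eq_zero fun K hK => A.form_cell_eq_zero (hw.eq_zero K hK)
    rw [← A.sum_form_cell T, ← Finset.sum_sdiff layer_subset,
      ← Finset.sum_sdiff (subset_layer hI), on_I, add_zero] at horth
    rw [Finset.sum_neg_distrib]
    exact eq_neg_of_add_eq_zero_left horth
  have energyOff_sub : ∑ K ∈ T.layer I \ I, H10.energy z K =
      T.energyOff I z - T.energyOff (T.layer I) z := by
    rw [energyOff, energyOff, Finset.sum_sdiff_eq_sub hI, Finset.sum_sdiff_eq_sub layer_subset,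
      Finset.sum_sdiff_eq_sub (subset_layer hI)]
    ring
  calc α * T.energyOff (T.layer I) z
      ≤ ∑ K ∈ T.cells \ T.layer I, A.form (cell K) z w := by
        rw [energyOff, Finset.mul_sum]
        refine Finset.sum_le_sum fun K hK => ?_
        rw [Finset.mem_sdiff] at hK
        rw [A.form_cell_congr_right (hw.eq_self K hK.1 hK.2)]
        exact A.mul_energy_le_form_self
    _ = ∑ K ∈ T.layer I \ I, -A.form (cell K) z w := form_sum
    _ ≤ ∑ K ∈ T.layer I \ I, β * (1 + C) / 2 * H10.energy z K := Finset.sum_le_sum layer_le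
    _ = β * (1 + C) / 2 * (T.energyOff I z - T.energyOff (T.layer I) z) := by
        rw [← Finset.mul_sum, energyOff_sub]

end Mesh

/-- The factor by which the energy of a corrector decays from one layer of elements to the next,
for localizations with constant `C`. -/
noncomputable def decayRate (α β C : ℝ) : ℝ :=
  β * (1 + C) / (2 * α + β * (1 + C))

theorem decayRate_pos {α β C : ℝ} (hα : 0 < α) (hβ : 0 < β) (hC : 0 ≤ C) :
    0 < decayRate α β C := by
  unfold decayRate; positivity

theorem decayRate_lt_one {α β C : ℝ} (hα : 0 < α) (hβ : 0 < β) (hC : 0 ≤ C) :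
    decayRate α β C < 1 := by
  rw [decayRate, div_lt_one (by positivity)]
  linarith

/-- The elements of the patch of order `ℓ` around the element `G`. -/
noncomputable def Mesh.patchCells (T : Mesh Ω) (G : BoxIntegral.Box (Fin d)) :
    ℕ → Finset (BoxIntegral.Box (Fin d))
  | 0 => {G}
  | ℓ + 1 => T.layer (T.patchCells G ℓ)

namespace Mesh

variable {T : Mesh Ω} {G : BoxIntegral.Box (Fin d)}

theorem patchCells_subset (hG : G ∈ T.cells) : ∀ ℓ, T.patchCells G ℓ ⊆ T.cells
  | 0 => Finset.singleton_subset_iff.2 hG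
  | _ + 1 => layer_subset

theorem mem_patchCells (hG : G ∈ T.cells) : ∀ ℓ, G ∈ T.patchCells G ℓ
  | 0 => Finset.mem_singleton_self G
  | ℓ + 1 => subset_layer (patchCells_subset hG ℓ) (mem_patchCells hG ℓ)

theorem patch_cell_eq_biUnion (T : Mesh Ω) (G : BoxIntegral.Box (Fin d)) (ℓ : ℕ) :
    T.patch (cell G) ℓ = ⋃ K ∈ T.patchCells G ℓ, cell K := by
  induction ℓ with
  | zero => simp only [patch, patchCells, (isClosed_cell G).closure_eq, Finset.mem_singleton,
      iUnion_iUnion_eq_left]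
  | succ ℓ ih =>
    have closure_patch : closure (T.patch (cell G) ℓ) = ⋃ K ∈ T.patchCells G ℓ, cell K := by
      rw [(T.isClosed_patch _ _).closure_eq, ih]
    ext x
    simp only [patch, nbhd, patchCells, mem_iUnion, exists_prop, mem_layer, closure_patch,
      mem_ofPred_eq, iUnion_inter, nonempty_iUnion]

variable {p : ℕ} {z w : H10 Ω} {C : ℝ}

theorem IsLocalization.sub_mem_kerProjOn_patch {ℓ : ℕ}
    (hw : T.IsLocalization (T.patchCells G ℓ) C z w) (hwp : w ∈ T.kerProj p)
    (hz : z ∈ T.kerProj p) : z - w ∈ T.kerProjOn p (T.patch (cell G) (ℓ + 1)) := by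
  refine ⟨Submodule.sub_mem _ hz hwp, T.ae_of_forall_cell fun K hK => ?_⟩
  by_cases hKℓ : K ∈ T.patchCells G (ℓ + 1)
  · refine .of_forall fun x hxK hx => absurd ?_ hx
    rw [patch_cell_eq_biUnion]
    exact mem_biUnion hKℓ hxK
  · rw [map_sub]
    filter_upwards [hw.eq_self K hK hKℓ, Lp.coeFn_sub (H10.toL2 z) (H10.toL2 w)]
      with x hx hsub hxK _
    rw [hsub, Pi.sub_apply, hx hxK, sub_self]

theorem mem_kerProjOn_closure (hw : w ∈ T.kerProj p) : w ∈ T.kerProjOn p (closure Ω) :=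
  ⟨hw, T.ae_of_forall_cell fun _ hK => .of_forall fun _ hxK hx => absurd
    (T.iUnion_cell ▸ mem_biUnion (t := fun K => cell K) hK hxK) hx⟩

end Mesh

namespace IsEnrichedCorrection

variable {T : Mesh Ω} {α β C : ℝ} {A : Coefficient Ω α β} {p : ℕ}
  {S : Set (EuclideanSpace ℝ (Fin d))} {G : BoxIntegral.Box (Fin d)} {v : L2 Ω} {y z w : H10 Ω}

theorem form_univ_eq (hz : IsEnrichedCorrection A T p S G v z) (hS : IsClosed S)
    (hw : w ∈ T.kerProjOn p S) :
    A.form univ z w = -∫ x in cell G, v x * H10.toL2 w x ∂(volume.restrict Ω) := by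
  rw [← A.form_eq_univ z (H10.grad_eq_zero w hS hw.2), hz.2 w hw]

theorem form_univ_eq_zero (hz : IsEnrichedCorrection A T p (closure Ω) G v z)
    (hw : w ∈ T.kerProj p)
    (h : ∀ᵐ x ∂(volume.restrict Ω), x ∈ cell G → H10.toL2 w x = 0) : A.form univ z w = 0 := by
  rw [hz.form_univ_eq isClosed_closure (Mesh.mem_kerProjOn_closure hw),
    setIntegral_congr_ae (measurableSet_cell G) (g := fun _ => 0)
      (h.mono fun x hx hxG => by rw [hx hxG, mul_zero]), integral_zero, neg_zero]

theorem energyOff_patchCells_succ_le (hz : IsEnrichedCorrection A T p (closure Ω) G v z)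
    (hG : G ∈ T.cells) (hT : T.HasLocalizations p C) (hC : 0 ≤ C) (hβ : 0 < β) (ℓ : ℕ) :
    T.energyOff (T.patchCells G (ℓ + 1)) z ≤
      decayRate α β C * T.energyOff (T.patchCells G ℓ) z := by
  have hpatch := Mesh.patchCells_subset hG ℓ
  obtain ⟨w, hwp, hw⟩ := hT _ hpatch z hz.1.1
  have horth := hz.form_univ_eq_zero hwp (hw.eq_zero G (Mesh.mem_patchCells hG ℓ))
  have hα := A.pos
  rw [decayRate, div_mul_eq_mul_div, le_div_iff₀ (by positivity), Mesh.patchCells]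
  linarith [hw.mul_energyOff_layer_le hpatch A hβ.le horth]

theorem energyOff_patchCells_le (hz : IsEnrichedCorrection A T p (closure Ω) G v z)
    (hG : G ∈ T.cells) (hT : T.HasLocalizations p C) (hC : 0 ≤ C) (hβ : 0 < β) (ℓ : ℕ) :
    T.energyOff (T.patchCells G ℓ) z ≤ decayRate α β C ^ ℓ * ‖H10.grad z‖ ^ 2 := by
  induction ℓ with
  | zero => rw [pow_zero, one_mul]; exact T.energyOff_le _ z
  | succ ℓ ih =>
    rw [pow_succ', mul_assoc]
    exact (hz.energyOff_patchCells_succ_le hG hT hC hβ ℓ).trans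
      (mul_le_mul_of_nonneg_left ih (decayRate_pos A.pos hβ hC).le)

/-! ### Localization error of the correctors -/

theorem form_univ_sub_eq_zero (hy : IsEnrichedCorrection A T p S G v y) (hS : IsClosed S)
    (hz : IsEnrichedCorrection A T p (closure Ω) G v z) (hw : w ∈ T.kerProjOn p S) :
    A.form univ (y - z) w = 0 := by
  have form_sub : A.form univ (y - z) w = A.form univ y w - A.form univ z w :=
    LinearMap.map_sub₂ (A.bilinForm univ) y z w
  rw [form_sub, hy.form_univ_eq hS hw,
    hz.form_univ_eq isClosed_closure (Mesh.mem_kerProjOn_closure hw.1), sub_self]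

theorem mul_norm_grad_sub_sq_le (hy : IsEnrichedCorrection A T p S G v y) (hS : IsClosed S)
    (hz : IsEnrichedCorrection A T p (closure Ω) G v z) (hw : w ∈ T.kerProjOn p S) :
    α * ‖H10.grad (y - z)‖ ^ 2 ≤ β * ‖H10.grad (w - z)‖ ^ 2 := by
  have horth := hy.form_univ_sub_eq_zero hS hz (Submodule.sub_mem _ hw hy.1)
  calc α * ‖H10.grad (y - z)‖ ^ 2
      ≤ A.form univ (y - z) (y - z) :=
        A.le_form_self univ (y - z) isClosed_univ (.of_forall fun x hx => absurd (mem_univ x) hx)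
    _ ≤ A.form univ (y - z + (w - y)) (y - z + (w - y)) := by
        rw [A.form_add_self, horth]
        linarith [A.form_self_nonneg univ (w - y)]
    _ ≤ β * ‖H10.grad (w - z)‖ ^ 2 := by
        rw [add_comm, sub_add_sub_cancel]
        exact A.form_self_le univ (w - z)

theorem mul_norm_grad_sub_sq_le_decayRate_pow {ℓ : ℕ}
    (hy : IsEnrichedCorrection A T p (T.patch (cell G) ℓ) G v y)
    (hz : IsEnrichedCorrection A T p (closure Ω) G v z) (hG : G ∈ T.cells)
    (hT : T.HasLocalizations p C) (hC : 0 ≤ C) (hβ : 0 < β) :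
    α * ‖H10.grad (y - z)‖ ^ 2 ≤
      β * (1 + C) / decayRate α β C * decayRate α β C ^ ℓ * ‖H10.grad z‖ ^ 2 := by
  have rate_pos : 0 < decayRate α β C := decayRate_pos A.pos hβ hC
  cases ℓ with
  | zero =>
    have comparison := hy.mul_norm_grad_sub_sq_le (T.isClosed_patch _ _) hz (Submodule.zero_mem _)
    rw [zero_sub, map_neg, norm_neg] at comparison
    refine comparison.trans (mul_le_mul_of_nonneg_right ?_ (sq_nonneg _))
    rw [pow_zero, mul_one, le_div_iff₀ rate_pos]
    nlinarith [decayRate_lt_one A.pos hβ hC]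
  | succ ℓ =>
    have hpatch := Mesh.patchCells_subset hG ℓ
    obtain ⟨w, hwp, hw⟩ := hT _ hpatch z hz.1.1
    have comparison := hy.mul_norm_grad_sub_sq_le (T.isClosed_patch _ _) hz
      (hw.sub_mem_kerProjOn_patch hwp hz.1.1)
    rw [sub_sub_cancel_left, map_neg, norm_neg] at comparison
    calc α * ‖H10.grad (y - z)‖ ^ 2
        ≤ β * ‖H10.grad w‖ ^ 2 := comparison
      _ ≤ β * (C * (decayRate α β C ^ ℓ * ‖H10.grad z‖ ^ 2)) := by
          gcongr
          exact (hw.norm_grad_sq_le hpatch).trans (mul_le_mul_of_nonneg_left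
            (hz.energyOff_patchCells_le hG hT hC hβ ℓ) hC)
      _ ≤ β * ((1 + C) * (decayRate α β C ^ ℓ * ‖H10.grad z‖ ^ 2)) := by
          gcongr
          exact le_add_of_nonneg_left zero_le_one
      _ = β * (1 + C) / decayRate α β C * decayRate α β C ^ (ℓ + 1) * ‖H10.grad z‖ ^ 2 := by
          field_simp
          ring

end IsEnrichedCorrection

theorem le_sqrt_mul_exp_mul_of_sq_le {a b c θ : ℝ} {ℓ : ℕ} (hθ : 0 < θ) (hb : 0 ≤ b) (hc : 0 ≤ c)
    (h : a ^ 2 ≤ b * θ ^ ℓ * c ^ 2) :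
    a ≤ √b * Real.exp (-(-Real.log θ / 2 * ℓ)) * c := by
  have exp_sq : Real.exp (-(-Real.log θ / 2 * ℓ)) ^ 2 = θ ^ ℓ := by
    rw [← Real.exp_nat_mul, ← Real.rpow_natCast θ ℓ, Real.rpow_def_of_pos hθ]
    congr 1
    push_cast
    ring
  refine le_of_sq_le_sq (h.trans_eq ?_) (by positivity)
  rw [mul_pow, mul_pow, exp_sq, Real.sq_sqrt hb]

theorem diam_cell_pos [NeZero d] (K : BoxIntegral.Box (Fin d)) : 0 < Metric.diam (cell K) := by
  refine Metric.diam_pos ⟨WithLp.toLp 2 K.lower, fun i => ⟨le_rfl, K.lower_le_upper i⟩,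
    WithLp.toLp 2 K.upper, fun i => ⟨K.lower_le_upper i, le_rfl⟩, fun h => ?_⟩
    (isCompact_cell K).isBounded
  exact (K.lower_lt_upper 0).ne (congrFun (congrArg WithLp.ofLp h) 0)

theorem Mesh.exists_uniform_size [NeZero d] {T : Mesh Ω} {σ τ : ℝ} (hσ : T.IsShapeRegular σ)
    (hτ : T.IsQuasiUniform τ) (hT : T.cells.Nonempty) : ∃ h : ℝ, 0 < h ∧
      (∀ K ∈ T.cells, ∀ i, h ≤ K.upper i - K.lower i) ∧
      ∀ K ∈ T.cells, Metric.diam (cell K) ≤ τ ^ 2 * σ * h := by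
  obtain ⟨G, hG⟩ := hT
  have σ_pos : 0 < σ :=
    pos_of_mul_pos_left ((diam_cell_pos G).trans_le (hσ G hG 0)) (side_pos G 0).le
  have τ_pos : 0 < τ :=
    pos_of_mul_pos_left ((diam_cell_pos G).trans_le (hτ G hG G hG)) (diam_cell_pos G).le
  have G_pos := diam_cell_pos G
  refine ⟨Metric.diam (cell G) / (τ * σ), by positivity, fun K hK i => ?_, fun K hK => ?_⟩
  · rw [div_le_iff₀ (by positivity)]
    calc Metric.diam (cell G)
        ≤ τ * Metric.diam (cell K) := hτ K hK G hG
      _ ≤ τ * (σ * (K.upper i - K.lower i)) := mul_le_mul_of_nonneg_left (hσ K hK i) τ_pos.le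
      _ = (K.upper i - K.lower i) * (τ * σ) := by ring
  · refine (hτ G hG K hK).trans_eq ?_
    field_simp

theorem Coefficient.bound_le {α β : ℝ} (A : Coefficient Ω α β) (hΩ : volume Ω ≠ 0) : α ≤ β := by
  have : (ae (volume.restrict Ω)).NeBot := ae_neBot.2 (Measure.restrict_eq_zero.not.2 hΩ)
  obtain ⟨x, hx⟩ := A.bounds.exists
  exact hx.1.trans hx.2

end LOD

theorem mainTheorem5_general (d : ℕ) [NeZero d] (p : ℕ) (α β σ τ : ℝ) :
    ∃ C₀ > 0, ∃ C > 0, ∀ (Ω : Set (EuclideanSpace ℝ (Fin d))), interior (closure Ω) = Ω →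
      ∀ (A : LOD.Coefficient Ω α β) (T : LOD.Mesh Ω), T.IsShapeRegular σ → T.IsQuasiUniform τ →
      ∀ G ∈ T.cells, ∀ (ℓ : ℕ) (v : LOD.L2 Ω),
        ‖LOD.H10.grad (LOD.localEnrichedCorrector A T p G ℓ v - LOD.enrichedCorrector A T p G v)‖
          ≤ C₀ * Real.exp (-(C * ℓ)) * ‖LOD.H10.grad (LOD.enrichedCorrector A T p G v)‖ := by
  by_cases hαβ : 0 < α ∧ α ≤ β
  · obtain ⟨hα, hβ⟩ : 0 < α ∧ 0 < β := ⟨hαβ.1, hαβ.1.trans_le hαβ.2⟩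
    obtain ⟨M, hM, hloc⟩ := LOD.Mesh.exists_hasLocalizations d p (τ ^ 2 * σ)
    set θ := LOD.decayRate α β M
    have hθ : 0 < θ := LOD.decayRate_pos hα hβ hM
    refine ⟨√(β * (1 + M) / θ / α), by positivity, -Real.log θ / 2,
      by linarith [Real.log_neg hθ (LOD.decayRate_lt_one hα hβ hM)], ?_⟩
    intro Ω hΩ A T hσ hτ G hG ℓ v
    obtain ⟨h, hh, hside, hdiam⟩ := LOD.Mesh.exists_uniform_size hσ hτ ⟨G, hG⟩
    refine LOD.le_sqrt_mul_exp_mul_of_sq_le hθ (by positivity) (norm_nonneg _) ?_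
    have error_le := (LOD.localEnrichedCorrector_spec A T p G ℓ v)
      |>.mul_norm_grad_sub_sq_le_decayRate_pow (LOD.enrichedCorrector_spec A T p G v) hG
        (hloc Ω hΩ T h hh hside hdiam) hM hβ
    rw [div_mul_eq_mul_div, div_mul_eq_mul_div, le_div_iff₀' hα]
    exact error_le
  · refine ⟨1, one_pos, 1, one_pos, fun Ω hΩ A T _ _ G hG => absurd ⟨A.pos, A.bound_le ?_⟩ hαβ⟩
    exact ((isOpen_interior.measure_pos volume (LOD.nonempty_interior_cell G)).trans_le
      (measure_mono (T.interior_cell_subset hΩ hG))).ne'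

theorem mainTheorem5 {d : ℕ} [NeZero d] (Ω : Set (EuclideanSpace ℝ (Fin d)))
    (hΩ : LOD.IsLipschitzDomain Ω) (p : ℕ) (α β σ τ : ℝ) :
    ∃ C₀ > 0, ∃ C > 0, ∀ (A : LOD.Coefficient Ω α β) (T : LOD.Mesh Ω),
      T.IsShapeRegular σ → T.IsQuasiUniform τ →
      ∀ G ∈ T.cells, ∀ ℓ : ℕ, 1 ≤ ℓ → ∀ v : LOD.L2 Ω,
        ‖LOD.H10.grad (LOD.localEnrichedCorrector A T p G ℓ v - LOD.enrichedCorrector A T p G v)‖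
          ≤ C₀ * Real.exp (-(C * ℓ)) * ‖LOD.H10.grad (LOD.enrichedCorrector A T p G v)‖ := by
  obtain ⟨C₀, hC₀, C, hC, h⟩ := mainTheorem5_general d p α β σ τ
  exact ⟨C₀, hC₀, C, hC, fun A T hσ hτ G hG ℓ _ => h Ω hΩ.interior_closure_eq A T hσ hτ G hG ℓ⟩
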